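/- Let $w:[0,\infty)\to[0,\infty)$ be measurable, strictly increasing and right-continuous with $w(0)=0$ and $w(1)=1$. Assume that $$\int_1^\infty\frac{du}{w(u)}<\infty$$ and that there is $\rho>0$ such that the map $t\mapsto w(t)^{\rho}\int_t^\infty\frac{ds}{w(s)}$ is non-increasing on $[1,\infty)$. Let $\widetilde X=(\widetilde X_t)_{t\ge0}$ be the vertex-reinforced jump process VRJP$(w)$ on the two connected vertices $\{0,1\}$, with $\widetilde X_0=0$, all initial weights equal to one, and local times $$\widetilde L(v,t)=1+\int_0^t \mathbf 1_{\{\widetilde X_s=v\}}\,ds,\qquad v\in\{0,1\};$$ that is, at time $t$ the process jumps to the other vertex $v\neq\widetilde X_t$ at rate $w(\widetilde L(v,t))$. It is realised by the following canonical construction. To every ordered pair $(i,j)$ of neighbouring integers attach exponential random variables $\chi^{(i,j)}_n$, $n\ge1$, of mean one, all of them independent. Start at $0$ at time $0$, with initial weight $1$ at $0$ and $1$ and initial weight $0$ at all other integers. Whenever the process arrives at a vertex $i$, let $L(j)$, for each neighbour $j=i\pm1$, be the current local time (including the initial weight) at $j$, and let $m_j$ be the number of jumps from $i$ to $j$ made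 so far. The process stays at $i$ for the time $\min_{j=i\pm1}\chi^{(i,j)}_{m_j+1}/w(L(j))$ (with $a/0=\infty$ for $a>0$) and then jumps to the neighbour that attains the minimum. (Since $w(0)=0$, it almost surely never leaves $\{0,1\}$.) Define $$Z_t=\int_1^{\widetilde L(0,t)}\frac{du}{w(u)}-\int_1^{\widetilde L(1,t)}\frac{du}{w(u)}-\frac{\mathbf 1_{\{\widetilde X_t=1\}}}{w(\widetilde L(0,t))\,w(\widetilde L(1,t))}.$$ Then $Z_t$ converges almost surely, as $t\to\infty$, to a finite random variable $Z_\infty$, and $$\mathbb P(Z_\infty=\varrho)=0\qquad\text{for every real }\varrho.$$ Moreover, with $\widetilde L(v,\infty)=\lim_{t\to\infty}\widetilde L(v,t)\in[0,\infty]$, the random variable $\min(\widetilde L(0,\infty),\widetilde L(1,\infty))$ is almost surely finite and its distribution has no atoms. -/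

import Mathlib

open MeasureTheory ProbabilityTheory Filter Topology
open scoped ENNReal

namespace VRJP

/-- Standing assumption on the weight function `w : [0,∞) → [0,∞)`: it is (strictly) increasing,
right-continuous, and normalised by `w 0 = 0`, `w 1 = 1`.  Nonnegativity and Borel measurability
on `[0,∞)` follow from monotonicity; the values of `w` on the negative half-line are irrelevant. -/
structure WeightAssumption (w : ℝ → ℝ) : Prop where
  strictMonoOn : StrictMonoOn w (Set.Ici 0)
  rightContinuous : ∀ x, 0 ≤ x → ContinuousWithinAt w (Set.Ici x) x
  map_zero : w 0 = 0
  map_one : w 1 = 1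

/-- Oriented edges of the nearest neighbour graph on `ℤ`. -/
abbrev OrientedEdge : Type := {e : ℤ × ℤ // |e.1 - e.2| = 1}

/-- State of the skeleton after a number of jumps: current vertex, current time, local times
(initial weights included), and the number of jumps made so far along each ordered pair. -/
structure SkeletonState where
  pos : ℤ
  time : ℝ≥0∞
  loc : ℤ → ℝ≥0∞
  jumps : ℤ × ℤ → ℕ

/-- Candidate waiting time for the jump from the current vertex `i` to `j`: the first unused
exponential variable of the ordered pair `(i, j)` divided by `w` of the local time at `j`
(with `a / 0 = ∞` for `a > 0`). -/
noncomputable def waitingTime (w : ℝ → ℝ) (χ : ℤ × ℤ → ℕ → ℝ) (s : SkeletonState) (j : ℤ) :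
    ℝ≥0∞ :=
  ENNReal.ofReal (χ (s.pos, j) (s.jumps (s.pos, j))) / ENNReal.ofReal (w (s.loc j).toReal)

/-- The neighbour to which the next jump goes (the one with the smaller candidate waiting time). -/
noncomputable def nextPos (w : ℝ → ℝ) (χ : ℤ × ℤ → ℕ → ℝ) (s : SkeletonState) : ℤ :=
  if waitingTime w χ s (s.pos + 1) ≤ waitingTime w χ s (s.pos - 1) then s.pos + 1 else s.pos - 1

/-- The time spent at the current vertex before the next jump. -/
noncomputable def holdingTime (w : ℝ → ℝ) (χ : ℤ × ℤ → ℕ → ℝ) (s : SkeletonState) : ℝ≥0∞ :=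
  min (waitingTime w χ s (s.pos - 1)) (waitingTime w χ s (s.pos + 1))

/-- One jump of the skeleton. -/
noncomputable def step (w : ℝ → ℝ) (χ : ℤ × ℤ → ℕ → ℝ) (s : SkeletonState) : SkeletonState where
  pos := nextPos w χ s
  time := s.time + holdingTime w χ s
  loc := Function.update s.loc s.pos (s.loc s.pos + holdingTime w χ s)
  jumps := Function.update s.jumps (s.pos, nextPos w χ s) (s.jumps (s.pos, nextPos w χ s) + 1)

/-- The skeleton of the canonical VRJP(`ℓ`, `w`) on `ℤ` started from `x₀`, driven by the waiting
times `χ (i, j) n` (indexed from `n = 0`). -/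
noncomputable def skeleton (w : ℝ → ℝ) (ℓ : ℤ → ℝ) (x₀ : ℤ) (χ : ℤ × ℤ → ℕ → ℝ) :
    ℕ → SkeletonState
  | 0 => ⟨x₀, 0, fun v => ENNReal.ofReal (ℓ v), fun _ => 0⟩
  | n + 1 => step w χ (skeleton w ℓ x₀ χ n)

/-- The canonical process `X_t = ∑ₙ X_{τₙ} 1{τₙ ≤ t < τₙ₊₁}`, for `t ≥ 0`. -/
noncomputable def canonicalProcess (w : ℝ → ℝ) (ℓ : ℤ → ℝ) (x₀ : ℤ) (χ : ℤ × ℤ → ℕ → ℝ)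
    (t : ℝ) : ℤ :=
  ∑' n : ℕ, {s : ℝ | (skeleton w ℓ x₀ χ n).time ≤ ENNReal.ofReal s ∧
      ENNReal.ofReal s < (skeleton w ℓ x₀ χ (n + 1)).time}.indicator
    (fun _ => (skeleton w ℓ x₀ χ n).pos) t

/-- Local time at `v` up to time `t` of a trajectory `X`, plus the initial weight:
`ℓ v + ∫₀ᵗ 1{X_s = v} ds`. -/
noncomputable def localTime (ℓ : ℤ → ℝ) (X : ℝ → ℤ) (v : ℤ) (t : ℝ) : ℝ :=
  ℓ v + ∫ s in (0 : ℝ)..t, {r : ℝ | X r = v}.indicator (fun _ => (1 : ℝ)) s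

/-- The total local time `L(v, ∞)`, with values in `[0, ∞]`. -/
noncomputable def totalLocalTime (ℓ : ℤ → ℝ) (X : ℝ → ℤ) (v : ℤ) : ℝ≥0∞ :=
  ⨆ t : Set.Ici (0 : ℝ), ENNReal.ofReal (localTime ℓ X v t)

/-- Initial weights of the extension of VRJP(`w`) to `{0, 1}`: one on `{0, 1}`, zero elsewhere. -/
noncomputable def twoVertexWeights : ℤ → ℝ :=
  ({0, 1} : Set ℤ).indicator (fun _ => 1)

/-- The VRJP(`w`) on the two vertices `{0, 1}`, started from `0`: the extension to `{0, 1}` of the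
canonical VRJP(`w`) on `ℤ`. -/
noncomputable def twoVertexProcess (w : ℝ → ℝ) (χ : ℤ × ℤ → ℕ → ℝ) : ℝ → ℤ :=
  canonicalProcess w twoVertexWeights 0 χ

/-- Local times of the VRJP(`w`) on `{0, 1}`. -/
noncomputable def twoVertexLocalTime (w : ℝ → ℝ) (χ : ℤ × ℤ → ℕ → ℝ) (v : ℤ) (t : ℝ) : ℝ :=
  localTime twoVertexWeights (twoVertexProcess w χ) v t

/-- `min (L(0, ∞), L(1, ∞))` for the VRJP(`w`) on `{0, 1}`. -/
noncomputable def minTotalLocalTime (w : ℝ → ℝ) (χ : ℤ × ℤ → ℕ → ℝ) : ℝ≥0∞ :=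
  min (totalLocalTime twoVertexWeights (twoVertexProcess w χ) 0)
    (totalLocalTime twoVertexWeights (twoVertexProcess w χ) 1)

/-- The process
`Z_t = ∫₁^{L(0,t)} du / w u - ∫₁^{L(1,t)} du / w u - 1{X_t = 1} / (w (L(0,t)) * w (L(1,t)))`. -/
noncomputable def Z (w : ℝ → ℝ) (χ : ℤ × ℤ → ℕ → ℝ) (t : ℝ) : ℝ :=
  (∫ u in (1 : ℝ)..(twoVertexLocalTime w χ 0 t), 1 / w u)
    - (∫ u in (1 : ℝ)..(twoVertexLocalTime w χ 1 t), 1 / w u)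
    - {r : ℝ | twoVertexProcess w χ r = 1}.indicator (fun _ => (1 : ℝ)) t
      / (w (twoVertexLocalTime w χ 0 t) * w (twoVertexLocalTime w χ 1 t))

/-- The limit `Z_∞` of `Z_t` as `t → ∞` (whose almost sure existence is part of what is to be
shown). -/
noncomputable def Zinfty (w : ℝ → ℝ) (χ : ℤ × ℤ → ℕ → ℝ) : ℝ :=
  limUnder atTop (Z w χ)

end VRJP

/-! ### The exponential law and i.i.d. exponential sequences -/

namespace VRJP

open Set

/-! Write `T = tail v` for the tail integral of `1 / v`, where `v` is `w` frozen below one. For `t ≥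
0` the two integrals in `Z` combine to `T (L(1,t)) - T (L(0,t))`. Both terms decrease to limits, and
at least one local time diverges because the sum of the clocks does, so the jump correction
vanishes. Hence `Z` converges to `balance`, the difference of the two limits. What remains is that
`balance` has no atoms. If the minimal total local time equals a finite `a`, then `balance` is `T a`
or `-T a`, and if that minimum is infinite then `balance` is `0`; so the claims about the minimum
follow.

An atom at `r ≠ 0` is excluded by varying only the first stay. By the monotone coupling, a longer
first stay leaves the starting vertex with more local time and the other vertex with less,
permanently and strictly. Therefore, for fixed later clocks, at most one value of the first clock
gives `balance = r` (`balance_cons_ne`), and the exponential law has no atoms.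

The atom at `0` is the core. As one of the limits vanishes, `balance = 0` means that both local
times diverge, the event `bothInf`. During one stay, the drop of `T` minus the compensator `1 / (v y
* v x')`, where `x'` is the local time of the vertex at the end of the stay and `y` that of the
other vertex, has mean zero, and its variance is the second moment of the compensator
(`integral_tail_step`). The compensators decrease along the chain, so in the alternating sum over
the two vertices they nearly cancel. This yields two estimates on `probInf`:
`probInf_mul_tail_fst_le` and the second-moment bound `probInf_mul_sq_le`. The latter says that if
`bothInf` is likely, then the two tails are nearly equal.

These show that `probInf` is at most `1 - ε`, uniformly over starting states with local times at
least one. Let `q = T x * v x * v y`, with `x` the larger local time. If `q` is large, stretch about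
`q / 16` stays at one vertex by a factor `1 + K / √N`, where `N` is their number. This costs only a
bounded density factor in `L²`, yet shifts the difference of the tails by more than the
second-moment bound allows, so the original and the stretched trajectory cannot both be likely to
balance (`not_both_balanced`). If `q` is bounded, one long stay, which has probability bounded
below, spoils the balance (`probInf_le_of_small`). The monotonicity of `t ↦ w t ^ ρ * T t` enters
only through `le_of_half_tail_le`: `v` grows by at most a constant factor while `T` halves. Finally,
an event whose conditional probability given every cylinder is at most `1 - ε` is null
(`measure_bothInf_eq_zero`). -/

instance isProbabilityMeasure_expMeasure_one : IsProbabilityMeasure (expMeasure 1) :=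
  isProbabilityMeasure_expMeasure one_pos

lemma lintegral_expMeasure {f : ℝ → ℝ≥0∞} (hf : Measurable f) :
    ∫⁻ x, f x ∂expMeasure 1 = ∫⁻ x in Ioi (0 : ℝ), ENNReal.ofReal (Real.exp (-x)) * f x := by
  have hd : expMeasure 1 = volume.withDensity (exponentialPDF 1) := rfl
  have hm : Measurable (exponentialPDF 1) := (measurable_exponentialPDFReal 1).ennreal_ofReal
  rw [hd, lintegral_withDensity_eq_lintegral_mul _ hm hf, restrict_Ioi_eq_restrict_Ici,
    ← lintegral_indicator measurableSet_Ici]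
  refine lintegral_congr fun x => ?_
  by_cases hx : 0 ≤ x
  · simp [hx, exponentialPDF_of_nonneg hx]
  · simp [hx, exponentialPDF_of_neg (not_le.1 hx)]

lemma expMeasure_Ici {t : ℝ} (ht : 0 ≤ t) :
    expMeasure 1 (Ici t) = ENNReal.ofReal (Real.exp (-t)) := by
  rw [← lintegral_indicator_one measurableSet_Ici,
    lintegral_expMeasure (measurable_one.indicator measurableSet_Ici)]
  have h1 : ∀ x : ℝ, ENNReal.ofReal (Real.exp (-x)) * (Ici t).indicator 1 x
      = (Ici t).indicator (fun x => ENNReal.ofReal (Real.exp (-x))) x := by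
    intro x
    by_cases hx : x ∈ Ici t <;> simp [hx]
  simp_rw [h1]
  rw [restrict_Ioi_eq_restrict_Ici, setLIntegral_indicator measurableSet_Ici,
    inter_eq_left.2 (Ici_subset_Ici.2 ht), ← restrict_Ioi_eq_restrict_Ici,
    ← ofReal_integral_eq_lintegral_ofReal (integrableOn_exp_neg_Ioi t)
      (Eventually.of_forall fun x => (Real.exp_pos _).le), integral_exp_neg_Ioi]

lemma ae_pos_expMeasure : ∀ᵐ x ∂expMeasure 1, 0 < x := by
  have : expMeasure 1 {x | ¬ 0 < x} = 0 := by
    have hm : MeasurableSet {x : ℝ | ¬ 0 < x} := by measurability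
    rw [← lintegral_indicator_one hm, lintegral_expMeasure (measurable_one.indicator hm)]
    rw [setLIntegral_congr_fun (g := fun _ => 0) measurableSet_Ioi]
    · simp
    · intro x hx
      have : ¬ x ≤ 0 := not_le.2 hx
      simp [this]
  exact this

lemma lintegral_exp_mul_expMeasure {l : ℝ} (hl : l < 1) :
    ∫⁻ x, ENNReal.ofReal (Real.exp (l * x)) ∂expMeasure 1 = ENNReal.ofReal (1 / (1 - l)) := by
  rw [lintegral_expMeasure (by fun_prop)]
  have h1 : ∀ x : ℝ, ENNReal.ofReal (Real.exp (-x)) * ENNReal.ofReal (Real.exp (l * x))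
      = ENNReal.ofReal (Real.exp ((l - 1) * x)) := by
    intro x
    rw [← ENNReal.ofReal_mul (Real.exp_pos _).le, ← Real.exp_add]
    ring_nf
  simp_rw [h1]
  have hl' : l - 1 < 0 := by linarith
  rw [← ofReal_integral_eq_lintegral_ofReal (integrableOn_exp_mul_Ioi hl' 0)
      (Eventually.of_forall fun x => (Real.exp_pos _).le), integral_exp_mul_Ioi hl']
  congr 1
  have : 1 - l ≠ 0 := by linarith
  have : l - 1 ≠ 0 := by linarith
  simp
  field_simp
  ring

/-- Integration by parts against the exponential law. -/
lemma lintegral_primitive_expMeasure {h : ℝ → ℝ} (hm : Measurable h)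
    (hint : ∀ t > 0, IntervalIntegrable h volume 0 t) (h0 : ∀ t, 0 ≤ h t) :
    ∫⁻ x, ENNReal.ofReal (∫ t in (0 : ℝ)..x, h t) ∂expMeasure 1
      = ∫⁻ x, ENNReal.ofReal (h x) ∂expMeasure 1 := by
  rw [lintegral_comp_eq_lintegral_meas_le_mul (f := fun x => x) (expMeasure 1)
    (ae_pos_expMeasure.mono fun x hx => hx.le) aemeasurable_id hint
    (Eventually.of_forall fun t => h0 t), lintegral_expMeasure hm.ennreal_ofReal]
  refine setLIntegral_congr_fun measurableSet_Ioi fun t ht => ?_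
  have : {a : ℝ | t ≤ a} = Ici t := rfl
  simp only [this]
  rw [expMeasure_Ici (le_of_lt ht)]

lemma integral_primitive_expMeasure {h : ℝ → ℝ} (hm : Measurable h)
    (hint : ∀ t > 0, IntervalIntegrable h volume 0 t) (h0 : ∀ t, 0 ≤ h t)
    {F : ℝ → ℝ} (hFm : Measurable F) (hF : ∀ x > 0, F x = ∫ t in (0 : ℝ)..x, h t) :
    ∫ x, F x ∂expMeasure 1 = ∫ x, h x ∂expMeasure 1 := by
  have hF0 : ∀ᵐ x ∂expMeasure 1, 0 ≤ F x := by
    filter_upwards [ae_pos_expMeasure] with x hx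
    rw [hF x hx]
    exact intervalIntegral.integral_nonneg hx.le fun t _ => h0 t
  rw [integral_eq_lintegral_of_nonneg_ae hF0 hFm.aestronglyMeasurable,
    integral_eq_lintegral_of_nonneg_ae (Eventually.of_forall h0) hm.aestronglyMeasurable,
    ← lintegral_primitive_expMeasure hm hint h0]
  congr 1
  refine lintegral_congr_ae ?_
  filter_upwards [ae_pos_expMeasure] with x hx
  rw [hF x hx]

/-- Scaling an exponential variable by `1 + θ` costs a bounded factor in `L²`. -/
lemma lintegral_scale_expMeasure_sq_le {θ : ℝ} (h0 : 0 ≤ θ) (h1 : θ < 1) {f : ℝ → ℝ≥0∞}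
    (hf : Measurable f) :
    (∫⁻ x, f ((1 + θ) * x) ∂expMeasure 1) ^ 2
      ≤ ENNReal.ofReal (1 / (1 - θ ^ 2)) * ∫⁻ x, f x ^ 2 ∂expMeasure 1 := by
  have hp : (0 : ℝ) < 1 + θ := by linarith
  -- The density of the law of `(1 + θ) X` with respect to that of `X`; its second moment is `1 / (1
  -- - θ ^ 2)`, finite exactly because `θ < 1`. The rest is Cauchy–Schwarz.
  set r : ℝ → ℝ≥0∞ := fun x => ENNReal.ofReal (Real.exp (x - x / (1 + θ)) / (1 + θ)) with hr
  have hrm : Measurable r := by fun_prop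
  have h2 : ∫⁻ x, f ((1 + θ) * x) ∂expMeasure 1 = ∫⁻ x, (r * f) x ∂expMeasure 1 := by
    rw [lintegral_expMeasure (f := fun x => f ((1 + θ) * x)) (hf.comp (measurable_const_mul _)), lintegral_expMeasure (hrm.mul hf)]
    have him : (fun x => (1 + θ) * x) '' Ioi 0 = Ioi (0 : ℝ) := by
      ext y
      simp only [mem_image, mem_Ioi]
      constructor
      · rintro ⟨x, hx, rfl⟩; positivity
      · intro hy; exact ⟨y / (1 + θ), by positivity, by field_simp⟩
    conv_rhs => rw [← him]
    rw [lintegral_image_eq_lintegral_abs_deriv_mul (f' := fun _ => 1 + θ) measurableSet_Ioi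
      (fun x _ => by simpa using ((hasDerivAt_id x).const_mul (1 + θ)).hasDerivWithinAt)
      (fun x _ y _ hxy => mul_left_cancel₀ hp.ne' hxy)]
    refine lintegral_congr fun x => ?_
    simp only [hr, Pi.mul_apply, ← mul_assoc]
    congr 1
    rw [← ENNReal.ofReal_mul (abs_nonneg _), ← ENNReal.ofReal_mul (by positivity)]
    congr 1
    rw [abs_of_pos hp]
    have : Real.exp (-x) = Real.exp (-((1 + θ) * x)) * Real.exp ((1 + θ) * x - (1 + θ) * x / (1 + θ)) := by
      rw [← Real.exp_add]; congr 1; field_simp; ring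
    rw [this]; field_simp
  rw [h2]
  have h3 := ENNReal.lintegral_mul_le_Lp_mul_Lq (expMeasure 1) Real.HolderConjugate.two_two
    hrm.aemeasurable hf.aemeasurable
  have h4 : ∫⁻ x, r x ^ (2 : ℝ) ∂expMeasure 1 = ENNReal.ofReal (1 / (1 - θ ^ 2)) := by
    have h5 : ∀ x, r x ^ (2 : ℝ)
        = ENNReal.ofReal (1 / (1 + θ) ^ 2) * ENNReal.ofReal (Real.exp ((2 - 2 / (1 + θ)) * x)) := by
      intro x
      rw [ENNReal.rpow_two, hr, ← ENNReal.ofReal_pow (by positivity), ← ENNReal.ofReal_mul (by positivity)]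
      congr 1
      rw [div_pow, ← Real.exp_nat_mul, div_eq_mul_one_div, mul_comm]
      congr 2
      push_cast
      ring
    simp_rw [h5]
    have hlt : 2 - 2 / (1 + θ) < 1 := by
      have : 1 < 2 / (1 + θ) := by rw [lt_div_iff₀ hp]; linarith
      linarith
    rw [lintegral_const_mul _ (by fun_prop), lintegral_exp_mul_expMeasure hlt,
      ← ENNReal.ofReal_mul (by positivity)]
    congr 1
    have e1 : (1 : ℝ) - θ ≠ 0 := by linarith
    have e2 : (1 : ℝ) - θ ^ 2 = (1 - θ) * (1 + θ) := by ring
    have e3 : 1 - (2 - 2 / (1 + θ)) = (1 - θ) / (1 + θ) := by field_simp; ring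
    rw [e3, e2]
    field_simp
  rw [h4] at h3
  calc (∫⁻ x, (r * f) x ∂expMeasure 1) ^ 2
      ≤ (ENNReal.ofReal (1 / (1 - θ ^ 2)) ^ (1 / 2 : ℝ)
          * (∫⁻ x, f x ^ (2 : ℝ) ∂expMeasure 1) ^ (1 / 2 : ℝ)) ^ 2 := by gcongr
    _ = _ := by
        rw [mul_pow, ← ENNReal.rpow_natCast, ← ENNReal.rpow_natCast, ← ENNReal.rpow_mul,
          ← ENNReal.rpow_mul]
        norm_num

/-- The law of an independent sequence of mean one exponential variables. -/
noncomputable def expSeq : Measure (ℕ → ℝ) := Measure.infinitePi fun _ => expMeasure 1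

instance isProbabilityMeasure_expSeq : IsProbabilityMeasure expSeq := by
  unfold expSeq; infer_instance

/-- Prepend a term to a sequence. -/
def consSeq (p : ℝ × (ℕ → ℝ)) : ℕ → ℝ
  | 0 => p.1
  | n + 1 => p.2 n

@[simp] lemma consSeq_zero (p : ℝ × (ℕ → ℝ)) : consSeq p 0 = p.1 := rfl
@[simp] lemma consSeq_succ (p : ℝ × (ℕ → ℝ)) (n : ℕ) : consSeq p (n + 1) = p.2 n := rfl

@[fun_prop] lemma measurable_consSeq : Measurable consSeq := by
  refine measurable_pi_iff.2 fun n => ?_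
  cases n with
  | zero => exact measurable_fst
  | succ n => exact (measurable_pi_apply n).comp measurable_snd

/-- An infinite product measure is determined by its values on finite boxes, and a box splits into
its zeroth side and a box in the shifted coordinates. All later inductions condition on the first
clock through this identity. -/
lemma map_consSeq : ((expMeasure 1).prod expSeq).map consSeq = expSeq := by
  classical
  refine Measure.eq_infinitePi _ fun s t ht => ?_
  rw [Measure.map_apply measurable_consSeq (MeasurableSet.pi s.countable_toSet fun i _ => ht i)]
  set s' : Finset ℕ := (s.erase 0).image Nat.pred with hs'
  have h1 : consSeq ⁻¹' (Set.pi s t)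
      = (if 0 ∈ s then t 0 else univ) ×ˢ Set.pi s' fun n => t (n + 1) := by
    ext ⟨a, b⟩
    simp only [mem_preimage, Set.mem_pi, Finset.mem_coe, mem_prod, hs', Finset.mem_image,
      Finset.mem_erase]
    constructor
    · intro h
      refine ⟨?_, ?_⟩
      · split_ifs with h0
        · exact h 0 h0
        · trivial
      · rintro n ⟨m, ⟨hm0, hm⟩, rfl⟩
        obtain ⟨k, rfl⟩ := Nat.exists_eq_succ_of_ne_zero hm0
        exact h _ hm
    · rintro ⟨h0, h⟩ i hi
      cases i with
      | zero => simpa [hi] using h0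
      | succ k => exact h k ⟨k + 1, ⟨by simp, hi⟩, rfl⟩
  have h2 : ∏ i ∈ s', expMeasure 1 (t (i + 1)) = ∏ i ∈ s.erase 0, expMeasure 1 (t i) := by
    rw [hs', Finset.prod_image]
    · refine Finset.prod_congr rfl fun i hi => ?_
      rw [Nat.pred_eq_sub_one, Nat.sub_add_cancel (Nat.one_le_iff_ne_zero.2 (Finset.ne_of_mem_erase hi))]
    · intro a ha b hb hab
      have ha' := Finset.ne_of_mem_erase ha
      have hb' := Finset.ne_of_mem_erase hb
      simp only [Nat.pred_eq_sub_one] at hab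
      omega
  rw [h1, Measure.prod_prod, expSeq, Measure.infinitePi_pi _ (fun i _ => ht (i + 1)), h2]
  split_ifs with h0
  · rw [Finset.mul_prod_erase s (fun i => expMeasure 1 (t i)) h0]
  · rw [measure_univ, one_mul, Finset.erase_eq_of_notMem h0]

lemma measurePreserving_consSeq :
    MeasurePreserving consSeq ((expMeasure 1).prod expSeq) expSeq :=
  ⟨measurable_consSeq, map_consSeq⟩

lemma lintegral_expSeq {f : (ℕ → ℝ) → ℝ≥0∞} (hf : Measurable f) :
    ∫⁻ e, f e ∂expSeq = ∫⁻ a, ∫⁻ e, f (consSeq (a, e)) ∂expSeq ∂expMeasure 1 := by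
  conv_lhs => rw [← map_consSeq]
  rw [lintegral_map hf measurable_consSeq, lintegral_prod]
  exact (hf.comp measurable_consSeq).aemeasurable

lemma integral_expSeq {f : (ℕ → ℝ) → ℝ} (hf : Integrable f expSeq) :
    ∫ e, f e ∂expSeq = ∫ a, ∫ e, f (consSeq (a, e)) ∂expSeq ∂expMeasure 1 := by
  have h1 : Integrable (fun p => f (consSeq p)) ((expMeasure 1).prod expSeq) :=
    measurePreserving_consSeq.integrable_comp hf.aestronglyMeasurable |>.2 hf
  conv_lhs => rw [← map_consSeq]
  rw [integral_map measurable_consSeq.aemeasurable, integral_prod _ h1]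
  rw [map_consSeq]; exact hf.aestronglyMeasurable

lemma measure_expSeq {s : Set (ℕ → ℝ)} (hs : MeasurableSet s) :
    expSeq s = ∫⁻ a, expSeq {e | consSeq (a, e) ∈ s} ∂expMeasure 1 := by
  conv_lhs => rw [← map_consSeq]
  rw [Measure.map_apply measurable_consSeq hs, Measure.prod_apply (measurable_consSeq hs)]
  rfl

lemma ae_pos_expSeq : ∀ᵐ e ∂expSeq, ∀ n, 0 < e n := by
  rw [ae_all_iff]
  intro n
  exact (measurePreserving_eval_infinitePi (fun _ : ℕ => expMeasure 1) n).quasiMeasurePreserving.ae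
    ae_pos_expMeasure

end VRJP

/-! ### Reinforcement functions, their tail integral, and the moments of one stay -/

namespace VRJP

open Set

/-- Weight functions bounded below by one, with integrable reciprocal. -/
structure IsReinforcement (v : ℝ → ℝ) : Prop where
  mono : Monotone v
  one_le : ∀ x, 1 ≤ v x
  rightContinuous : ∀ x, ContinuousWithinAt v (Ici x) x
  integrableOn : IntegrableOn (fun u => 1 / v u) (Ioi 1)

/-- The tail integral `∫_t^∞ 1 / v`. -/
noncomputable def tail (v : ℝ → ℝ) (t : ℝ) : ℝ := ∫ s in Ioi t, 1 / v s

lemma tendsto_tail (v : ℝ → ℝ) : Tendsto (tail v) atTop (𝓝 0) :=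
  tendsto_integral_Ioi_zero (f := fun u => 1 / v u) tendsto_id

namespace IsReinforcement

variable {v : ℝ → ℝ}

lemma pos (hv : IsReinforcement v) (x : ℝ) : 0 < v x := one_pos.trans_le (hv.one_le x)

lemma antitone_inv (hv : IsReinforcement v) : Antitone fun u => 1 / v u := fun x _ h =>
  one_div_le_one_div_of_le (hv.pos x) (hv.mono h)

lemma measurable (hv : IsReinforcement v) : Measurable v := hv.mono.measurable

lemma intervalIntegrable (hv : IsReinforcement v) (a b : ℝ) :
    IntervalIntegrable (fun u => 1 / v u) volume a b := hv.antitone_inv.intervalIntegrable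

lemma integrableOn_Ioi (hv : IsReinforcement v) (t : ℝ) :
    IntegrableOn (fun u => 1 / v u) (Ioi t) := by
  rcases le_total 1 t with h | h
  · exact hv.integrableOn.mono_set (Ioi_subset_Ioi h)
  · rw [← Ioc_union_Ioi_eq_Ioi h]
    exact ((intervalIntegrable_iff_integrableOn_Ioc_of_le h).1 (hv.intervalIntegrable t 1)).union
      hv.integrableOn

lemma tail_sub (hv : IsReinforcement v) (t s : ℝ) :
    tail v t - tail v s = ∫ u in t..s, 1 / v u :=
  intervalIntegral.integral_Ioi_sub_Ioi' (hv.integrableOn_Ioi t) (hv.integrableOn_Ioi s)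

lemma le_tail_sub (hv : IsReinforcement v) {t s : ℝ} (h : t ≤ s) :
    (s - t) / v s ≤ tail v t - tail v s := by
  rw [hv.tail_sub]
  have := intervalIntegral.integral_mono_on h (intervalIntegrable_const (c := 1 / v s))
    (hv.intervalIntegrable t s) (fun u hu => hv.antitone_inv hu.2)
  simpa [div_eq_mul_inv] using this

lemma tail_sub_le (hv : IsReinforcement v) {t s : ℝ} (h : t ≤ s) :
    tail v t - tail v s ≤ (s - t) / v t := by
  rw [hv.tail_sub]
  have := intervalIntegral.integral_mono_on h (hv.intervalIntegrable t s)
    (intervalIntegrable_const (c := 1 / v t)) (fun u hu => hv.antitone_inv hu.1)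
  simpa [div_eq_mul_inv] using this

lemma tail_strictAnti (hv : IsReinforcement v) : StrictAnti (tail v) := fun t s h => by
  have := hv.le_tail_sub h.le
  have h2 : 0 < (s - t) / v s := div_pos (sub_pos.2 h) (hv.pos s)
  linarith

lemma tail_antitone (hv : IsReinforcement v) : Antitone (tail v) := hv.tail_strictAnti.antitone

lemma tail_nonneg (hv : IsReinforcement v) (t : ℝ) : 0 ≤ tail v t :=
  setIntegral_nonneg measurableSet_Ioi fun s _ => (one_div_pos.2 (hv.pos s)).le

lemma tail_pos (hv : IsReinforcement v) (t : ℝ) : 0 < tail v t :=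
  (hv.tail_nonneg (t + 1)).trans_lt (hv.tail_strictAnti (lt_add_one t))

lemma continuous_tail (hv : IsReinforcement v) : Continuous (tail v) := by
  have : tail v = fun t => tail v 0 - ∫ u in (0 : ℝ)..t, 1 / v u := by
    ext t; rw [← hv.tail_sub]; ring
  rw [this]
  exact continuous_const.sub
    (intervalIntegral.continuous_primitive (fun a b => hv.intervalIntegrable a b) 0)

lemma measurable_tail (hv : IsReinforcement v) : Measurable (tail v) := hv.continuous_tail.measurable

/-- Since `1 / v` is decreasing and integrable, `v` grows at least linearly; this gives `v → ∞`. -/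
lemma sub_div_tail_le (hv : IsReinforcement v) {t s : ℝ} (h : t ≤ s) : (s - t) / tail v t ≤ v s := by
  have h1 := hv.le_tail_sub h
  have h2 := hv.tail_nonneg s
  rw [div_le_iff₀ (hv.tail_pos t)]
  rw [div_le_iff₀ (hv.pos s)] at h1
  nlinarith [hv.pos s]

lemma tendsto_atTop (hv : IsReinforcement v) : Tendsto v atTop atTop := by
  refine tendsto_atTop_mono' (f₁ := fun s => (s - 0) / tail v 0) _ ?_ ?_
  · filter_upwards [eventually_ge_atTop 0] with s hs using hv.sub_div_tail_le hs
  · simpa using tendsto_id.atTop_div_const (hv.tail_pos 0)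

/-- Holding at a vertex with local time `x` while the other one has local time `y`: the drop of the
tail integral has mean equal to that of its compensator, and the variance of the difference is the
second moment of the compensator. -/
lemma integral_tail_step (hv : IsReinforcement v) (x y : ℝ) :
    ∫ e, (tail v x - tail v (x + max e 0 / v y)) ∂expMeasure 1
        = ∫ e, 1 / (v y * v (x + max e 0 / v y)) ∂expMeasure 1 ∧
      ∫ e, (tail v x - tail v (x + max e 0 / v y)
        - 1 / (v y * v (x + max e 0 / v y))) ^ 2 ∂expMeasure 1
        = ∫ e, (1 / (v y * v (x + max e 0 / v y))) ^ 2 ∂expMeasure 1 := by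
  have hy := hv.pos y
  set f : ℝ → ℝ := fun e => tail v x - tail v (x + max e 0 / v y) with hf
  set g : ℝ → ℝ := fun e => 1 / (v y * v (x + max e 0 / v y)) with hg
  have hfm : Measurable f :=
    measurable_const.sub (hv.measurable_tail.comp (by fun_prop))
  have hgm : Measurable g :=
    ((hv.measurable.comp (by fun_prop)).const_mul _).const_div _
  have hg0 : ∀ t, 0 ≤ g t := fun t => (one_div_pos.2 (mul_pos hy (hv.pos _))).le
  have hg1 : ∀ t, g t ≤ 1 := fun t => by
    rw [hg]; simp only
    rw [div_le_one (mul_pos hy (hv.pos _))]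
    nlinarith [hv.one_le y, hv.one_le (x + max t 0 / v y)]
  have hf0 : ∀ t, 0 ≤ f t := fun t => sub_nonneg.2 (hv.tail_antitone (by
    have : 0 ≤ max t 0 / v y := by positivity
    linarith))
  have hf1 : ∀ t, f t ≤ tail v x := fun t => by
    have := hv.tail_nonneg (x + max t 0 / v y)
    simp only [hf]; linarith
  have hgi : ∀ a b, IntervalIntegrable g volume a b := fun a b => by
    refine Antitone.intervalIntegrable fun s t h => ?_
    refine one_div_le_one_div_of_le (mul_pos hy (hv.pos _)) ?_
    refine mul_le_mul_of_nonneg_left (hv.mono ?_) hy.le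
    gcongr
  -- The substitution `u = x + t / v y` shows that the drop `f` is the primitive of its compensator
  -- `g`. Integration by parts against the exponential law then gives equal means.
  have hfg : ∀ e ≥ 0, f e = ∫ t in (0 : ℝ)..e, g t := by
    intro e he
    have h1 : ∫ t in (0 : ℝ)..e, g t = ∫ t in (0 : ℝ)..e, (v y)⁻¹ * (1 / v (x + t / v y)) := by
      refine intervalIntegral.integral_congr fun t ht => ?_
      rw [uIcc_of_le he] at ht
      simp only [hg, max_eq_left ht.1]
      field_simp
    rw [h1, intervalIntegral.integral_const_mul]
    have h2 := intervalIntegral.integral_comp_add_div (a := 0) (b := e)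
      (fun u => 1 / v u) (c := v y) hy.ne' x
    rw [h2, hf]
    simp only [max_eq_left he, zero_div, add_zero, smul_eq_mul]
    rw [hv.tail_sub, inv_mul_cancel_left₀ hy.ne']
  have hgrc : ∀ t ≥ 0, ContinuousWithinAt g (Ici t) t := by
    intro t ht
    have h1 : ContinuousWithinAt (fun e => v (x + max e 0 / v y)) (Ici t) t := by
      refine ContinuousWithinAt.comp (t := Ici (x + max t 0 / v y)) (hv.rightContinuous _)
        (Continuous.continuousWithinAt (by fun_prop)) ?_
      intro e he
      have : t ≤ e := he
      simp only [mem_Ici]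
      gcongr
    refine ContinuousWithinAt.div continuousWithinAt_const (continuousWithinAt_const.mul h1) ?_
    exact (mul_pos hy (hv.pos _)).ne'
  have hcf : Continuous f :=
    continuous_const.sub (hv.continuous_tail.comp (by fun_prop))
  -- Only right derivatives are available, because `v` is merely right-continuous; the fundamental
  -- theorem of calculus used for `f ^ 2` needs no more.
  have hder : ∀ t > 0, HasDerivWithinAt f (g t) (Ioi t) t := by
    intro t ht
    have h1 := intervalIntegral.integral_hasDerivWithinAt_right (hgi 0 t) (s := Ici t) (t := Ioi t)
      (hgm.stronglyMeasurable.stronglyMeasurableAtFilter)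
      ((hgrc t ht.le).mono Ioi_subset_Ici_self)
    refine (h1.mono Ioi_subset_Ici_self).congr (fun s hs => hfg s (ht.le.trans (le_of_lt hs)))
      (hfg t ht.le)
  have hfgi : ∀ e, IntervalIntegrable (fun t => 2 * (f t * g t)) volume 0 e := fun e =>
    ((hgi 0 e).continuousOn_mul hcf.continuousOn).const_mul 2
  have hff : ∀ e > 0, f e ^ 2 = ∫ t in (0 : ℝ)..e, 2 * (f t * g t) := by
    intro e he
    rw [intervalIntegral.integral_eq_sub_of_hasDeriv_right_of_le he.le
      (f := fun t => f t ^ 2) (hcf.pow 2).continuousOn _ (hfgi e)]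
    · simp [hf]
    · intro t ht
      have h1 := (hder t ht.1).pow 2
      have h2 : ((2 : ℕ) : ℝ) * f t ^ (2 - 1) * g t = 2 * (f t * g t) := by norm_num; ring
      rwa [h2] at h1
  have i1 : Integrable f (expMeasure 1) :=
    Integrable.of_bound hfm.aestronglyMeasurable (tail v x)
      (Eventually.of_forall fun t => by rw [Real.norm_of_nonneg (hf0 t)]; exact hf1 t)
  have i2 : Integrable g (expMeasure 1) :=
    Integrable.of_bound hgm.aestronglyMeasurable 1
      (Eventually.of_forall fun t => by rw [Real.norm_of_nonneg (hg0 t)]; exact hg1 t)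
  have i3 : Integrable (fun t => f t ^ 2) (expMeasure 1) :=
    Integrable.of_bound (hfm.pow_const 2).aestronglyMeasurable (tail v x ^ 2)
      (Eventually.of_forall fun t => by
        rw [Real.norm_of_nonneg (sq_nonneg _)]; exact pow_le_pow_left₀ (hf0 t) (hf1 t) 2)
  have i4 : Integrable (fun t => g t ^ 2) (expMeasure 1) :=
    Integrable.of_bound (hgm.pow_const 2).aestronglyMeasurable 1
      (Eventually.of_forall fun t => by
        rw [Real.norm_of_nonneg (sq_nonneg _)]; exact pow_le_one₀ (hg0 t) (hg1 t))
  have i5 : Integrable (fun t => 2 * (f t * g t)) (expMeasure 1) :=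
    (i1.mul_of_top_left (memLp_top_of_bound hgm.aestronglyMeasurable 1
      (Eventually.of_forall fun t => by
        rw [Real.norm_of_nonneg (hg0 t)]; exact hg1 t))).const_mul 2
  refine ⟨integral_primitive_expMeasure hgm (fun t _ => hgi 0 t) hg0 hfm
    (fun e he => hfg e he.le), ?_⟩
  -- As `f ^ 2` is the primitive of `2 f g`, the mixed term in `(f - g) ^ 2` cancels `f ^ 2` in
  -- mean, and only `g ^ 2` survives.
  have e1 : ∫ e, f e ^ 2 ∂expMeasure 1 = ∫ e, 2 * (f e * g e) ∂expMeasure 1 :=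
    integral_primitive_expMeasure ((hfm.mul hgm).const_mul 2) (fun t _ => hfgi t)
      (fun t => mul_nonneg zero_le_two (mul_nonneg (hf0 t) (hg0 t))) (hfm.pow_const 2) hff
  have e2 : ∀ e, (f e - g e) ^ 2 = f e ^ 2 - 2 * (f e * g e) + g e ^ 2 := fun e => by ring
  change ∫ e, (f e - g e) ^ 2 ∂expMeasure 1 = ∫ e, g e ^ 2 ∂expMeasure 1
  have i6 : Integrable (fun t => f t ^ 2 - 2 * (f t * g t)) (expMeasure 1) := i3.sub i5
  simp_rw [e2]
  rw [integral_add i6 i4, integral_sub i3 i5, e1, sub_self, zero_add]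

end IsReinforcement

end VRJP

/-! ### The alternating two-vertex chain and its martingale -/

namespace VRJP

open Set

/-- One jump of the two-vertex chain: the state is the pair (local time of the current vertex,
local time of the other vertex). -/
noncomputable def chainStep (v : ℝ → ℝ) (s : ℝ × ℝ) (e : ℝ) : ℝ × ℝ :=
  (s.2, s.1 + max e 0 / v s.2)

/-- The two-vertex chain driven by the sequence `e`. -/
noncomputable def chain (v : ℝ → ℝ) (s : ℝ × ℝ) (e : ℕ → ℝ) : ℕ → ℝ × ℝ
  | 0 => s
  | n + 1 => chainStep v (chain v s e n) (e n)

/-- The local time of the vertex occupied after `n` jumps, upon arrival there. -/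
noncomputable def loc (v : ℝ → ℝ) (s : ℝ × ℝ) (e : ℕ → ℝ) (n : ℕ) : ℝ := (chain v s e n).1

/-- The compensator of the drop of the tail integral during the `n`-th stay. -/
noncomputable def drift (v : ℝ → ℝ) (s : ℝ × ℝ) (e : ℕ → ℝ) (n : ℕ) : ℝ :=
  1 / (v (loc v s e (n + 1)) * v (loc v s e (n + 2)))

/-- The `n`-th martingale increment. -/
noncomputable def noise (v : ℝ → ℝ) (s : ℝ × ℝ) (e : ℕ → ℝ) (n : ℕ) : ℝ :=
  tail v (loc v s e n) - tail v (loc v s e (n + 2)) - drift v s e n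

variable {v : ℝ → ℝ} {s : ℝ × ℝ} {e : ℕ → ℝ}

@[simp] lemma loc_zero : loc v s e 0 = s.1 := rfl
@[simp] lemma loc_one : loc v s e 1 = s.2 := rfl

lemma loc_add_two (n : ℕ) :
    loc v s e (n + 2) = loc v s e n + max (e n) 0 / v (loc v s e (n + 1)) := rfl

lemma chain_cons (a : ℝ) (n : ℕ) :
    chain v s (consSeq (a, e)) (n + 1) = chain v (chainStep v s a) e n := by
  induction n with
  | zero => rfl
  | succ n ih => rw [chain, ih]; rfl

lemma loc_cons (a : ℝ) (n : ℕ) :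
    loc v s (consSeq (a, e)) (n + 1) = loc v (chainStep v s a) e n := by
  rw [loc, chain_cons]; rfl

lemma drift_cons (a : ℝ) (n : ℕ) :
    drift v s (consSeq (a, e)) (n + 1) = drift v (chainStep v s a) e n := by
  simp only [drift, loc_cons]

lemma noise_cons (a : ℝ) (n : ℕ) :
    noise v s (consSeq (a, e)) (n + 1) = noise v (chainStep v s a) e n := by
  simp only [noise, drift_cons, loc_cons]

lemma drift_cons_zero (a : ℝ) :
    drift v s (consSeq (a, e)) 0 = 1 / (v s.2 * v (s.1 + max a 0 / v s.2)) := rfl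

lemma noise_cons_zero (a : ℝ) : noise v s (consSeq (a, e)) 0 =
    tail v s.1 - tail v (s.1 + max a 0 / v s.2) - 1 / (v s.2 * v (s.1 + max a 0 / v s.2)) := rfl

namespace IsReinforcement

lemma measurable_chain (hv : IsReinforcement v) (n : ℕ) :
    Measurable fun p : (ℝ × ℝ) × (ℕ → ℝ) => chain v p.1 p.2 n := by
  induction n with
  | zero => exact measurable_fst
  | succ n ih =>
    have h1 := hv.measurable.comp ih.snd
    have h2 : Measurable fun p : (ℝ × ℝ) × (ℕ → ℝ) => max (p.2 n) 0 :=
      ((measurable_pi_apply n).comp measurable_snd).max measurable_const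
    exact ih.snd.prodMk (ih.fst.add (h2.div h1))

@[fun_prop]
lemma measurable_loc (hv : IsReinforcement v) (n : ℕ) :
    Measurable fun p : (ℝ × ℝ) × (ℕ → ℝ) => loc v p.1 p.2 n := (hv.measurable_chain n).fst

lemma measurable_tail_loc (hv : IsReinforcement v) (n : ℕ) :
    Measurable fun p : (ℝ × ℝ) × (ℕ → ℝ) => tail v (loc v p.1 p.2 n) :=
  hv.measurable_tail.comp (hv.measurable_loc n)

lemma measurable_drift (hv : IsReinforcement v) (n : ℕ) :
    Measurable fun p : (ℝ × ℝ) × (ℕ → ℝ) => drift v p.1 p.2 n :=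
  ((hv.measurable.comp (hv.measurable_loc _)).mul
    (hv.measurable.comp (hv.measurable_loc _))).const_div 1

lemma measurable_noise (hv : IsReinforcement v) (n : ℕ) :
    Measurable fun p : (ℝ × ℝ) × (ℕ → ℝ) => noise v p.1 p.2 n :=
  ((hv.measurable_tail_loc _).sub (hv.measurable_tail_loc _)).sub (hv.measurable_drift _)

lemma measurable_chainStep (s : ℝ × ℝ) : Measurable (chainStep v s) := by
  unfold chainStep
  fun_prop

lemma stay_nonneg (hv : IsReinforcement v) (a y : ℝ) : 0 ≤ max a 0 / v y :=
  div_nonneg (le_max_right _ _) (hv.pos _).le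

/-- Clocks enter the chain as `max (e n) 0`, so that monotonicity holds for every driving sequence
and not only almost surely. -/
lemma loc_le_loc_add_two (hv : IsReinforcement v) (s : ℝ × ℝ) (e : ℕ → ℝ) (n : ℕ) :
    loc v s e n ≤ loc v s e (n + 2) := by
  rw [loc_add_two]; linarith [hv.stay_nonneg (e n) (loc v s e (n + 1))]

lemma monotone_loc_even (hv : IsReinforcement v) (s : ℝ × ℝ) (e : ℕ → ℝ) :
    Monotone fun n => loc v s e (2 * n) :=
  monotone_nat_of_le_succ fun n => hv.loc_le_loc_add_two s e (2 * n)

lemma monotone_loc_odd (hv : IsReinforcement v) (s : ℝ × ℝ) (e : ℕ → ℝ) :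
    Monotone fun n => loc v s e (2 * n + 1) :=
  monotone_nat_of_le_succ fun n => hv.loc_le_loc_add_two s e (2 * n + 1)

lemma fst_le_loc (hv : IsReinforcement v) (s : ℝ × ℝ) (e : ℕ → ℝ) (n : ℕ) :
    s.1 ≤ loc v s e (2 * n) := hv.monotone_loc_even s e (Nat.zero_le n)

lemma snd_le_loc (hv : IsReinforcement v) (s : ℝ × ℝ) (e : ℕ → ℝ) (n : ℕ) :
    s.2 ≤ loc v s e (2 * n + 1) := hv.monotone_loc_odd s e (Nat.zero_le n)

lemma min_le_loc (hv : IsReinforcement v) (s : ℝ × ℝ) (e : ℕ → ℝ) (n : ℕ) :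
    min s.1 s.2 ≤ loc v s e n := by
  rcases Nat.even_or_odd' n with ⟨k, rfl | rfl⟩
  · exact (min_le_left _ _).trans (hv.fst_le_loc s e k)
  · exact (min_le_right _ _).trans (hv.snd_le_loc s e k)

lemma drift_pos (hv : IsReinforcement v) (s : ℝ × ℝ) (e : ℕ → ℝ) (n : ℕ) : 0 < drift v s e n :=
  one_div_pos.2 (mul_pos (hv.pos _) (hv.pos _))

/-- Consecutive compensators share the factor `v (loc (n + 2))`; in the other factor `loc (n + 1)`
is replaced by the later local time `loc (n + 3)` of the same vertex. -/
lemma antitone_drift (hv : IsReinforcement v) (s : ℝ × ℝ) (e : ℕ → ℝ) :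
    Antitone (drift v s e) := by
  refine antitone_nat_of_succ_le fun n => one_div_le_one_div_of_le (mul_pos (hv.pos _) (hv.pos _)) ?_
  rw [mul_comm]
  exact mul_le_mul_of_nonneg_left (hv.mono (hv.loc_le_loc_add_two s e (n + 1))) (hv.pos _).le

lemma drift_le (hv : IsReinforcement v) (s : ℝ × ℝ) (e : ℕ → ℝ) (n : ℕ) :
    drift v s e n ≤ 1 / (v s.1 * v s.2) := by
  refine (hv.antitone_drift s e (Nat.zero_le n)).trans ?_
  refine one_div_le_one_div_of_le (mul_pos (hv.pos _) (hv.pos _)) ?_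
  rw [mul_comm]
  exact mul_le_mul_of_nonneg_left (hv.mono (hv.loc_le_loc_add_two s e 0)) (hv.pos _).le

lemma drift_le_one (hv : IsReinforcement v) (s : ℝ × ℝ) (e : ℕ → ℝ) (n : ℕ) :
    drift v s e n ≤ 1 := by
  refine (hv.drift_le s e n).trans ?_
  rw [div_le_one (mul_pos (hv.pos _) (hv.pos _))]
  nlinarith [hv.one_le s.1, hv.one_le s.2]

lemma tail_loc_le (hv : IsReinforcement v) (s : ℝ × ℝ) (e : ℕ → ℝ) (n : ℕ) :
    tail v (loc v s e n) ≤ tail v (min s.1 s.2) := hv.tail_antitone (hv.min_le_loc s e n)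

/-- A deterministic bound depending only on the starting state; the integrability of the weighted
sums of increments rests on it. -/
lemma abs_noise_le (hv : IsReinforcement v) (s : ℝ × ℝ) (e : ℕ → ℝ) (n : ℕ) :
    |noise v s e n| ≤ tail v (min s.1 s.2) + 1 := by
  have h1 := hv.drift_le_one s e n
  have h2 := hv.drift_pos s e n
  have h3 := hv.tail_loc_le s e n
  have h4 := hv.tail_nonneg (loc v s e (n + 2))
  have h5 := hv.tail_antitone (hv.loc_le_loc_add_two s e n)
  have h6 := hv.tail_nonneg (min s.1 s.2)
  rw [abs_le, noise]
  constructor <;> linarith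

lemma abs_sum_noise_le (hv : IsReinforcement v) (s : ℝ × ℝ) (e : ℕ → ℝ) (η : ℕ → ℝ) (n : ℕ) :
    |∑ k ∈ Finset.range n, η k * noise v s e k|
      ≤ (∑ k ∈ Finset.range n, |η k|) * (tail v (min s.1 s.2) + 1) := by
  refine (Finset.abs_sum_le_sum_abs _ _).trans ?_
  rw [Finset.sum_mul]
  refine Finset.sum_le_sum fun k _ => ?_
  rw [abs_mul]
  exact mul_le_mul_of_nonneg_left (hv.abs_noise_le s e k) (abs_nonneg _)

lemma measurable_section (s : ℝ × ℝ) {β : Type*} [MeasurableSpace β] {f : (ℝ × ℝ) × (ℕ → ℝ) → β}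
    (hf : Measurable f) : Measurable fun e => f (s, e) := hf.comp measurable_prodMk_left

lemma measurable_sum_noise (hv : IsReinforcement v) (s : ℝ × ℝ) (η : ℕ → ℝ) (n : ℕ) :
    Measurable fun e => ∑ k ∈ Finset.range n, η k * noise v s e k :=
  Finset.measurable_fun_sum _ fun k _ => (measurable_section s (hv.measurable_noise k)).const_mul _

lemma integrable_sum_noise (hv : IsReinforcement v) (s : ℝ × ℝ) (η : ℕ → ℝ) (n : ℕ) :
    Integrable (fun e => ∑ k ∈ Finset.range n, η k * noise v s e k) expSeq :=
  Integrable.of_bound (hv.measurable_sum_noise s η n).aestronglyMeasurable _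
    (Eventually.of_forall fun e => hv.abs_sum_noise_le s e η n)

lemma integrable_sum_noise_sq (hv : IsReinforcement v) (s : ℝ × ℝ) (η : ℕ → ℝ) (n : ℕ) :
    Integrable (fun e => (∑ k ∈ Finset.range n, η k * noise v s e k) ^ 2) expSeq :=
  Integrable.of_bound ((hv.measurable_sum_noise s η n).pow_const 2).aestronglyMeasurable
    (((∑ k ∈ Finset.range n, |η k|) * (tail v (min s.1 s.2) + 1)) ^ 2)
    (Eventually.of_forall fun e => by
      rw [Real.norm_of_nonneg (sq_nonneg _), ← sq_abs]
      exact pow_le_pow_left₀ (abs_nonneg _) (hv.abs_sum_noise_le s e η n) 2)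

lemma integrable_drift (hv : IsReinforcement v) (s : ℝ × ℝ) (n : ℕ) :
    Integrable (fun e => drift v s e n) expSeq :=
  Integrable.of_bound (measurable_section s (hv.measurable_drift n)).aestronglyMeasurable 1
    (Eventually.of_forall fun e => by
      rw [Real.norm_of_nonneg (hv.drift_pos s e n).le]; exact hv.drift_le_one s e n)

lemma integrable_drift_sq (hv : IsReinforcement v) (s : ℝ × ℝ) (n : ℕ) :
    Integrable (fun e => drift v s e n ^ 2) expSeq :=
  Integrable.of_bound
    ((measurable_section s (hv.measurable_drift n)).pow_const 2).aestronglyMeasurable 1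
    (Eventually.of_forall fun e => by
      rw [Real.norm_of_nonneg (sq_nonneg _)]
      exact pow_le_one₀ (hv.drift_pos s e n).le (hv.drift_le_one s e n))

lemma sum_noise_cons (η : ℕ → ℝ) (a : ℝ) (n : ℕ) :
    ∑ k ∈ Finset.range (n + 1), η k * noise v s (consSeq (a, e)) k
      = η 0 * (tail v s.1 - tail v (s.1 + max a 0 / v s.2)
          - 1 / (v s.2 * v (s.1 + max a 0 / v s.2)))
        + ∑ k ∈ Finset.range n, η (k + 1) * noise v (chainStep v s a) e k := by
  rw [Finset.sum_range_succ', add_comm, noise_cons_zero]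
  simp only [noise_cons]

/-- Conditioning on the first clock leaves a chain of the same kind from a new state, so induction
works once the state and the weights are generalised. -/
lemma integral_sum_noise (hv : IsReinforcement v) (n : ℕ) (s : ℝ × ℝ) (η : ℕ → ℝ) :
    ∫ e, ∑ k ∈ Finset.range n, η k * noise v s e k ∂expSeq = 0 := by
  induction n generalizing s η with
  | zero => simp
  | succ n ih =>
    rw [integral_expSeq (hv.integrable_sum_noise s η (n + 1))]
    simp_rw [sum_noise_cons]
    have h1 : ∀ a, ∫ e, (η 0 * (tail v s.1 - tail v (s.1 + max a 0 / v s.2)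
          - 1 / (v s.2 * v (s.1 + max a 0 / v s.2)))
        + ∑ k ∈ Finset.range n, η (k + 1) * noise v (chainStep v s a) e k) ∂expSeq
        = η 0 * (tail v s.1 - tail v (s.1 + max a 0 / v s.2)
          - 1 / (v s.2 * v (s.1 + max a 0 / v s.2))) := by
      intro a
      rw [integral_add (integrable_const _)
        (hv.integrable_sum_noise (chainStep v s a) (fun k => η (k + 1)) n),
        ih (chainStep v s a) fun k => η (k + 1)]
      simp
    simp_rw [h1]
    have hm : Measurable fun a : ℝ => s.1 + max a 0 / v s.2 := by fun_prop
    rw [integral_const_mul, integral_sub, (hv.integral_tail_step s.1 s.2).1, sub_self, mul_zero]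
    · refine Integrable.of_bound
        (measurable_const.sub (hv.measurable_tail.comp hm)).aestronglyMeasurable (tail v s.1)
        (Eventually.of_forall fun a => ?_)
      have h2 := hv.tail_antitone (le_add_of_nonneg_right (a := s.1) (hv.stay_nonneg a s.2))
      have h3 := hv.tail_nonneg (s.1 + max a 0 / v s.2)
      rw [Real.norm_of_nonneg (by linarith)]
      linarith
    · refine Integrable.of_bound
        (((hv.measurable.comp hm).const_mul _).const_div _).aestronglyMeasurable 1
        (Eventually.of_forall fun a => ?_)
      exact (Real.norm_of_nonneg (hv.drift_pos s (consSeq (a, fun _ => 0)) 0).le).trans_le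
        (hv.drift_le_one s (consSeq (a, fun _ => 0)) 0)

/-- Martingale increments are orthogonal, and given the past each has variance equal to the second
moment of its compensator. -/
lemma integral_sum_noise_sq (hv : IsReinforcement v) (n : ℕ) (s : ℝ × ℝ) (η : ℕ → ℝ) :
    ∫ e, (∑ k ∈ Finset.range n, η k * noise v s e k) ^ 2 ∂expSeq
      = ∫ e, ∑ k ∈ Finset.range n, η k ^ 2 * drift v s e k ^ 2 ∂expSeq := by
  induction n generalizing s η with
  | zero => simp
  | succ n ih =>
    have hi : ∀ (s : ℝ × ℝ) (n : ℕ) (η : ℕ → ℝ), Integrable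
        (fun e => ∑ k ∈ Finset.range n, η k ^ 2 * drift v s e k ^ 2) expSeq :=
      fun s n η => integrable_finsetSum _ fun k _ => (hv.integrable_drift_sq s k).const_mul _
    rw [integral_expSeq (hv.integrable_sum_noise_sq s η (n + 1)), integral_expSeq (hi s (n + 1) η)]
    simp_rw [sum_noise_cons, Finset.sum_range_succ' _ n, drift_cons, drift_cons_zero]
    set A : ℝ → ℝ := fun a => tail v s.1 - tail v (s.1 + max a 0 / v s.2)
          - 1 / (v s.2 * v (s.1 + max a 0 / v s.2)) with hA
    set B : ℝ → ℝ := fun a => 1 / (v s.2 * v (s.1 + max a 0 / v s.2)) with hB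
    set Q : ℝ → ℝ := fun a => ∫ e, ∑ k ∈ Finset.range n,
      η (k + 1) ^ 2 * drift v (chainStep v s a) e k ^ 2 ∂expSeq with hQ
    -- Given the first clock, the cross term vanishes by `integral_sum_noise`.
    have h1 : ∀ a, ∫ e, (η 0 * A a
        + ∑ k ∈ Finset.range n, η (k + 1) * noise v (chainStep v s a) e k) ^ 2 ∂expSeq
        = η 0 ^ 2 * A a ^ 2 + Q a := by
      intro a
      have i1 := hv.integrable_sum_noise (chainStep v s a) (fun k => η (k + 1)) n
      have i2 := hv.integrable_sum_noise_sq (chainStep v s a) (fun k => η (k + 1)) n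
      simp_rw [add_sq]
      have i3 : Integrable (fun e => (η 0 * A a) ^ 2 + 2 * (η 0 * A a) *
          ∑ k ∈ Finset.range n, η (k + 1) * noise v (chainStep v s a) e k) expSeq :=
        (integrable_const _).add (i1.const_mul _)
      rw [integral_add i3 i2, integral_add (integrable_const _) (i1.const_mul _),
        integral_const_mul, hv.integral_sum_noise n (chainStep v s a) fun k => η (k + 1),
        ih (chainStep v s a) fun k => η (k + 1)]
      simp [mul_pow, hQ]
    have h2 : ∀ a, ∫ e, (∑ k ∈ Finset.range n, η (k + 1) ^ 2 * drift v (chainStep v s a) e k ^ 2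
        + η 0 ^ 2 * B a ^ 2) ∂expSeq = η 0 ^ 2 * B a ^ 2 + Q a := by
      intro a
      rw [integral_add (hi (chainStep v s a) n fun k => η (k + 1)) (integrable_const _)]
      simp [hQ, add_comm]
    have h3 : ∫ a, A a ^ 2 ∂expMeasure 1 = ∫ a, B a ^ 2 ∂expMeasure 1 :=
      (hv.integral_tail_step s.1 s.2).2
    have hm : Measurable fun a : ℝ => s.1 + max a 0 / v s.2 := by fun_prop
    have hBm : Measurable B := ((hv.measurable.comp hm).const_mul _).const_div _
    have hAm : Measurable A := (measurable_const.sub (hv.measurable_tail.comp hm)).sub hBm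
    have hQi : Integrable Q (expMeasure 1) := by
      have i1 : Integrable (fun p : ℝ × (ℕ → ℝ) => ∑ k ∈ Finset.range n,
          η (k + 1) ^ 2 * drift v (chainStep v s p.1) p.2 k ^ 2) ((expMeasure 1).prod expSeq) := by
        refine integrable_finsetSum _ fun k _ => Integrable.const_mul ?_ _
        refine Integrable.of_bound (Measurable.aestronglyMeasurable ?_) 1
          (Eventually.of_forall fun p => ?_)
        · exact ((hv.measurable_drift k).comp
            (((measurable_chainStep s).comp measurable_fst).prodMk measurable_snd)).pow_const 2
        · rw [Real.norm_of_nonneg (sq_nonneg _)]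
          exact pow_le_one₀ (hv.drift_pos _ _ _).le (hv.drift_le_one _ _ _)
      exact i1.integral_prod_left
    have hAi : Integrable (fun a => A a ^ 2) (expMeasure 1) :=
      Integrable.of_bound (hAm.pow_const 2).aestronglyMeasurable ((tail v (min s.1 s.2) + 1) ^ 2)
        (Eventually.of_forall fun a => by
          rw [Real.norm_of_nonneg (sq_nonneg _), ← sq_abs]
          exact pow_le_pow_left₀ (abs_nonneg _)
            (hv.abs_noise_le s (consSeq (a, fun _ => 0)) 0) 2)
    have hBi : Integrable (fun a => B a ^ 2) (expMeasure 1) :=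
      Integrable.of_bound (hBm.pow_const 2).aestronglyMeasurable 1
        (Eventually.of_forall fun a => by
          rw [Real.norm_of_nonneg (sq_nonneg _)]
          exact pow_le_one₀ (hv.drift_pos s (consSeq (a, fun _ => 0)) 0).le
            (hv.drift_le_one s (consSeq (a, fun _ => 0)) 0))
    refine (integral_congr_ae (Eventually.of_forall h1)).trans
      (Eq.trans ?_ (integral_congr_ae (Eventually.of_forall h2)).symm)
    rw [integral_add (hAi.const_mul _) hQi, integral_add (hBi.const_mul _) hQi,
      integral_const_mul, integral_const_mul, h3]

end IsReinforcement

end VRJP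

/-! ### First and second moment bounds for the probability of balance -/

namespace VRJP

open Set

/-- The driving sequences for which both local times diverge. -/
def bothInf (v : ℝ → ℝ) (s : ℝ × ℝ) : Set (ℕ → ℝ) :=
  {e | Tendsto (fun n => tail v (loc v s e n)) atTop (𝓝 0)}

/-- The probability that both local times diverge. -/
noncomputable def probInf (v : ℝ → ℝ) (s : ℝ × ℝ) : ℝ := expSeq.real (bothInf v s)

variable {v : ℝ → ℝ} {s : ℝ × ℝ} {e : ℕ → ℝ}

lemma probInf_nonneg : 0 ≤ probInf v s := measureReal_nonneg

lemma probInf_le_one : probInf v s ≤ 1 := measureReal_le_one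

lemma consSeq_mem_bothInf (a : ℝ) :
    consSeq (a, e) ∈ bothInf v s ↔ e ∈ bothInf v (chainStep v s a) := by
  simp only [bothInf, mem_ofPred_eq]
  rw [← tendsto_add_atTop_iff_nat 1]
  simp only [loc_cons]

lemma even_of_mem_bothInf (h : e ∈ bothInf v s) :
    Tendsto (fun n => tail v (loc v s e (2 * n))) atTop (𝓝 0) :=
  h.comp (tendsto_atTop_mono (fun n => (by omega : n ≤ 2 * n)) tendsto_id)

lemma odd_of_mem_bothInf (h : e ∈ bothInf v s) :
    Tendsto (fun n => tail v (loc v s e (2 * n + 1))) atTop (𝓝 0) :=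
  h.comp (tendsto_atTop_mono (fun n => (by omega : n ≤ 2 * n + 1)) tendsto_id)

/-- A Fatou bound for the probability of an event on which a sequence has a given limit. -/
lemma measureReal_mul_le_of_tendsto {Ω : Type*} [MeasurableSpace Ω] {μ : Measure Ω}
    [IsProbabilityMeasure μ] {S : Set Ω} (hS : MeasurableSet S) {f : ℕ → Ω → ℝ} {d C : ℝ}
    (hf : ∀ n, Integrable (f n) μ) (hf0 : ∀ n ω, 0 ≤ f n ω) (hC : ∀ n, ∫ ω, f n ω ∂μ ≤ C)
    (hlim : ∀ ω ∈ S, Tendsto (fun n => f n ω) atTop (𝓝 d)) : μ.real S * d ≤ C := by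
  have hC0 : 0 ≤ C := (integral_nonneg (hf0 0)).trans (hC 0)
  have h1 : ∫⁻ ω, S.indicator (fun _ => ENNReal.ofReal d) ω ∂μ ≤ ENNReal.ofReal C := by
    calc ∫⁻ ω, S.indicator (fun _ => ENNReal.ofReal d) ω ∂μ
        ≤ ∫⁻ ω, liminf (fun n => ENNReal.ofReal (f n ω)) atTop ∂μ := by
          refine lintegral_mono fun ω => ?_
          by_cases hω : ω ∈ S
          · rw [(ENNReal.tendsto_ofReal (hlim ω hω)).liminf_eq]
            simp [hω]
          · simp [hω]
      _ ≤ liminf (fun n => ∫⁻ ω, ENNReal.ofReal (f n ω) ∂μ) atTop :=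
          lintegral_liminf_le' fun n => (hf n).aemeasurable.ennreal_ofReal
      _ ≤ ENNReal.ofReal C := by
          refine liminf_le_of_le (by isBoundedDefault) fun b hb => ?_
          obtain ⟨n, hn⟩ := hb.exists
          refine hn.trans ?_
          rw [← ofReal_integral_eq_lintegral_ofReal (hf n) (Eventually.of_forall (hf0 n))]
          exact ENNReal.ofReal_le_ofReal (hC n)
  rw [lintegral_indicator_const hS, ← ofReal_measureReal,
    ← ENNReal.ofReal_mul' measureReal_nonneg] at h1
  rw [mul_comm]
  exact (ENNReal.ofReal_le_ofReal_iff hC0).1 h1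

lemma sum_range_two_mul (f : ℕ → ℝ) (n : ℕ) : ∑ k ∈ Finset.range (2 * n), f k
    = ∑ k ∈ Finset.range n, f (2 * k) + ∑ k ∈ Finset.range n, f (2 * k + 1) := by
  induction n with
  | zero => simp
  | succ n ih =>
    rw [mul_add, mul_one, Finset.sum_range_succ, Finset.sum_range_succ, ih, Finset.sum_range_succ,
      Finset.sum_range_succ]
    ring

namespace IsReinforcement

lemma measurableSet_bothInf_prod (hv : IsReinforcement v) :
    MeasurableSet {p : (ℝ × ℝ) × (ℕ → ℝ) | p.2 ∈ bothInf v p.1} :=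
  measurableSet_tendsto _ fun n => hv.measurable_tail_loc n

lemma measurableSet_bothInf (hv : IsReinforcement v) (s : ℝ × ℝ) : MeasurableSet (bothInf v s) :=
  measurable_prodMk_left hv.measurableSet_bothInf_prod

lemma measurable_probInf (hv : IsReinforcement v) : Measurable (probInf v) :=
  (measurable_measure_prodMk_left hv.measurableSet_bothInf_prod).ennreal_toReal

lemma ofReal_probInf : ENNReal.ofReal (probInf v s) = expSeq (bothInf v s) :=
  ofReal_measureReal

lemma integrable_probInf_comp (hv : IsReinforcement v) {Ω : Type*} [MeasurableSpace Ω]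
    {μ : Measure Ω} [IsProbabilityMeasure μ] {f : Ω → ℝ × ℝ} (hf : Measurable f) :
    Integrable (fun ω => probInf v (f ω)) μ :=
  Integrable.of_bound (hv.measurable_probInf.comp hf).aestronglyMeasurable 1
    (Eventually.of_forall fun _ => by
      rw [Real.norm_of_nonneg probInf_nonneg]; exact probInf_le_one)

/-- The Markov property at the first jump, as `bothInf` does not see a shift of the chain. Iterated,
it makes `probInf` along the chain a martingale. -/
lemma probInf_eq_integral (hv : IsReinforcement v) (s : ℝ × ℝ) :
    probInf v s = ∫ a, probInf v (chainStep v s a) ∂expMeasure 1 := by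
  have h1 := measure_expSeq (hv.measurableSet_bothInf s)
  simp_rw [consSeq_mem_bothInf, ofPred_mem_eq, ← ofReal_probInf] at h1
  rw [← ofReal_integral_eq_lintegral_ofReal
    (hv.integrable_probInf_comp (measurable_chainStep s))
    (Eventually.of_forall fun _ => probInf_nonneg)] at h1
  exact (ENNReal.ofReal_eq_ofReal_iff probInf_nonneg (integral_nonneg fun _ => probInf_nonneg)).1 h1

lemma measurable_chain_section (hv : IsReinforcement v) (s : ℝ × ℝ) (n : ℕ) :
    Measurable fun e => chain v s e n := measurable_section s (hv.measurable_chain n)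

lemma integral_probInf_chain (hv : IsReinforcement v) (n : ℕ) (s : ℝ × ℝ) :
    ∫ e, probInf v (chain v s e n) ∂expSeq = probInf v s := by
  induction n generalizing s with
  | zero => simp [chain]
  | succ n ih =>
    rw [integral_expSeq (hv.integrable_probInf_comp (hv.measurable_chain_section s _))]
    simp_rw [chain_cons, ih]
    exact (hv.probInf_eq_integral s).symm

lemma integrable_tail_loc (hv : IsReinforcement v) (s : ℝ × ℝ) (n : ℕ) :
    Integrable (fun e => tail v (loc v s e n)) expSeq :=
  Integrable.of_bound (measurable_section s (hv.measurable_tail_loc n)).aestronglyMeasurable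
    (tail v (min s.1 s.2)) (Eventually.of_forall fun e => by
      rw [Real.norm_of_nonneg (hv.tail_nonneg _)]; exact hv.tail_loc_le s e n)

lemma integral_noise (hv : IsReinforcement v) (s : ℝ × ℝ) (n : ℕ) :
    ∫ e, noise v s e n ∂expSeq = 0 := by
  have h1 := hv.integral_sum_noise (n + 1) s fun k => if k = n then 1 else 0
  simpa using h1

lemma integral_tail_loc (hv : IsReinforcement v) (s : ℝ × ℝ) (n : ℕ) :
    ∫ e, tail v (loc v s e (n + 2)) ∂expSeq
      = ∫ e, tail v (loc v s e n) ∂expSeq - ∫ e, drift v s e n ∂expSeq := by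
  have h1 := hv.integral_noise s n
  have i1 := hv.integrable_tail_loc s n
  have i2 := hv.integrable_tail_loc s (n + 2)
  simp only [noise] at h1
  have i3 : Integrable (fun e => tail v (loc v s e n) - tail v (loc v s e (n + 2))) expSeq :=
    i1.sub i2
  rw [integral_sub i3 (hv.integrable_drift s n), integral_sub i1 i2] at h1
  linarith

lemma integral_tail_even (hv : IsReinforcement v) (s : ℝ × ℝ) (n : ℕ) :
    ∫ e, tail v (loc v s e (2 * n)) ∂expSeq
      = tail v s.1 - ∑ k ∈ Finset.range n, ∫ e, drift v s e (2 * k) ∂expSeq := by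
  induction n with
  | zero => simp
  | succ n ih =>
    rw [mul_add, mul_one, hv.integral_tail_loc, ih, Finset.sum_range_succ]
    ring

lemma integral_tail_odd (hv : IsReinforcement v) (s : ℝ × ℝ) (n : ℕ) :
    ∫ e, tail v (loc v s e (2 * n + 1)) ∂expSeq
      = tail v s.2 - ∑ k ∈ Finset.range n, ∫ e, drift v s e (2 * k + 1) ∂expSeq := by
  induction n with
  | zero => simp
  | succ n ih =>
    rw [show 2 * (n + 1) + 1 = (2 * n + 1) + 2 by ring, hv.integral_tail_loc, ih,
      Finset.sum_range_succ]
    ring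

lemma sum_drift_even_le (hv : IsReinforcement v) (s : ℝ × ℝ) (n : ℕ) :
    ∑ k ∈ Finset.range n, ∫ e, drift v s e (2 * k) ∂expSeq ≤ tail v s.1 := by
  have h1 := hv.integral_tail_even s n
  have h2 : 0 ≤ ∫ e, tail v (loc v s e (2 * n)) ∂expSeq := integral_nonneg fun _ => hv.tail_nonneg _
  linarith

lemma sum_drift_odd_le_even (hv : IsReinforcement v) (s : ℝ × ℝ) (n : ℕ) :
    ∑ k ∈ Finset.range n, ∫ e, drift v s e (2 * k + 1) ∂expSeq
      ≤ ∑ k ∈ Finset.range n, ∫ e, drift v s e (2 * k) ∂expSeq :=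
  Finset.sum_le_sum fun _ _ => integral_mono (hv.integrable_drift s _) (hv.integrable_drift s _)
    fun e => hv.antitone_drift s e (Nat.le_succ _)

lemma sum_drift_odd_le (hv : IsReinforcement v) (s : ℝ × ℝ) (n : ℕ) :
    ∑ k ∈ Finset.range n, ∫ e, drift v s e (2 * k + 1) ∂expSeq ≤ tail v s.2 := by
  have h1 := hv.integral_tail_odd s n
  have h2 : 0 ≤ ∫ e, tail v (loc v s e (2 * n + 1)) ∂expSeq :=
    integral_nonneg fun _ => hv.tail_nonneg _
  linarith

/-- Each even compensator after the first is dominated by the odd one just before it, and the odd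
ones have total mean at most the tail at the other vertex. -/
lemma sum_drift_even_le_add (hv : IsReinforcement v) (s : ℝ × ℝ) (n : ℕ) :
    ∑ k ∈ Finset.range n, ∫ e, drift v s e (2 * k) ∂expSeq
      ≤ 1 / (v s.1 * v s.2) + tail v s.2 := by
  have hk : 0 < 1 / (v s.1 * v s.2) := one_div_pos.2 (mul_pos (hv.pos _) (hv.pos _))
  cases n with
  | zero => simpa using (add_pos hk (hv.tail_pos _)).le
  | succ n =>
    rw [Finset.sum_range_succ', add_comm]
    refine add_le_add ?_ ((Finset.sum_le_sum fun k _ => ?_).trans (hv.sum_drift_odd_le s n))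
    · refine (integral_mono (hv.integrable_drift s _) (integrable_const (1 / (v s.1 * v s.2)))
        fun e => hv.drift_le s e _).trans_eq ?_
      simp
    · exact integral_mono (hv.integrable_drift s _) (hv.integrable_drift s _)
        fun e => hv.antitone_drift s e (by omega)

/-- On `bothInf` the tail at the starting vertex is used up entirely, while its expected consumption
is the sum of the even compensators, which the other vertex controls. -/
lemma probInf_mul_tail_fst_le (hv : IsReinforcement v) (s : ℝ × ℝ) :
    probInf v s * tail v s.1 ≤ 1 / (v s.1 * v s.2) + tail v s.2 := by
  refine measureReal_mul_le_of_tendsto (hv.measurableSet_bothInf s)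
    (f := fun n e => tail v s.1 - tail v (loc v s e (2 * n)))
    (fun n => (integrable_const _).sub (hv.integrable_tail_loc s _))
    (fun n e => sub_nonneg.2 (hv.tail_antitone (hv.fst_le_loc s e n))) (fun n => ?_) fun e he => ?_
  · rw [integral_sub (integrable_const _) (hv.integrable_tail_loc s _), hv.integral_tail_even]
    have h1 := hv.sum_drift_even_le_add s n
    simpa using h1
  · simpa using (even_of_mem_bothInf he).const_sub (tail v s.1)

lemma sum_alternating_noise (s : ℝ × ℝ) (e : ℕ → ℝ) (n : ℕ) :
    ∑ k ∈ Finset.range (2 * n), (-1) ^ k * noise v s e k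
      = (tail v s.1 - tail v (loc v s e (2 * n))) - (tail v s.2 - tail v (loc v s e (2 * n + 1)))
        - ∑ k ∈ Finset.range n, (drift v s e (2 * k) - drift v s e (2 * k + 1)) := by
  induction n with
  | zero => simp
  | succ n ih =>
    rw [mul_add, mul_one, Finset.sum_range_succ, Finset.sum_range_succ, ih, Finset.sum_range_succ]
    have h1 : (-1 : ℝ) ^ (2 * n) = 1 := by simp
    rw [pow_succ, h1]
    simp only [noise]
    ring_nf

/-- An alternating sum of a decreasing positive sequence is at most its first term. -/
lemma sum_drift_sub_mem (hv : IsReinforcement v) (s : ℝ × ℝ) (e : ℕ → ℝ) (n : ℕ) :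
    |∑ k ∈ Finset.range n, (drift v s e (2 * k) - drift v s e (2 * k + 1))|
      ≤ 1 / (v s.1 * v s.2) := by
  have h1 : ∀ n, ∑ k ∈ Finset.range n, (drift v s e (2 * k) - drift v s e (2 * k + 1))
      ≤ drift v s e 0 - drift v s e (2 * n) := by
    intro n
    induction n with
    | zero => simp
    | succ n ih =>
      rw [Finset.sum_range_succ]
      have := hv.antitone_drift s e (show 2 * n + 1 ≤ 2 * (n + 1) by omega)
      linarith
  rw [abs_of_nonneg (Finset.sum_nonneg fun k _ =>
    sub_nonneg.2 (hv.antitone_drift s e (Nat.le_succ _)))]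
  have := hv.drift_pos s e (2 * n)
  linarith [h1 n, hv.drift_le s e 0]

/-- On `bothInf` both tails tend to zero, so the difference of consumptions tends to the initial
difference of tails. That difference is the alternating martingale plus a remainder of size `κ`, and
the martingale has second moment at most `κ` times the total expected compensator. -/
lemma probInf_mul_sq_le (hv : IsReinforcement v) (s : ℝ × ℝ) :
    probInf v s * (tail v s.2 - tail v s.1) ^ 2
      ≤ 4 * (1 / (v s.1 * v s.2)) * tail v s.1 + 2 * (1 / (v s.1 * v s.2)) ^ 2 := by
  set κ := 1 / (v s.1 * v s.2) with hκ
  have hκ0 : 0 < κ := one_div_pos.2 (mul_pos (hv.pos _) (hv.pos _))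
  have hint : ∀ n, Integrable (fun e => (tail v s.1 - tail v (loc v s e (2 * n))
      - (tail v s.2 - tail v (loc v s e (2 * n + 1)))) ^ 2) expSeq := fun n => by
    have m1 := measurable_section s (hv.measurable_tail_loc (2 * n))
    have m2 := measurable_section s (hv.measurable_tail_loc (2 * n + 1))
    refine Integrable.of_bound (Measurable.aestronglyMeasurable (by fun_prop))
      ((2 * tail v (min s.1 s.2)) ^ 2) (Eventually.of_forall fun e => ?_)
    rw [Real.norm_of_nonneg (sq_nonneg _), ← sq_abs]
    refine pow_le_pow_left₀ (abs_nonneg _) ?_ 2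
    have h1 := hv.tail_loc_le s e 0
    have h2 := hv.tail_loc_le s e 1
    have h3 := hv.tail_antitone (hv.fst_le_loc s e n)
    have h4 := hv.tail_antitone (hv.snd_le_loc s e n)
    have h5 := hv.tail_nonneg (loc v s e (2 * n))
    have h6 := hv.tail_nonneg (loc v s e (2 * n + 1))
    simp only [loc_zero, loc_one] at h1 h2
    have h7 := hv.tail_nonneg (min s.1 s.2)
    rw [abs_le]
    constructor <;> linarith
  refine measureReal_mul_le_of_tendsto (hv.measurableSet_bothInf s)
    (f := fun n e => (tail v s.1 - tail v (loc v s e (2 * n))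
      - (tail v s.2 - tail v (loc v s e (2 * n + 1)))) ^ 2)
    hint (fun n e => sq_nonneg _) (fun n => ?_) fun e he => ?_
  · have i1 := hv.integrable_sum_noise_sq s (fun k => (-1) ^ k) (2 * n)
    calc ∫ e, (tail v s.1 - tail v (loc v s e (2 * n))
          - (tail v s.2 - tail v (loc v s e (2 * n + 1)))) ^ 2 ∂expSeq
        ≤ ∫ e, (2 * (∑ k ∈ Finset.range (2 * n), (-1) ^ k * noise v s e k) ^ 2 + 2 * κ ^ 2)
            ∂expSeq := by
          refine integral_mono (hint n) ((i1.const_mul 2).add (integrable_const _)) fun e => ?_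
          have h1 := sum_alternating_noise (v := v) s e n
          have h2 := hv.sum_drift_sub_mem s e n
          simp only
          set D := ∑ k ∈ Finset.range n, (drift v s e (2 * k) - drift v s e (2 * k + 1))
          set M := ∑ k ∈ Finset.range (2 * n), (-1 : ℝ) ^ k * noise v s e k
          have h3 : tail v s.1 - tail v (loc v s e (2 * n))
            - (tail v s.2 - tail v (loc v s e (2 * n + 1))) = M + D := by linarith
          rw [h3]
          have h4 : D ^ 2 ≤ κ ^ 2 := by
            rw [← sq_abs D]; exact pow_le_pow_left₀ (abs_nonneg _) h2 2
          nlinarith [sq_nonneg (M - D)]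
      _ = 2 * ∫ e, ∑ k ∈ Finset.range (2 * n), drift v s e k ^ 2 ∂expSeq + 2 * κ ^ 2 := by
          rw [integral_add (i1.const_mul 2) (integrable_const _), integral_const_mul,
            hv.integral_sum_noise_sq]
          simp [← pow_mul]
      _ ≤ 2 * ∫ e, ∑ k ∈ Finset.range (2 * n), κ * drift v s e k ∂expSeq + 2 * κ ^ 2 := by
          refine add_le_add_left (mul_le_mul_of_nonneg_left (integral_mono
            (integrable_finsetSum _ fun k _ => hv.integrable_drift_sq s k)
            (integrable_finsetSum _ fun k _ => (hv.integrable_drift s k).const_mul _)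
            fun e => Finset.sum_le_sum fun k _ => ?_) zero_le_two) _
          rw [pow_two]
          exact mul_le_mul_of_nonneg_right (hv.drift_le s e k) (hv.drift_pos s e k).le
      _ ≤ 4 * κ * tail v s.1 + 2 * κ ^ 2 := by
          rw [integral_finsetSum _ fun k _ => (hv.integrable_drift s k).const_mul _]
          -- Odd compensators are dominated by even ones, and the even ones have total mean at most
          -- `tail v s.1`; hence the constant `4 = 2 * 2`.
          simp_rw [integral_const_mul]
          rw [← Finset.mul_sum, sum_range_two_mul]
          have h1 := hv.sum_drift_odd_le_even s n
          have h2 := hv.sum_drift_even_le s n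
          nlinarith
  · have h1 := ((even_of_mem_bothInf he).const_sub (tail v s.1)).sub
      ((odd_of_mem_bothInf he).const_sub (tail v s.2))
    have h2 := h1.pow 2
    have h3 : (tail v s.1 - 0 - (tail v s.2 - 0)) ^ 2 = (tail v s.2 - tail v s.1) ^ 2 := by ring
    rwa [h3] at h2

end IsReinforcement

end VRJP

/-! ### Memorylessness, scaling of clocks, and deviation bounds -/

namespace VRJP

open Set

/-- Memorylessness of the exponential law. -/
lemma setLIntegral_Ioi_expMeasure {t : ℝ} (ht : 0 ≤ t) {f : ℝ → ℝ≥0∞} (hf : Measurable f) :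
    ∫⁻ x in Ioi t, f x ∂expMeasure 1
      = ENNReal.ofReal (Real.exp (-t)) * ∫⁻ x, f (t + x) ∂expMeasure 1 := by
  have hft : Measurable fun x => f (t + x) := hf.comp (measurable_const_add t)
  rw [← lintegral_indicator measurableSet_Ioi, lintegral_expMeasure (hf.indicator measurableSet_Ioi),
    lintegral_expMeasure hft, ← lintegral_const_mul _ (by fun_prop),
    ← lintegral_indicator measurableSet_Ioi, ← lintegral_indicator measurableSet_Ioi,
    ← lintegral_add_left_eq_self _ t]
  refine lintegral_congr fun x => ?_
  by_cases hx : 0 < x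
  · have h1 : 0 < t + x := by linarith
    simp only [indicator, mem_Ioi, hx, h1, if_true, lt_add_iff_pos_right]
    rw [← mul_assoc, ← ENNReal.ofReal_mul (Real.exp_pos _).le, ← Real.exp_add]
    ring_nf
  · simp [indicator, hx]

lemma sq_lintegral_mul_le {α : Type*} [MeasurableSpace α] {μ : Measure α} {f g : α → ℝ≥0∞}
    (hf : Measurable f) (hg : Measurable g) :
    (∫⁻ x, f x * g x ∂μ) ^ 2 ≤ (∫⁻ x, f x ^ 2 ∂μ) * ∫⁻ x, g x ^ 2 ∂μ := by
  have h := ENNReal.lintegral_mul_le_Lp_mul_Lq μ Real.HolderConjugate.two_two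
    hf.aemeasurable hg.aemeasurable
  simp only [ENNReal.rpow_two, Pi.mul_apply] at h
  calc (∫⁻ x, f x * g x ∂μ) ^ 2
      ≤ ((∫⁻ x, f x ^ 2 ∂μ) ^ (1 / 2 : ℝ) * (∫⁻ x, g x ^ 2 ∂μ) ^ (1 / 2 : ℝ)) ^ 2 := by gcongr
    _ = _ := by
        rw [mul_pow, ← ENNReal.rpow_natCast, ← ENNReal.rpow_natCast, ← ENNReal.rpow_mul,
          ← ENNReal.rpow_mul]
        norm_num

/-- Scale the terms of a sequence by factors `1 + θ n`. -/
def scaleSeq (θ : ℕ → ℝ) (e : ℕ → ℝ) : ℕ → ℝ := fun n => (1 + θ n) * e n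

lemma measurable_scaleSeq (θ : ℕ → ℝ) : Measurable (scaleSeq θ) :=
  measurable_pi_iff.2 fun n => (measurable_pi_apply n).const_mul _

lemma scaleSeq_cons (θ : ℕ → ℝ) (a : ℝ) (e : ℕ → ℝ) : scaleSeq θ (consSeq (a, e))
    = consSeq ((1 + θ 0) * a, scaleSeq (fun n => θ (n + 1)) e) := by
  funext n
  cases n <;> rfl

/-- The one-variable `L²` bound tensorises over the finitely many scaled coordinates. -/
lemma lintegral_scaleSeq_sq_le {t : ℝ} (h1 : t < 1) (n : ℕ) {θ : ℕ → ℝ} (h0 : ∀ k, 0 ≤ θ k)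
    (ht : ∀ k, θ k ≤ t) (hn : ∀ k, n ≤ k → θ k = 0) {f : (ℕ → ℝ) → ℝ≥0∞} (hf : Measurable f) :
    (∫⁻ e, f (scaleSeq θ e) ∂expSeq) ^ 2
      ≤ ENNReal.ofReal (1 / (1 - t ^ 2)) ^ n * ∫⁻ e, f e ^ 2 ∂expSeq := by
  induction n generalizing θ f with
  | zero =>
    have h2 : ∀ e, scaleSeq θ e = e := fun e => funext fun k => by simp [scaleSeq, hn k (Nat.zero_le k)]
    simp_rw [h2]
    simpa using sq_lintegral_mul_le (μ := expSeq) (measurable_const (a := (1 : ℝ≥0∞))) hf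
  | succ n ih =>
    have ht0 : 0 ≤ t := (h0 0).trans (ht 0)
    have hm : Measurable fun p : ℝ × (ℕ → ℝ) => f (consSeq (p.1, scaleSeq (fun n => θ (n + 1)) p.2)) :=
      hf.comp (measurable_consSeq.comp
        (measurable_fst.prodMk ((measurable_scaleSeq _).comp measurable_snd)))
    rw [lintegral_expSeq (f := fun e => f (scaleSeq θ e)) (hf.comp (measurable_scaleSeq θ)), lintegral_expSeq (hf.pow_const 2)]
    simp_rw [scaleSeq_cons]
    set φ : ℝ → ℝ≥0∞ := fun a => ∫⁻ e, f (consSeq (a, scaleSeq (fun n => θ (n + 1)) e)) ∂expSeq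
    have hφ : Measurable φ := hm.lintegral_prod_right'
    have h2 : ∀ a, φ a ^ 2 ≤ ENNReal.ofReal (1 / (1 - t ^ 2)) ^ n
        * ∫⁻ e, f (consSeq (a, e)) ^ 2 ∂expSeq := fun a =>
      ih (fun k => h0 (k + 1)) (fun k => ht (k + 1)) (fun k hk => hn (k + 1) (by omega))
        (f := fun e => f (consSeq (a, e)))
        (hf.comp (measurable_consSeq.comp measurable_prodMk_left))
    have h3 : ENNReal.ofReal (1 / (1 - θ 0 ^ 2)) ≤ ENNReal.ofReal (1 / (1 - t ^ 2)) := by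
      refine ENNReal.ofReal_le_ofReal (one_div_le_one_div_of_le (by nlinarith) ?_)
      nlinarith [pow_le_pow_left₀ (h0 0) (ht 0) 2]
    calc (∫⁻ a, φ ((1 + θ 0) * a) ∂expMeasure 1) ^ 2
        ≤ ENNReal.ofReal (1 / (1 - θ 0 ^ 2)) * ∫⁻ a, φ a ^ 2 ∂expMeasure 1 :=
          lintegral_scale_expMeasure_sq_le (h0 0) ((ht 0).trans_lt h1) hφ
      _ ≤ ENNReal.ofReal (1 / (1 - t ^ 2)) * ∫⁻ a, ENNReal.ofReal (1 / (1 - t ^ 2)) ^ n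
            * ∫⁻ e, f (consSeq (a, e)) ^ 2 ∂expSeq ∂expMeasure 1 :=
          mul_le_mul' h3 (lintegral_mono h2)
      _ = _ := by
          have hm2 : Measurable fun p : ℝ × (ℕ → ℝ) => f (consSeq p) ^ 2 :=
            (hf.comp measurable_consSeq).pow_const 2
          rw [lintegral_const_mul _ hm2.lintegral_prod_right',
            ← mul_assoc, ← pow_succ']

/-- An unlikely event stays unlikely after scaling; for `t` of order `1 / √n` the constant is
bounded uniformly in `n`. -/
lemma measure_scaleSeq_preimage_sq_le {t : ℝ} (h1 : t < 1) (n : ℕ) {θ : ℕ → ℝ} (h0 : ∀ k, 0 ≤ θ k)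
    (ht : ∀ k, θ k ≤ t) (hn : ∀ k, n ≤ k → θ k = 0) {B : Set (ℕ → ℝ)} (hB : MeasurableSet B) :
    expSeq (scaleSeq θ ⁻¹' B) ^ 2 ≤ ENNReal.ofReal (1 / (1 - t ^ 2)) ^ n * expSeq B := by
  have h := lintegral_scaleSeq_sq_le h1 n h0 ht hn (f := B.indicator 1)
    (measurable_one.indicator hB)
  have h2 : ∀ e, B.indicator (1 : (ℕ → ℝ) → ℝ≥0∞) e ^ 2 = B.indicator 1 e := fun e => by
    by_cases he : e ∈ B <;> simp [he]
  simp_rw [h2] at h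
  rw [lintegral_indicator_one hB] at h
  have h3 : ∀ e, B.indicator (1 : (ℕ → ℝ) → ℝ≥0∞) (scaleSeq θ e)
      = (scaleSeq θ ⁻¹' B).indicator 1 e := fun e => rfl
  simp_rw [h3] at h
  rwa [lintegral_indicator_one (measurable_scaleSeq θ hB)] at h

lemma lintegral_prod_expSeq (n : ℕ) {f : ℕ → ℝ → ℝ≥0∞} (hf : ∀ k, Measurable (f k)) :
    ∫⁻ e, ∏ k ∈ Finset.range n, f k (e k) ∂expSeq
      = ∏ k ∈ Finset.range n, ∫⁻ a, f k a ∂expMeasure 1 := by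
  induction n generalizing f with
  | zero => simp
  | succ n ih =>
    have hm : ∀ f : ℕ → ℝ → ℝ≥0∞, (∀ k, Measurable (f k)) → ∀ n,
        Measurable fun e : ℕ → ℝ => ∏ k ∈ Finset.range n, f k (e k) := fun f hf n =>
      Finset.measurable_fun_prod _ fun k _ => (hf k).comp (measurable_pi_apply k)
    rw [lintegral_expSeq (hm f hf _)]
    simp_rw [Finset.prod_range_succ' _ n, consSeq_zero, consSeq_succ]
    simp_rw [lintegral_mul_const _ (hm (fun k => f (k + 1)) (fun k => hf (k + 1)) n),
      ih fun k => hf (k + 1)]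
    rw [lintegral_const_mul _ (hf 0)]

lemma lintegral_ofReal_expMeasure : ∫⁻ x, ENNReal.ofReal x ∂expMeasure 1 = 1 := by
  have h := lintegral_primitive_expMeasure (h := fun _ => 1) measurable_const
    (fun t _ => intervalIntegrable_const) (fun _ => zero_le_one)
  simpa using h

/-- Markov bound for a sum of exponential variables. -/
lemma expSeq_sum_ge_le {N : ℕ} (hN : 0 < N) (i : ℕ → ℕ) :
    expSeq {e | 4 * (N : ℝ) ≤ ∑ k ∈ Finset.range N, max (e (i k)) 0} ≤ 1 / 4 := by
  have hm : ∀ k, Measurable fun e : ℕ → ℝ => ENNReal.ofReal (max (e (i k)) 0) := fun k =>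
    ((measurable_pi_apply _).max measurable_const).ennreal_ofReal
  have h1 : ∫⁻ e, ∑ k ∈ Finset.range N, ENNReal.ofReal (max (e (i k)) 0) ∂expSeq = N := by
    rw [lintegral_finsetSum _ fun k _ => hm k]
    have h2 : ∀ k, ∫⁻ e, ENNReal.ofReal (max (e (i k)) 0) ∂expSeq = 1 := fun k => by
      have h3 := (measurePreserving_eval_infinitePi (fun _ : ℕ => expMeasure 1) (i k)).lintegral_comp
        (f := ENNReal.ofReal) ENNReal.measurable_ofReal
      rw [lintegral_ofReal_expMeasure] at h3
      rw [← h3]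
      refine lintegral_congr fun e => ?_
      simp [ENNReal.ofReal_max]
    simp only [h2, Finset.sum_const, Finset.card_range, nsmul_eq_mul, mul_one]
  have h4 := mul_meas_ge_le_lintegral (μ := expSeq) (Finset.measurable_fun_sum (Finset.range N) fun k _ => hm k)
    (ENNReal.ofReal (4 * N))
  rw [h1] at h4
  have h5 : {e : ℕ → ℝ | 4 * (N : ℝ) ≤ ∑ k ∈ Finset.range N, max (e (i k)) 0}
      ⊆ {e | ENNReal.ofReal (4 * N) ≤ ∑ k ∈ Finset.range N, ENNReal.ofReal (max (e (i k)) 0)} := by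
    intro e he
    rw [mem_ofPred_eq, ← ENNReal.ofReal_sum_of_nonneg fun k _ => le_max_right _ _]
    exact ENNReal.ofReal_le_ofReal he
  have h6 : ENNReal.ofReal (4 * N) = 4 * N := by
    rw [ENNReal.ofReal_mul (by norm_num), ENNReal.ofReal_natCast]; norm_num
  rw [h6] at h4
  have hN' : (N : ℝ≥0∞) ≠ 0 := by exact_mod_cast hN.ne'
  refine (measure_mono (h5.trans_eq (by rw [h6]))).trans ?_
  rw [ENNReal.le_div_iff_mul_le (by norm_num) (by norm_num)]
  rw [mul_assoc, mul_comm (N : ℝ≥0∞), ← mul_assoc] at h4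
  have h7 := ENNReal.mul_le_mul_iff_left hN' (ENNReal.natCast_ne_top N) |>.1 (h4.trans_eq (one_mul _).symm)
  rwa [mul_comm] at h7

/-- Chernoff bound for the lower tail of a sum of exponential variables. -/
lemma expSeq_sum_le_le (n : ℕ) (J : Finset ℕ) (hJ : J ⊆ Finset.range n) (M : ℝ) :
    expSeq {e | ∑ k ∈ J, max (e k) 0 ≤ M} ≤ ENNReal.ofReal (Real.exp M * (1 / 2) ^ J.card) := by
  set f : ℕ → ℝ → ℝ≥0∞ := fun k a => if k ∈ J then ENNReal.ofReal (Real.exp (-(max a 0))) else 1 with hf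
  have hfm : ∀ k, Measurable (f k) := fun k => by
    by_cases hk : k ∈ J
    · simp only [hf, hk, if_true]; fun_prop
    · simp only [hf, hk, if_false]; fun_prop
  have h0 : ∫⁻ a, ENNReal.ofReal (Real.exp (-(max a 0))) ∂expMeasure 1 = ENNReal.ofReal (1 / 2) := by
    have h1 := lintegral_exp_mul_expMeasure (l := -1) (by norm_num)
    norm_num at h1 ⊢
    rw [← h1]
    refine lintegral_congr_ae ?_
    filter_upwards [ae_pos_expMeasure] with a ha
    rw [max_eq_left ha.le]
  have h1 : ∫⁻ e, ∏ k ∈ Finset.range n, f k (e k) ∂expSeq = ENNReal.ofReal ((1 / 2) ^ J.card) := by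
    rw [lintegral_prod_expSeq n hfm]
    have h2 : ∀ k, ∫⁻ a, f k a ∂expMeasure 1 = if k ∈ J then ENNReal.ofReal (1 / 2) else 1 := by
      intro k
      by_cases hk : k ∈ J
      · simp only [hf, hk, if_true, h0]
      · simp [hf, hk]
    simp_rw [h2]
    rw [Finset.prod_ite_mem, Finset.inter_eq_right.2 hJ, Finset.prod_const, ENNReal.ofReal_pow (by norm_num)]
  have h3 : ∀ e : ℕ → ℝ, ∏ k ∈ Finset.range n, f k (e k)
      = ENNReal.ofReal (Real.exp (-∑ k ∈ J, max (e k) 0)) := fun e => by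
    simp only [hf]
    rw [Finset.prod_ite_mem, Finset.inter_eq_right.2 hJ,
      ← ENNReal.ofReal_prod_of_nonneg fun k _ => (Real.exp_pos _).le, ← Real.exp_sum,
      Finset.sum_neg_distrib]
  have h4 := mul_meas_ge_le_lintegral (μ := expSeq)
    (Finset.measurable_fun_prod (Finset.range n) fun k _ => (hfm k).comp (measurable_pi_apply k))
    (ENNReal.ofReal (Real.exp (-M)))
  simp only [Function.comp_def] at h4
  rw [h1] at h4
  simp_rw [h3] at h4
  have h5 : {e : ℕ → ℝ | ∑ k ∈ J, max (e k) 0 ≤ M} ⊆ {e | ENNReal.ofReal (Real.exp (-M))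
      ≤ ENNReal.ofReal (Real.exp (-∑ k ∈ J, max (e k) 0))} := fun e he =>
    ENNReal.ofReal_le_ofReal (Real.exp_le_exp.2 (neg_le_neg he))
  refine (measure_mono h5).trans ?_
  have h6 := mul_le_mul_right h4 (ENNReal.ofReal (Real.exp M))
  rw [← mul_assoc, ← ENNReal.ofReal_mul (Real.exp_pos _).le, ← Real.exp_add,
    ← ENNReal.ofReal_mul (Real.exp_pos _).le] at h6
  simpa using h6

end VRJP

/-! ### Monotone coupling and growth control of the weight -/

namespace VRJP

open Set

variable {v : ℝ → ℝ}

namespace IsReinforcement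

lemma loc_even_le (hv : IsReinforcement v) (s : ℝ × ℝ) (e : ℕ → ℝ) (n : ℕ) :
    loc v s e (2 * n) ≤ s.1 + (∑ k ∈ Finset.range n, max (e (2 * k)) 0) / v s.2 := by
  induction n with
  | zero => simp
  | succ n ih =>
    rw [Finset.sum_range_succ, add_div, mul_add, mul_one, loc_add_two]
    have h1 : max (e (2 * n)) 0 / v (loc v s e (2 * n + 1)) ≤ max (e (2 * n)) 0 / v s.2 :=
      div_le_div_of_nonneg_left (le_max_right _ _) (hv.pos _) (hv.mono (hv.snd_le_loc s e n))
    linarith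

lemma loc_odd_le (hv : IsReinforcement v) (s : ℝ × ℝ) (e : ℕ → ℝ) (n : ℕ) :
    loc v s e (2 * n + 1)
      ≤ s.2 + (∑ k ∈ Finset.range n, max (e (2 * k + 1)) 0) / v s.1 := by
  induction n with
  | zero => simp
  | succ n ih =>
    rw [Finset.sum_range_succ, add_div, show 2 * (n + 1) + 1 = (2 * n + 1) + 2 by ring, loc_add_two]
    have h1 : max (e (2 * n + 1)) 0 / v (loc v s e (2 * n + 1 + 1))
        ≤ max (e (2 * n + 1)) 0 / v s.1 :=
      div_le_div_of_nonneg_left (le_max_right _ _) (hv.pos _)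
        (hv.mono (hv.fst_le_loc s e (n + 1)))
    linarith

/-- Monotone coupling: longer stays at the starting vertex and shorter ones at the other vertex
increase the local time of the former and decrease that of the latter. -/
lemma coupling (hv : IsReinforcement v) (s : ℝ × ℝ) {e e' : ℕ → ℝ}
    (h0 : ∀ k, max (e (2 * k)) 0 ≤ max (e' (2 * k)) 0)
    (h1 : ∀ k, max (e' (2 * k + 1)) 0 ≤ max (e (2 * k + 1)) 0) (n : ℕ) :
    loc v s e (2 * n) ≤ loc v s e' (2 * n) ∧ loc v s e' (2 * n + 1) ≤ loc v s e (2 * n + 1) ∧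
      (∑ k ∈ Finset.range n, (max (e' (2 * k)) 0 - max (e (2 * k)) 0) / v (loc v s e (2 * k + 1)))
        ≤ loc v s e' (2 * n) - loc v s e (2 * n) := by
  induction n with
  | zero => simp
  | succ n ih =>
    obtain ⟨i1, i2, i3⟩ := ih
    have d0 : 0 ≤ (max (e' (2 * n)) 0 - max (e (2 * n)) 0) / v (loc v s e (2 * n + 1)) :=
      div_nonneg (sub_nonneg.2 (h0 n)) (hv.pos _).le
    have d1 : (max (e' (2 * n)) 0 - max (e (2 * n)) 0) / v (loc v s e (2 * n + 1))
        ≤ max (e' (2 * n)) 0 / v (loc v s e' (2 * n + 1))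
          - max (e (2 * n)) 0 / v (loc v s e (2 * n + 1)) := by
      rw [sub_div]
      exact sub_le_sub_right
        (div_le_div_of_nonneg_left (le_max_right _ _) (hv.pos _) (hv.mono i2)) _
    have j1 : loc v s e (2 * (n + 1)) ≤ loc v s e' (2 * (n + 1)) := by
      rw [mul_add, mul_one, loc_add_two, loc_add_two]; linarith
    refine ⟨j1, ?_, ?_⟩
    · rw [show 2 * (n + 1) + 1 = (2 * n + 1) + 2 by ring, loc_add_two (e := e) (2 * n + 1),
      loc_add_two (e := e') (2 * n + 1)]
      have : max (e' (2 * n + 1)) 0 / v (loc v s e' (2 * n + 1 + 1))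
          ≤ max (e (2 * n + 1)) 0 / v (loc v s e (2 * n + 1 + 1)) :=
        div_le_div₀ (le_max_right _ _) (h1 n) (hv.pos _) (hv.mono j1)
      linarith
    · rw [Finset.sum_range_succ, mul_add, mul_one, loc_add_two, loc_add_two]; linarith

/-- Under the coupling every stay at the other vertex has a smaller clock and a larger rate, so the
gap there can only widen. -/
lemma coupling_odd_gap (hv : IsReinforcement v) (s : ℝ × ℝ) {e e' : ℕ → ℝ}
    (h0 : ∀ k, max (e (2 * k)) 0 ≤ max (e' (2 * k)) 0)
    (h1 : ∀ k, max (e' (2 * k + 1)) 0 ≤ max (e (2 * k + 1)) 0) :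
    Monotone fun n => loc v s e (2 * n + 1) - loc v s e' (2 * n + 1) := by
  refine monotone_nat_of_le_succ fun n => ?_
  rw [show 2 * (n + 1) + 1 = (2 * n + 1) + 2 by ring, loc_add_two (e := e) (2 * n + 1),
      loc_add_two (e := e') (2 * n + 1)]
  have : max (e' (2 * n + 1)) 0 / v (loc v s e' (2 * n + 1 + 1))
      ≤ max (e (2 * n + 1)) 0 / v (loc v s e (2 * n + 1 + 1)) :=
    div_le_div₀ (le_max_right _ _) (h1 n) (hv.pos _) (hv.mono (hv.coupling s h0 h1 (n + 1)).1)
  linarith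

/-- Growth control of the weight by the tail integral. -/
lemma le_of_half_tail_le (hv : IsReinforcement v) {ρ : ℝ} (hρ : 0 < ρ)
    (hmono : AntitoneOn (fun t => v t ^ ρ * tail v t) (Ici 1)) {t u : ℝ} (ht : 1 ≤ t) (htu : t ≤ u)
    (h : tail v t / 2 ≤ tail v u) : v u ≤ 2 ^ (1 / ρ) * v t := by
  have h1 : v u ^ ρ * tail v u ≤ v t ^ ρ * tail v t := hmono ht (ht.trans htu) htu
  have h2 := hv.tail_pos t
  have h3 : v u ^ ρ ≤ 2 * v t ^ ρ := by
    have h4 : 0 < v u ^ ρ := Real.rpow_pos_of_pos (hv.pos _) _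
    have h5 : v u ^ ρ * (tail v t / 2) ≤ v t ^ ρ * tail v t :=
      (mul_le_mul_of_nonneg_left h h4.le).trans h1
    nlinarith
  have h6 : v u = (v u ^ ρ) ^ (1 / ρ) := by
    rw [← Real.rpow_mul (hv.pos _).le, mul_one_div_cancel hρ.ne', Real.rpow_one]
  have h7 : 2 ^ (1 / ρ) * v t = (2 * v t ^ ρ) ^ (1 / ρ) := by
    rw [Real.mul_rpow zero_le_two (Real.rpow_nonneg (hv.pos _).le _),
      ← Real.rpow_mul (hv.pos _).le, mul_one_div_cancel hρ.ne', Real.rpow_one]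
  rw [h6, h7]
  exact Real.rpow_le_rpow (Real.rpow_nonneg (hv.pos _).le _) h3 (by positivity)

end IsReinforcement

end VRJP

/-! ### Balance is not almost certain: the large regime -/

namespace VRJP

open Set

variable {v : ℝ → ℝ}

lemma expSeq_real_sum_even_le {N : ℕ} (hN : 8 ≤ N) :
    expSeq.real {e | ∑ k ∈ Finset.range N, max (e (2 * k)) 0 ≤ N / 4} ≤ 1 / 8 := by
  have hJ : (Finset.range N).image (fun k => 2 * k) ⊆ Finset.range (2 * N) := by
    intro k hk
    obtain ⟨j, hj, rfl⟩ := Finset.mem_image.1 hk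
    rw [Finset.mem_range] at hj ⊢
    omega
  have hinj : Function.Injective fun k : ℕ => 2 * k := fun a b h => by simpa using h
  have h := expSeq_sum_le_le (2 * N) _ hJ (N / 4)
  simp_rw [Finset.sum_image hinj.injOn] at h
  rw [Finset.card_image_of_injective _ hinj, Finset.card_range] at h
  have h2 : Real.exp ((N : ℝ) / 4) * (1 / 2) ^ N ≤ 1 / 8 := by
    -- Chernoff gives `(exp (1 / 4) / 2) ^ N`; the base is at most `13 / 20`, whose eighth power is
    -- already below `1 / 8`.
    have h3 : Real.exp (1 / 4) ≤ 13 / 10 := by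
      refine le_of_pow_le_pow_left₀ (n := 4) (by norm_num) (by norm_num) ?_
      rw [← Real.exp_nat_mul]
      norm_num
      linarith [Real.exp_one_lt_d9]
    have h4 : Real.exp ((N : ℝ) / 4) = Real.exp (1 / 4) ^ N := by
      rw [← Real.exp_nat_mul]; ring_nf
    rw [h4, ← mul_pow]
    calc (Real.exp (1 / 4) * (1 / 2)) ^ N ≤ (13 / 20) ^ N := by
          refine pow_le_pow_left₀ (by positivity) ?_ N
          linarith
      _ ≤ (13 / 20) ^ 8 := pow_le_pow_of_le_one (by norm_num) (by norm_num) hN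
      _ ≤ 1 / 8 := by norm_num
  calc _ ≤ (ENNReal.ofReal (Real.exp ((N : ℝ) / 4) * (1 / 2) ^ N)).toReal :=
        ENNReal.toReal_mono ENNReal.ofReal_ne_top h
    _ = Real.exp ((N : ℝ) / 4) * (1 / 2) ^ N := ENNReal.toReal_ofReal (by positivity)
    _ ≤ 1 / 8 := h2

lemma expSeq_real_sum_ge_le {N : ℕ} (hN : 0 < N) (i : ℕ → ℕ) :
    expSeq.real {e | 4 * (N : ℝ) ≤ ∑ k ∈ Finset.range N, max (e (i k)) 0} ≤ 1 / 4 := by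
  have h := ENNReal.toReal_mono (by simp) (expSeq_sum_ge_le hN i)
  simpa [Measure.real] using h

namespace IsReinforcement

/-- With probability of balance at least `1 / 2`, the second-moment bound gives a squared difference
of at most `260 * N * g ^ 2`, and `260 ≤ 17 ^ 2`. -/
lemma abs_tail_sub_le_of_half_le (hv : IsReinforcement v) {t : ℝ × ℝ} {m g q N : ℝ}
    (hp : 1 / 2 ≤ probInf v t) (hm : tail v t.1 ≤ m) (hg : 1 / (v t.1 * v t.2) ≤ g)
    (hmq : m = q * g) (hq : q ≤ 32 * N) (hN : 1 ≤ N) :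
    |tail v t.2 - tail v t.1| ≤ 17 * √N * g := by
  have h1 := hv.probInf_mul_sq_le t
  set κ := 1 / (v t.1 * v t.2)
  have hκ : 0 < κ := one_div_pos.2 (mul_pos (hv.pos _) (hv.pos _))
  have hg0 : 0 < g := hκ.trans_le hg
  have hm0 : 0 < m := (hv.tail_pos _).trans_le hm
  set D := tail v t.2 - tail v t.1
  have h2 : κ * tail v t.1 ≤ g * m := mul_le_mul hg hm (hv.tail_nonneg _) hg0.le
  have h3 : κ ^ 2 ≤ g ^ 2 := pow_le_pow_left₀ hκ.le hg 2
  have h4 : g * m ≤ 32 * N * g ^ 2 := by rw [hmq]; nlinarith [sq_nonneg g]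
  have h5 : 1 / 2 * D ^ 2 ≤ probInf v t * D ^ 2 := mul_le_mul_of_nonneg_right hp (sq_nonneg D)
  have h6 : D ^ 2 ≤ 260 * (N * g ^ 2) := by nlinarith [sq_nonneg g]
  refine abs_le_of_sq_le_sq ?_ (by positivity)
  rw [mul_pow, mul_pow, Real.sq_sqrt (by linarith)]
  nlinarith [mul_nonneg (by linarith : (0 : ℝ) ≤ N) (sq_nonneg g)]

/-- Two coupled trajectories whose stays at the starting vertex differ by a factor `1 + θ` cannot
both end up close to balance. -/
lemma not_both_balanced (hv : IsReinforcement v) {ρ : ℝ} (hρ : 0 < ρ)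
    (hmono : AntitoneOn (fun t => v t ^ ρ * tail v t) (Ici 1)) {s : ℝ × ℝ} (h1 : 1 ≤ s.1)
    (h2 : 1 ≤ s.2) (hs : tail v s.1 ≤ tail v s.2) {N : ℕ} {K θ : ℝ} (hN0 : 1 ≤ N)
    (hK : K = 140 * (2 ^ (1 / ρ)) ^ 2) (hθ : θ = K / √N) (hθ1 : θ ≤ 1)
    (hN1 : 16 * N ≤ tail v s.1 * (v s.1 * v s.2)) (hN2 : tail v s.1 * (v s.1 * v s.2) ≤ 32 * N)
    {η : ℕ → ℝ} (hη0 : ∀ k < N, η (2 * k) = θ) (hη1 : ∀ k, 0 ≤ η (2 * k))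
    (hη2 : ∀ k, η (2 * k + 1) = 0)
    {e : ℕ → ℝ} (he1 : (N : ℝ) / 4 ≤ ∑ k ∈ Finset.range N, max (e (2 * k)) 0)
    (he2 : ∑ k ∈ Finset.range N, max (e (2 * k)) 0 ≤ 4 * N)
    (he3 : ∑ k ∈ Finset.range N, max (e (2 * k + 1)) 0 ≤ 4 * N)
    (hp : 1 / 2 ≤ probInf v (chain v s e (2 * N)))
    (hp' : 1 / 2 ≤ probInf v (chain v s (scaleSeq η e) (2 * N))) : False := by
  set κ : ℝ := 2 ^ (1 / ρ) with hκ
  have hκ0 : 0 < κ := Real.rpow_pos_of_pos two_pos _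
  set e' := scaleSeq η e with he'
  set x := s.1
  set y := s.2
  have hx := hv.pos x
  have hy := hv.pos y
  set m := tail v x with hm
  set q := m * (v x * v y) with hq
  set g := 1 / (v x * v y) with hg
  have hg0 : 0 < g := one_div_pos.2 (mul_pos hx hy)
  have hmq : m = q * g := by rw [hq, hg]; field_simp
  have hNr : (1 : ℝ) ≤ N := by exact_mod_cast hN0
  have hsq : 0 < √(N : ℝ) := Real.sqrt_pos.2 (by linarith)
  have hK0 : 0 < K := by rw [hK]; positivity
  have hθ0 : 0 < θ := by rw [hθ]; positivity
  have hmax : ∀ k, 0 ≤ 1 + η k → max (e' k) 0 = (1 + η k) * max (e k) 0 := fun k hk => by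
    rw [he', scaleSeq, mul_max_of_nonneg _ _ hk, mul_zero]
  have hce : ∀ k, max (e (2 * k)) 0 ≤ max (e' (2 * k)) 0 := fun k => by
    rw [hmax _ (by linarith [hη1 k])]
    nlinarith [hη1 k, le_max_right (e (2 * k)) 0]
  have hco : ∀ k, max (e' (2 * k + 1)) 0 = max (e (2 * k + 1)) 0 := fun k => by
    rw [hmax _ (by rw [hη2]; norm_num), hη2]; ring
  obtain ⟨c1, c2, c3⟩ := hv.coupling s hce (fun k => (hco k).le) N
  set a := loc v s e (2 * N) with ha
  set b := loc v s e (2 * N + 1) with hb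
  set a' := loc v s e' (2 * N) with ha'
  set b' := loc v s e' (2 * N + 1) with hb'
  have hxa : x ≤ a := hv.fst_le_loc s e N
  have hyb : y ≤ b := hv.snd_le_loc s e N
  have hyb' : y ≤ b' := hv.snd_le_loc s e' N
  have hxa' : x ≤ a' := hxa.trans c1
  have hsum' : ∑ k ∈ Finset.range N, max (e' (2 * k)) 0 ≤ 8 * N := by
    have : ∑ k ∈ Finset.range N, max (e' (2 * k)) 0
        = (1 + θ) * ∑ k ∈ Finset.range N, max (e (2 * k)) 0 := by
      rw [Finset.mul_sum]
      refine Finset.sum_congr rfl fun k hk => ?_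
      rw [hmax _ (by linarith [hη1 k]), hη0 k (Finset.mem_range.1 hk)]
    rw [this]
    nlinarith
  -- The `N` stretched stays use at most `8 * N * g ≤ m / 2` of the tail, so the weight has grown by
  -- at most the factor `κ`.
  have hva' : v a' ≤ κ * v x := by
    refine hv.le_of_half_tail_le hρ hmono h1 hxa' ?_
    have i1 := hv.loc_even_le s e' N
    have i2 := hv.tail_sub_le hxa'
    have i3 : (a' - x) / v x ≤ 8 * N * g := by
      calc (a' - x) / v x ≤ (8 * N / v y) / v x := by
            refine div_le_div_of_nonneg_right ?_ hx.le
            have := div_le_div_of_nonneg_right hsum' hy.le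
            linarith
        _ = 8 * N * g := by rw [hg]; field_simp
    have i4 : 16 * N * g ≤ m := by rw [hmq]; exact mul_le_mul_of_nonneg_right hN1 hg0.le
    linarith
  -- The same at the other vertex, whose tail is at least `m` by `hs`.
  have hvb : v b ≤ κ * v y := by
    refine hv.le_of_half_tail_le hρ hmono h2 hyb ?_
    have i1 := hv.loc_odd_le s e N
    have i2 := hv.tail_sub_le hyb
    have i3 : (b - y) / v y ≤ 4 * N * g := by
      calc (b - y) / v y ≤ (4 * N / v x) / v y := by
            refine div_le_div_of_nonneg_right ?_ hy.le
            have := div_le_div_of_nonneg_right he3 hx.le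
            linarith
        _ = 4 * N * g := by rw [hg]; field_simp
    have i4 : 16 * N * g ≤ m := by rw [hmq]; exact mul_le_mul_of_nonneg_right hN1 hg0.le
    have i5 : 0 < N * g := by positivity
    linarith
  have hgap : θ * (N / 4) / (κ * v y) ≤ a' - a := by
    refine le_trans ?_ c3
    calc θ * (N / 4) / (κ * v y)
        ≤ (θ * ∑ k ∈ Finset.range N, max (e (2 * k)) 0) / (κ * v y) := by gcongr
      _ ≤ _ := by
          rw [Finset.mul_sum, Finset.sum_div]
          refine Finset.sum_le_sum fun k hk => ?_
          have hk' := Finset.mem_range.1 hk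
          rw [hmax _ (by linarith [hη1 k]), hη0 k hk']
          have : θ * max (e (2 * k)) 0 = (1 + θ) * max (e (2 * k)) 0 - max (e (2 * k)) 0 := by ring
          rw [← this]
          refine div_le_div_of_nonneg_left (mul_nonneg hθ0.le (le_max_right _ _)) (hv.pos _) ?_
          exact (hv.mono (hv.monotone_loc_odd s e hk'.le)).trans hvb
  -- Stretching separates the local times at the starting vertex; as the weight there is still
  -- comparable to its initial value, the tails separate as well.
  have hgap2 : θ * N * g / (4 * κ ^ 2) ≤ tail v a - tail v a' := by
    refine le_trans ?_ (hv.le_tail_sub c1)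
    calc θ * N * g / (4 * κ ^ 2) = (θ * (N / 4) / (κ * v y)) / (κ * v x) := by
          rw [hg]; field_simp
      _ ≤ (a' - a) / (κ * v x) := by gcongr
      _ ≤ (a' - a) / v a' := div_le_div_of_nonneg_left (sub_nonneg.2 c1) (hv.pos _) hva'
  have hgle : ∀ a b, x ≤ a → y ≤ b → 1 / (v a * v b) ≤ g := fun a b hxa hyb =>
    one_div_le_one_div_of_le (mul_pos hx hy) (mul_le_mul (hv.mono hxa) (hv.mono hyb) hy.le (hv.pos _).le)
  have k1 := hv.abs_tail_sub_le_of_half_le hp (hv.tail_antitone hxa) (hgle a b hxa hyb) hmq hN2 hNr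
  have k2 := hv.abs_tail_sub_le_of_half_le hp' (hv.tail_antitone hxa') (hgle a' b' hxa' hyb')
    hmq hN2 hNr
  have k3 : |tail v b - tail v a| ≤ 17 * √N * g := k1
  have k4 : |tail v b' - tail v a'| ≤ 17 * √N * g := k2
  have k5 := (abs_le.1 k3).1
  have k6 := (abs_le.1 k4).2
  have k7 := hv.tail_antitone c2
  -- The factor `140 = 4 * 35` in `K` makes the gap `35 * √N * g`, more than the two allowed
  -- deviations `17 * √N * g` together. Since the tail at the other vertex moves in the opposite
  -- direction, nothing compensates.
  have k8 : θ * N * g / (4 * κ ^ 2) = 35 * √N * g := by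
    rw [hθ, hK]
    have : (N : ℝ) = √N * √N := (Real.mul_self_sqrt (by linarith)).symm
    rw [this, Real.sqrt_mul_self hsq.le]
    field_simp
    norm_num
  have k9 : 0 < √N * g := by positivity
  linarith

/-- Far from absorption, balance has probability bounded away from one. -/
lemma exists_probInf_le_of_large (hv : IsReinforcement v) {ρ : ℝ} (hρ : 0 < ρ)
    (hmono : AntitoneOn (fun t => v t ^ ρ * tail v t) (Ici 1)) :
    ∃ C > 0, ∃ ε > 0, ∀ s : ℝ × ℝ, 1 ≤ s.1 → 1 ≤ s.2 → tail v s.1 ≤ tail v s.2 →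
      C < tail v s.1 * (v s.1 * v s.2) → probInf v s ≤ 1 - ε := by
  set K : ℝ := 140 * (2 ^ (1 / ρ)) ^ 2 with hK
  have hκ1 : (1 : ℝ) ≤ 2 ^ (1 / ρ) := Real.one_le_rpow one_le_two (by positivity)
  have hK1 : 140 ≤ K := by rw [hK]; nlinarith
  -- The threshold forces `N > 4 * K ^ 2`, hence `θ ≤ 1 / 2`. The value of `ε` makes the bad event
  -- have probability at most `exp (-4 * K ^ 2) / 64`, which after the scaling loss `exp (4 * K ^
  -- 2)` leaves the square of `1 / 8`.
  refine ⟨16 * (4 * K ^ 2 + 1), by positivity, Real.exp (-(4 * K ^ 2)) / 128, by positivity,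
    fun s h1 h2 hs hC => ?_⟩
  set q := tail v s.1 * (v s.1 * v s.2) with hq
  set N := ⌊q / 16⌋₊ with hN
  have hq0 : 0 ≤ q / 16 := by nlinarith
  have hN1 : (N : ℝ) ≤ q / 16 := Nat.floor_le hq0
  have hN2 : q / 16 < N + 1 := Nat.lt_floor_add_one _
  have hN3 : 4 * K ^ 2 < N := by linarith
  have hN4 : (8 : ℝ) ≤ N := by nlinarith
  have hN8 : 8 ≤ N := by exact_mod_cast hN4
  have hNpos : (0 : ℝ) < N := by linarith
  set θ := K / √N with hθ
  have hθ0 : 0 ≤ θ := by positivity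
  have hθ2 : θ ^ 2 * N = K ^ 2 := by
    rw [hθ, div_pow, Real.sq_sqrt hNpos.le]; field_simp
  have hθ4 : θ ^ 2 ≤ 1 / 4 := by
    have : θ ^ 2 * (4 * K ^ 2) ≤ K ^ 2 := by
      rw [← hθ2]; nlinarith [sq_nonneg θ]
    nlinarith
  have hθ1 : θ < 1 := by nlinarith
  by_contra hcon
  rw [not_le] at hcon
  set η : ℕ → ℝ := fun k => if Even k ∧ k < 2 * N then θ else 0 with hη
  have hη0 : ∀ k, 0 ≤ η k := fun k => by simp only [hη]; split_ifs <;> simp [hθ0]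
  have hη1 : ∀ k, η k ≤ θ := fun k => by simp only [hη]; split_ifs <;> simp [hθ0]
  have hη2 : ∀ k, 2 * N ≤ k → η k = 0 := fun k hk => by
    simp only [hη]; rw [if_neg]; rintro ⟨-, h⟩; omega
  set B := {e : ℕ → ℝ | 1 / 2 ≤ 1 - probInf v (chain v s e (2 * N))} with hB
  have hBm : MeasurableSet B := measurableSet_le measurable_const
    (measurable_const.sub (hv.measurable_probInf.comp (hv.measurable_chain_section s _)))
  -- Markov's inequality for the martingale `1 - probInf`, whose mean is below `ε`.
  have hB1 : expSeq.real B ≤ Real.exp (-(4 * K ^ 2)) / 64 := by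
    have hi := hv.integrable_probInf_comp (μ := expSeq) (hv.measurable_chain_section s (2 * N))
    have h := mul_meas_ge_le_integral_of_nonneg (μ := expSeq)
      (f := fun e => 1 - probInf v (chain v s e (2 * N)))
      (Eventually.of_forall fun e => sub_nonneg.2 probInf_le_one)
      ((integrable_const _).sub hi) (1 / 2)
    rw [integral_sub (integrable_const _) hi, hv.integral_probInf_chain, integral_const,
      probReal_univ, one_smul] at h
    have h' : 1 / 2 * expSeq.real B ≤ 1 - probInf v s := h
    linarith
  have hB2 : expSeq.real (scaleSeq η ⁻¹' B) ≤ 1 / 8 := by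
    have h := measure_scaleSeq_preimage_sq_le hθ1 (2 * N) hη0 hη1 hη2 hBm
    have h3 : expSeq.real (scaleSeq η ⁻¹' B) ^ 2 ≤ (1 / (1 - θ ^ 2)) ^ (2 * N) * expSeq.real B := by
      have h4 := ENNReal.toReal_mono (ENNReal.mul_ne_top
        (ENNReal.pow_ne_top ENNReal.ofReal_ne_top) (measure_ne_top _ _)) h
      rwa [ENNReal.toReal_pow, ENNReal.toReal_mul, ENNReal.toReal_pow, ENNReal.toReal_ofReal] at h4
      exact one_div_nonneg.2 (by linarith)
    have h5 : (1 / (1 - θ ^ 2)) ^ (2 * N) ≤ Real.exp (4 * K ^ 2) := by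
      calc (1 / (1 - θ ^ 2)) ^ (2 * N) ≤ Real.exp (2 * θ ^ 2) ^ (2 * N) := by
            refine pow_le_pow_left₀ (one_div_nonneg.2 (by linarith)) ?_ _
            refine le_trans ?_ (Real.add_one_le_exp _)
            rw [div_le_iff₀ (by linarith)]
            nlinarith [sq_nonneg θ]
        _ = Real.exp (4 * K ^ 2) := by
            rw [← Real.exp_nat_mul, ← hθ2]; push_cast; ring_nf
    have h6 : expSeq.real (scaleSeq η ⁻¹' B) ^ 2 ≤ (1 / 8) ^ 2 := by
      refine h3.trans ((mul_le_mul h5 hB1 measureReal_nonneg (Real.exp_pos _).le).trans ?_)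
      rw [← mul_div_assoc, ← Real.exp_add]
      norm_num
    exact le_of_pow_le_pow_left₀ two_ne_zero (by norm_num) h6
  have hB3 : expSeq.real B ≤ 1 / 8 := hB1.trans (by
    have : Real.exp (-(4 * K ^ 2)) ≤ 1 := Real.exp_le_one_iff.2 (by nlinarith)
    linarith)
  have hS1 := expSeq_real_sum_even_le hN8
  have hS2 := expSeq_real_sum_ge_le (by omega : 0 < N) (fun k => 2 * k)
  have hS3 := expSeq_real_sum_ge_le (by omega : 0 < N) (fun k => 2 * k + 1)
  set S1 := {e : ℕ → ℝ | ∑ k ∈ Finset.range N, max (e (2 * k)) 0 ≤ N / 4}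
  set S2 := {e : ℕ → ℝ | 4 * (N : ℝ) ≤ ∑ k ∈ Finset.range N, max (e (2 * k)) 0}
  set S3 := {e : ℕ → ℝ | 4 * (N : ℝ) ≤ ∑ k ∈ Finset.range N, max (e (2 * k + 1)) 0}
  -- The five bad events have total probability at most `3 / 8 + 2 / 4 < 1`, so some sequence avoids
  -- them all.
  have hex : ∃ e, e ∉ B ∪ scaleSeq η ⁻¹' B ∪ S1 ∪ S2 ∪ S3 := by
    by_contra hall
    push Not at hall
    have h3 : expSeq.real (B ∪ scaleSeq η ⁻¹' B ∪ S1 ∪ S2 ∪ S3) = 1 := by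
      rw [eq_univ_of_forall hall]; simp
    have h4 := measureReal_union_le (μ := expSeq) (B ∪ scaleSeq η ⁻¹' B ∪ S1 ∪ S2) S3
    have h5 := measureReal_union_le (μ := expSeq) (B ∪ scaleSeq η ⁻¹' B ∪ S1) S2
    have h6 := measureReal_union_le (μ := expSeq) (B ∪ scaleSeq η ⁻¹' B) S1
    have h7 := measureReal_union_le (μ := expSeq) B (scaleSeq η ⁻¹' B)
    linarith
  obtain ⟨e, he⟩ := hex
  simp only [mem_union, not_or] at he
  obtain ⟨⟨⟨⟨k1, k2⟩, k3⟩, k4⟩, k5⟩ := he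
  have k1' : ¬ (1 / 2 ≤ 1 - probInf v (chain v s e (2 * N))) := k1
  have k2' : ¬ (1 / 2 ≤ 1 - probInf v (chain v s (scaleSeq η e) (2 * N))) := k2
  refine hv.not_both_balanced hρ hmono h1 h2 hs (N := N) (θ := θ) (η := η) (e := e) (by omega) hK
    hθ hθ1.le (by linarith) (by linarith) (fun k hk => ?_) (fun k => hη0 _) (fun k => ?_)
    (not_le.1 k3).le (not_le.1 k4).le (not_le.1 k5).le (by linarith) (by linarith)
  · simp only [hη]; rw [if_pos ⟨even_two_mul k, by omega⟩]
  · simp only [hη]; rw [if_neg]; rintro ⟨h, -⟩; exact (Nat.not_even_iff_odd.2 ⟨k, rfl⟩) h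

end IsReinforcement

end VRJP

/-! ### The small regime, and balance has probability zero -/

namespace VRJP

open Set

variable {v : ℝ → ℝ}

namespace IsReinforcement

/-- Close to absorption, one long stay decides the competition with positive probability. -/
lemma probInf_le_of_small (hv : IsReinforcement v) {ρ : ℝ} (hρ : 0 < ρ)
    (hmono : AntitoneOn (fun t => v t ^ ρ * tail v t) (Ici 1)) {C : ℝ} (hC0 : 0 < C) {s : ℝ × ℝ}
    (h1 : 1 ≤ s.1) (hs : tail v s.1 ≤ tail v s.2)
    (hC : tail v s.1 * (v s.1 * v s.2) ≤ C) :
    probInf v s ≤ 1 - Real.exp (-(4 + 2 ^ (1 / ρ) * C)) / 4 := by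
  set κ : ℝ := 2 ^ (1 / ρ) with hκ
  have hκ0 : 0 < κ := Real.rpow_pos_of_pos two_pos _
  set K := 4 + κ * C with hK
  have hKC : 0 < κ * C := by positivity
  have hx := hv.pos s.1
  have hy := hv.pos s.2
  have hm := hv.tail_pos s.1
  have key : ∀ a ∈ Ici K, probInf v (chainStep v s a) ≤ 3 / 4 := by
    intro a ha
    have ha' : K ≤ a := ha
    have ha0 : 0 < a := by linarith
    have h := hv.probInf_mul_tail_fst_le (chainStep v s a)
    simp only [chainStep, max_eq_left ha0.le] at h ⊢
    set x' := s.1 + a / v s.2 with hx'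
    have hxx' : s.1 ≤ x' := le_add_of_nonneg_right (by positivity)
    have i1 : a * (1 / (v s.2 * v x')) ≤ tail v s.1 - tail v x' := by
      refine le_trans (le_of_eq ?_) (hv.le_tail_sub hxx')
      have hvx' := hv.pos x'
      rw [hx']; field_simp; ring
    have i0 : 0 < 1 / (v s.2 * v x') := one_div_pos.2 (mul_pos hy (hv.pos _))
    -- Were the tail not halved, `v x'` would be at most `κ * v s.1`, and a clock of at least `4 + κ
    -- * C` would consume more than the whole tail.
    have i2 : tail v x' ≤ tail v s.1 / 2 := by
      by_contra hcon
      have i3 := hv.le_of_half_tail_le hρ hmono h1 hxx' (not_le.1 hcon).le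
      have i4 : tail v s.1 / C ≤ κ * (1 / (v s.2 * v x')) := by
        have i5 : 1 / (κ * (v s.1 * v s.2)) ≤ 1 / (v s.2 * v x') := by
          refine one_div_le_one_div_of_le (mul_pos hy (hv.pos _)) ?_
          nlinarith
        calc tail v s.1 / C ≤ 1 / (v s.1 * v s.2) := by
              rw [div_le_div_iff₀ hC0 (mul_pos hx hy)]; linarith
          _ = κ * (1 / (κ * (v s.1 * v s.2))) := by field_simp
          _ ≤ _ := mul_le_mul_of_nonneg_left i5 hκ0.le
      rw [div_le_iff₀ hC0] at i4
      have i6 := hv.tail_pos x'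
      nlinarith
    have i3 : 4 * (1 / (v s.2 * v x')) ≤ tail v s.1 := by
      have := hv.tail_nonneg x'
      nlinarith
    -- After the stay, the bound for the other vertex leaves at most `1 / 4 + 1 / 2` of its tail.
    -- The first term uses that the clock is at least `4`.
    have i4 : probInf v (s.2, x') * tail v s.2 ≤ 3 / 4 * tail v s.2 := by linarith
    exact le_of_mul_le_mul_right i4 (hv.tail_pos _)
  have hi := hv.integrable_probInf_comp (μ := expMeasure 1) (measurable_chainStep (v := v) s)
  have h2 : ∫ a, probInf v (chainStep v s a) ∂expMeasure 1
      ≤ ∫ a, (1 - (Ici K).indicator (fun _ => 1 / 4) a) ∂expMeasure 1 := by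
    refine integral_mono hi ((integrable_const _).sub
      ((integrable_const _).indicator measurableSet_Ici)) fun a => ?_
    by_cases ha : a ∈ Ici K
    · simp only [indicator_of_mem ha]; linarith [key a ha]
    · simp only [indicator_of_notMem ha, sub_zero]; exact probInf_le_one
  rw [← hv.probInf_eq_integral, integral_sub (integrable_const _)
    ((integrable_const _).indicator measurableSet_Ici), integral_indicator_const _ measurableSet_Ici,
    measureReal_def, expMeasure_Ici (by linarith), ENNReal.toReal_ofReal (Real.exp_pos _).le] at h2
  simp only [integral_const, probReal_univ, smul_eq_mul, one_mul] at h2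
  linarith

lemma exists_probInf_le_of_leading (hv : IsReinforcement v) {ρ : ℝ} (hρ : 0 < ρ)
    (hmono : AntitoneOn (fun t => v t ^ ρ * tail v t) (Ici 1)) :
    ∃ ε > 0, ∀ s : ℝ × ℝ, 1 ≤ s.2 → s.2 ≤ s.1 → probInf v s ≤ 1 - ε := by
  obtain ⟨C, hC, ε, hε, h⟩ := hv.exists_probInf_le_of_large hρ hmono
  refine ⟨min ε (Real.exp (-(4 + 2 ^ (1 / ρ) * C)) / 4), lt_min hε (by positivity),
    fun s h2 h12 => ?_⟩
  have hs := hv.tail_antitone h12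
  rcases lt_or_ge C (tail v s.1 * (v s.1 * v s.2)) with hc | hc
  · exact (h s (h2.trans h12) h2 hs hc).trans (sub_le_sub_left (min_le_left _ _) _)
  · exact (hv.probInf_le_of_small hρ hmono hC (h2.trans h12) hs hc).trans
      (sub_le_sub_left (min_le_right _ _) _)

/-- If the current vertex lags behind, there are two cases. Either its stay ends before it catches
up, and the next vertex leads on arrival; or it catches up and, by memorylessness, the rest of the
stay is that of a chain started from equal local times. -/
lemma exists_probInf_le (hv : IsReinforcement v) {ρ : ℝ} (hρ : 0 < ρ)
    (hmono : AntitoneOn (fun t => v t ^ ρ * tail v t) (Ici 1)) :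
    ∃ ε > 0, ∀ s : ℝ × ℝ, 1 ≤ s.1 → 1 ≤ s.2 → probInf v s ≤ 1 - ε := by
  obtain ⟨ε, hε, h⟩ := hv.exists_probInf_le_of_leading hρ hmono
  refine ⟨ε, hε, fun s h1 h2 => ?_⟩
  rcases le_total s.2 s.1 with h12 | h12
  · exact h s h2 h12
  have hy := hv.pos s.2
  have hε1 : 0 ≤ 1 - ε := probInf_nonneg.trans (h s.swap h1 h12)
  set t := (s.2 - s.1) * v s.2 with ht
  have ht0 : 0 ≤ t := mul_nonneg (sub_nonneg.2 h12) hy.le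
  set f : ℝ → ℝ≥0∞ := fun a => ENNReal.ofReal (probInf v (chainStep v s a)) with hf
  have hfm : Measurable f :=
    (hv.measurable_probInf.comp (measurable_chainStep s)).ennreal_ofReal
  have e1 : ∀ s, ENNReal.ofReal (probInf v s)
      = ∫⁻ a, ENNReal.ofReal (probInf v (chainStep v s a)) ∂expMeasure 1 := fun s => by
    rw [hv.probInf_eq_integral s, ofReal_integral_eq_lintegral_ofReal
      (hv.integrable_probInf_comp (measurable_chainStep s))
      (Eventually.of_forall fun _ => probInf_nonneg)]
  have e2 : ∫⁻ a in Iic t, f a ∂expMeasure 1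
      ≤ ENNReal.ofReal (1 - ε) * expMeasure 1 (Iic t) := by
    rw [← setLIntegral_const]
    refine setLIntegral_mono measurable_const fun a ha => ENNReal.ofReal_le_ofReal ?_
    refine h _ ?_ ?_
    · exact h1.trans (le_add_of_nonneg_right (hv.stay_nonneg a s.2))
    · have : max a 0 / v s.2 ≤ t / v s.2 :=
        div_le_div_of_nonneg_right (max_le ha ht0) hy.le
      rw [ht, mul_div_cancel_right₀ _ hy.ne'] at this
      simp only [chainStep]; linarith
  have e3 : ∫⁻ a in Ioi t, f a ∂expMeasure 1
      ≤ ENNReal.ofReal (1 - ε) * expMeasure 1 (Ioi t) := by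
    have e4 : expMeasure 1 (Ioi t) = ENNReal.ofReal (Real.exp (-t)) := by
      have := setLIntegral_Ioi_expMeasure ht0 (f := fun _ => 1) measurable_const
      simpa using this
    rw [setLIntegral_Ioi_expMeasure ht0 hfm, e4, mul_comm]
    refine mul_le_mul_left ?_ _
    have e5 : ∫⁻ a, f (t + a) ∂expMeasure 1 = ENNReal.ofReal (probInf v (s.2, s.2)) := by
      rw [e1]
      refine lintegral_congr_ae ?_
      filter_upwards [ae_pos_expMeasure] with a ha
      simp only [hf, chainStep, max_eq_left ha.le, max_eq_left (add_nonneg ht0 ha.le)]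
      congr 3
      rw [add_div, ht, mul_div_cancel_right₀ _ hy.ne']
      ring
    rw [e5]
    exact ENNReal.ofReal_le_ofReal (h _ h2 le_rfl)
  have e6 : ENNReal.ofReal (probInf v s) ≤ ENNReal.ofReal (1 - ε) := by
    rw [e1 s, ← lintegral_add_compl f (measurableSet_Iic (a := t)), compl_Iic]
    refine (add_le_add e2 e3).trans_eq ?_
    rw [← mul_add, ← compl_Iic, measure_add_measure_compl measurableSet_Iic, measure_univ, mul_one]
  exact (ENNReal.ofReal_le_ofReal_iff hε1).1 e6

lemma one_le_chainStep (hv : IsReinforcement v) {s : ℝ × ℝ} (h1 : 1 ≤ s.1) (h2 : 1 ≤ s.2) (a : ℝ) :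
    1 ≤ (chainStep v s a).1 ∧ 1 ≤ (chainStep v s a).2 :=
  ⟨h2, h1.trans (le_add_of_nonneg_right (hv.stay_nonneg a s.2))⟩

/-- Events depending on finitely many coordinates do not increase the chance of balance. -/
lemma measure_bothInf_inter_le (hv : IsReinforcement v) {c : ℝ≥0∞}
    (hc : ∀ s : ℝ × ℝ, 1 ≤ s.1 → 1 ≤ s.2 → expSeq (bothInf v s) ≤ c) (n : ℕ) {s : ℝ × ℝ}
    (h1 : 1 ≤ s.1) (h2 : 1 ≤ s.2) {B : Set (ℕ → ℝ)} (hB : MeasurableSet B)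
    (hdep : ∀ e e' : ℕ → ℝ, (∀ k < n, e k = e' k) → (e ∈ B ↔ e' ∈ B)) :
    expSeq (bothInf v s ∩ B) ≤ c * expSeq B := by
  induction n generalizing s B with
  | zero =>
    by_cases h : (0 : ℕ → ℝ) ∈ B
    · have : B = univ := eq_univ_of_forall fun e => (hdep e 0 (by simp)).2 h
      rw [this]; simpa using hc s h1 h2
    · have : B = ∅ := eq_empty_of_forall_notMem fun e he => h ((hdep e 0 (by simp)).1 he)
      rw [this]; simp
  | succ n ih =>
    have hm : Measurable fun a : ℝ => expSeq {e | consSeq (a, e) ∈ B} :=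
      measurable_measure_prodMk_left (measurable_consSeq hB)
    rw [measure_expSeq ((hv.measurableSet_bothInf s).inter hB), measure_expSeq hB,
      ← lintegral_const_mul c hm]
    refine lintegral_mono fun a => ?_
    obtain ⟨k1, k2⟩ := hv.one_le_chainStep h1 h2 a
    have := ih k1 k2 (B := {e | consSeq (a, e) ∈ B})
      ((measurable_consSeq.comp measurable_prodMk_left) hB) fun e e' he => hdep _ _ fun k hk => by
        cases k with
        | zero => rfl
        | succ k => exact he k (by omega)
    refine le_trans (le_of_eq ?_) this
    congr 1
    ext e
    exact and_congr_left' (consSeq_mem_bothInf a)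

/-- The two local times almost surely do not both diverge. -/
lemma measure_bothInf_eq_zero (hv : IsReinforcement v) {ρ : ℝ} (hρ : 0 < ρ)
    (hmono : AntitoneOn (fun t => v t ^ ρ * tail v t) (Ici 1)) {s : ℝ × ℝ}
    (h1 : 1 ≤ s.1) (h2 : 1 ≤ s.2) : expSeq (bothInf v s) = 0 := by
  obtain ⟨ε, hε, h⟩ := hv.exists_probInf_le hρ hmono
  have hε1 : 0 ≤ 1 - ε := probInf_nonneg.trans (h s h1 h2)
  set A := bothInf v s with hA
  have hAm := hv.measurableSet_bothInf s
  -- Given any finite number of clocks, balance has conditional probability at most `1 - ε`.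
  -- Approximating `A` itself by cylinders then forces `A` to be null, as in Lévy's zero-one law.
  have hcyl : ∀ B ∈ measurableCylinders fun _ : ℕ => ℝ,
      expSeq.real (A ∩ B) ≤ (1 - ε) * expSeq.real B := by
    intro B hB
    obtain ⟨I, S, hS, rfl⟩ := (mem_measurableCylinders B).1 hB
    have hdep : ∀ e e' : ℕ → ℝ, (∀ k < I.sup id + 1, e k = e' k) →
        (e ∈ cylinder I S ↔ e' ∈ cylinder I S) := fun e e' he => by
      rw [mem_cylinder, mem_cylinder]
      have : I.restrict e = I.restrict e' := funext fun i =>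
        he i (Nat.lt_succ_of_le (Finset.le_sup (f := id) i.2))
      rw [this]
    have h3 := hv.measure_bothInf_inter_le (c := ENNReal.ofReal (1 - ε)) (fun s k1 k2 => by
      rw [← ofReal_probInf]; exact ENNReal.ofReal_le_ofReal (h s k1 k2)) _ h1 h2
      (hS.cylinder I) hdep
    have h4 := ENNReal.toReal_mono (ENNReal.mul_ne_top ENNReal.ofReal_ne_top (measure_ne_top _ _)) h3
    rwa [ENNReal.toReal_mul, ENNReal.toReal_ofReal hε1] at h4
  have hdense := Measure.MeasureDense.of_generateFrom_isSetAlgebra_finite (μ := expSeq)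
    isSetAlgebra_measurableCylinders (generateFrom_measurableCylinders (α := fun _ : ℕ => ℝ)).symm
  have h0 : expSeq.real A ≤ 0 := by
    by_contra hcon
    rw [not_le] at hcon
    obtain ⟨B, hB, hAB⟩ := hdense.approx A hAm (measure_ne_top _ _) (ε * expSeq.real A / 2)
      (by positivity)
    have hBm : MeasurableSet B := .of_mem_measurableCylinders hB
    have h5 : expSeq.real (symmDiff A B) < ε * expSeq.real A / 2 := by
      have := ENNReal.toReal_lt_of_lt_ofReal hAB
      exact this
    have h6 := hcyl B hB
    have h7 : expSeq.real A ≤ expSeq.real (A ∩ B) + expSeq.real (symmDiff A B) := by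
      refine (measureReal_mono (fun e he => ?_)).trans (measureReal_union_le _ _)
      by_cases hb : e ∈ B
      · exact Or.inl ⟨he, hb⟩
      · exact Or.inr (Or.inl ⟨he, hb⟩)
    have h8 : expSeq.real B ≤ expSeq.real A + expSeq.real (symmDiff A B) := by
      refine (measureReal_mono (fun e he => ?_)).trans (measureReal_union_le _ _)
      by_cases ha : e ∈ A
      · exact Or.inl ha
      · exact Or.inr (Or.inr ⟨he, ha⟩)
    nlinarith [measureReal_nonneg (μ := expSeq) (s := symmDiff A B)]
  exact (measureReal_eq_zero_iff).1 (le_antisymm h0 measureReal_nonneg)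

end IsReinforcement

end VRJP

/-! ### The limiting balance and its absence of atoms -/

namespace VRJP

open Set

variable {v : ℝ → ℝ}

/-- The limiting tail integral at the starting vertex. -/
noncomputable def tailEven (v : ℝ → ℝ) (s : ℝ × ℝ) (e : ℕ → ℝ) : ℝ :=
  ⨅ n, tail v (loc v s e (2 * n))

/-- The limiting tail integral at the other vertex. -/
noncomputable def tailOdd (v : ℝ → ℝ) (s : ℝ × ℝ) (e : ℕ → ℝ) : ℝ :=
  ⨅ n, tail v (loc v s e (2 * n + 1))

/-- The limiting balance between the two vertices. -/
noncomputable def balance (v : ℝ → ℝ) (s : ℝ × ℝ) (e : ℕ → ℝ) : ℝ :=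
  tailOdd v s e - tailEven v s e

lemma tendsto_of_even_odd {f : ℕ → ℝ} {l : ℝ} (h0 : Tendsto (fun n => f (2 * n)) atTop (𝓝 l))
    (h1 : Tendsto (fun n => f (2 * n + 1)) atTop (𝓝 l)) : Tendsto f atTop (𝓝 l) := by
  rw [Metric.tendsto_atTop] at h0 h1 ⊢
  intro ε hε
  obtain ⟨N, hN⟩ := h0 ε hε
  obtain ⟨M, hM⟩ := h1 ε hε
  refine ⟨2 * N + 2 * M + 1, fun n hn => ?_⟩
  rcases Nat.even_or_odd' n with ⟨k, rfl | rfl⟩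
  · exact hN k (by omega)
  · exact hM k (by omega)

lemma expMeasure_subsingleton {S : Set ℝ} (hS : S.Subsingleton) : expMeasure 1 S = 0 := by
  have h : expMeasure 1 ≪ volume := withDensity_absolutelyContinuous _ _
  exact h (hS.measure_zero volume)

/-- For each fixed level the Chernoff bound tends to zero as the number of terms grows. -/
lemma ae_unbounded_sum : ∀ᵐ e ∂expSeq, ∀ M : ℝ, ∃ n, M < ∑ k ∈ Finset.range n, max (e k) 0 := by
  have h1 : ∀ M : ℕ, ∀ᵐ e ∂expSeq, ∃ n, (M : ℝ) < ∑ k ∈ Finset.range n, max (e k) 0 := by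
    intro M
    have h2 : ∀ n, expSeq {e | ¬ ∃ n, (M : ℝ) < ∑ k ∈ Finset.range n, max (e k) 0}
        ≤ ENNReal.ofReal (Real.exp M * (1 / 2) ^ n) := fun n => by
      have h3 := expSeq_sum_le_le n (Finset.range n) subset_rfl M
      rw [Finset.card_range] at h3
      refine (measure_mono fun e he => ?_).trans h3
      simp only [mem_ofPred_eq, not_exists, not_lt] at he
      exact he n
    have h3 : Tendsto (fun n : ℕ => ENNReal.ofReal (Real.exp M * (1 / 2) ^ n)) atTop (𝓝 0) := by
      have := (tendsto_pow_atTop_nhds_zero_of_lt_one (r := (1 / 2 : ℝ)) (by norm_num)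
        (by norm_num)).const_mul (Real.exp M)
      simpa using ENNReal.tendsto_ofReal this
    exact le_antisymm (ge_of_tendsto' h3 h2) (zero_le)
  filter_upwards [ae_all_iff.2 h1] with e he M
  obtain ⟨m, hm⟩ := exists_nat_gt M
  obtain ⟨n, hn⟩ := he m
  exact ⟨n, hm.trans hn⟩

lemma loc_add_loc_succ (s : ℝ × ℝ) (e : ℕ → ℝ) (n : ℕ) :
    loc v s e n + loc v s e (n + 1)
      = s.1 + s.2 + ∑ k ∈ Finset.range n, max (e k) 0 / v (loc v s e (k + 1)) := by
  induction n with
  | zero => simp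
  | succ n ih => rw [Finset.sum_range_succ, loc_add_two]; linarith

namespace IsReinforcement

lemma tendsto_tailEven (hv : IsReinforcement v) (s : ℝ × ℝ) (e : ℕ → ℝ) :
    Tendsto (fun n => tail v (loc v s e (2 * n))) atTop (𝓝 (tailEven v s e)) :=
  tendsto_atTop_ciInf (hv.tail_antitone.comp_monotone (hv.monotone_loc_even s e))
    ⟨0, by rintro _ ⟨n, rfl⟩; exact hv.tail_nonneg _⟩

lemma tendsto_tailOdd (hv : IsReinforcement v) (s : ℝ × ℝ) (e : ℕ → ℝ) :
    Tendsto (fun n => tail v (loc v s e (2 * n + 1))) atTop (𝓝 (tailOdd v s e)) :=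
  tendsto_atTop_ciInf (hv.tail_antitone.comp_monotone (hv.monotone_loc_odd s e))
    ⟨0, by rintro _ ⟨n, rfl⟩; exact hv.tail_nonneg _⟩

lemma tailEven_nonneg (hv : IsReinforcement v) (s : ℝ × ℝ) (e : ℕ → ℝ) : 0 ≤ tailEven v s e :=
  le_ciInf fun _ => hv.tail_nonneg _

lemma tailOdd_nonneg (hv : IsReinforcement v) (s : ℝ × ℝ) (e : ℕ → ℝ) : 0 ≤ tailOdd v s e :=
  le_ciInf fun _ => hv.tail_nonneg _

lemma tailEven_le (hv : IsReinforcement v) (s : ℝ × ℝ) (e : ℕ → ℝ) (n : ℕ) :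
    tailEven v s e ≤ tail v (loc v s e (2 * n)) :=
  ciInf_le ⟨0, by rintro _ ⟨n, rfl⟩; exact hv.tail_nonneg _⟩ n

lemma tailOdd_le (hv : IsReinforcement v) (s : ℝ × ℝ) (e : ℕ → ℝ) (n : ℕ) :
    tailOdd v s e ≤ tail v (loc v s e (2 * n + 1)) :=
  ciInf_le ⟨0, by rintro _ ⟨n, rfl⟩; exact hv.tail_nonneg _⟩ n

lemma measurable_balance (hv : IsReinforcement v) (s : ℝ × ℝ) : Measurable (balance v s) :=
  (measurable_of_tendsto_metrizable (fun n => measurable_section s (hv.measurable_tail_loc (2 * n + 1)))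
    (tendsto_pi_nhds.2 fun e => hv.tendsto_tailOdd s e)).sub
  (measurable_of_tendsto_metrizable (fun n => measurable_section s (hv.measurable_tail_loc (2 * n)))
    (tendsto_pi_nhds.2 fun e => hv.tendsto_tailEven s e))

lemma exists_forall_le_of_lt_tail (hv : IsReinforcement v) {δ : ℝ} (hδ : 0 < δ) :
    ∃ K, ∀ t, δ ≤ tail v t → t ≤ K := by
  obtain ⟨K, hK⟩ := ((tendsto_tail v).eventually_lt_const hδ).exists
  refine ⟨K, fun t ht => ?_⟩
  by_contra h
  exact absurd (hv.tail_antitone (not_le.1 h).le) (by linarith)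

/-- At least one of the two local times diverges. -/
lemma tailEven_eq_zero_or (hv : IsReinforcement v) (s : ℝ × ℝ) {e : ℕ → ℝ}
    (he : ∀ M : ℝ, ∃ n, M < ∑ k ∈ Finset.range n, max (e k) 0) :
    tailEven v s e = 0 ∨ tailOdd v s e = 0 := by
  by_contra! h
  have h0 := (hv.tailEven_nonneg s e).lt_of_ne' h.1
  have h1 := (hv.tailOdd_nonneg s e).lt_of_ne' h.2
  obtain ⟨K, hK⟩ := hv.exists_forall_le_of_lt_tail (lt_min h0 h1)
  have hb : ∀ n, loc v s e n ≤ K := by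
    intro n
    refine hK _ ?_
    rcases Nat.even_or_odd' n with ⟨k, rfl | rfl⟩
    · exact (min_le_left _ _).trans (hv.tailEven_le s e k)
    · exact (min_le_right _ _).trans (hv.tailOdd_le s e k)
  -- If both local times stayed below `K`, each clock would add at least `max (e k) 0 / v K` to
  -- their sum, which would then diverge.
  obtain ⟨n, hn⟩ := he ((2 * K - s.1 - s.2) * v K)
  have h2 := loc_add_loc_succ (v := v) s e n
  have h3 : (∑ k ∈ Finset.range n, max (e k) 0) / v K
      ≤ ∑ k ∈ Finset.range n, max (e k) 0 / v (loc v s e (k + 1)) := by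
    rw [Finset.sum_div]
    exact Finset.sum_le_sum fun k _ =>
      div_le_div_of_nonneg_left (le_max_right _ _) (hv.pos _) (hv.mono (hb _))
  have h4 := hb n
  have h5 := hb (n + 1)
  rw [← lt_div_iff₀ (hv.pos K)] at hn
  linarith

/-- A positive limit of the tails keeps `p` eventually bounded, so a fixed gap in local time costs a
fixed amount of tail. The indices start at one because in the application the gap appears only after
the first stay. -/
lemma tail_limit_lt (hv : IsReinforcement v) {p q : ℕ → ℝ} {A B δ : ℝ} (hδ : 0 < δ) (hA : 0 < A)
    (hp : Tendsto (fun n => tail v (p n)) atTop (𝓝 A))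
    (hq : Tendsto (fun n => tail v (q n)) atTop (𝓝 B)) (hpq : ∀ n, p (n + 1) + δ ≤ q (n + 1)) :
    B < A := by
  obtain ⟨K, hK⟩ := hv.exists_forall_le_of_lt_tail (half_pos hA)
  have h1 : B ≤ A - δ / v (K + δ) := by
    refine le_of_tendsto_of_tendsto hq (hp.sub_const _) ?_
    filter_upwards [hp.eventually_const_lt (half_lt_self hA), eventually_ge_atTop 1] with n hn hn1
    obtain ⟨m, rfl⟩ := Nat.exists_eq_add_of_le' hn1
    have h2 := hv.tail_antitone (hpq m)
    have h3 := hv.le_tail_sub (le_add_of_nonneg_right hδ.le : p (m + 1) ≤ p (m + 1) + δ)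
    have h4 : δ / v (K + δ) ≤ (p (m + 1) + δ - p (m + 1)) / v (p (m + 1) + δ) := by
      rw [add_sub_cancel_left]
      exact div_le_div_of_nonneg_left hδ.le (hv.pos _)
        (hv.mono (add_le_add_left (hK _ hn.le) δ))
    linarith
  have h2 : 0 < δ / v (K + δ) := div_pos hδ (hv.pos _)
  linarith

/-- The limiting balance is a strictly increasing function of the first stay, away from zero. -/
lemma balance_cons_ne (hv : IsReinforcement v) (hstrict : StrictMonoOn v (Ici 1)) {s : ℝ × ℝ}
    (h1 : 1 ≤ s.1) {a a' : ℝ} (ha : 0 < a) (haa' : a < a') {t : ℕ → ℝ} (ht : 0 < t 0) {r : ℝ}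
    (hr : r ≠ 0) (hb : balance v s (consSeq (a, t)) = r) :
    balance v s (consSeq (a', t)) ≠ r := by
  intro hb'
  set e := consSeq (a, t) with he
  set e' := consSeq (a', t) with he'
  have e0 : e 0 = a := rfl
  have e0' : e' 0 = a' := rfl
  have hk : ∀ k, k ≠ 0 → e k = e' k := fun k hk => by
    obtain ⟨j, rfl⟩ := Nat.exists_eq_succ_of_ne_zero hk
    rfl
  have hce : ∀ k, max (e (2 * k)) 0 ≤ max (e' (2 * k)) 0 := fun k => by
    rcases Nat.eq_zero_or_pos k with rfl | hk0
    · rw [mul_zero, e0, e0']; exact max_le_max_right _ haa'.le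
    · rw [hk _ (by omega)]
  have hco : ∀ k, max (e' (2 * k + 1)) 0 ≤ max (e (2 * k + 1)) 0 := fun k => by
    rw [hk _ (by omega)]
  have hy := hv.pos s.2
  have E : ∀ n, loc v s e (2 * (n + 1)) + (a' - a) / v s.2 ≤ loc v s e' (2 * (n + 1)) := by
    intro n
    have c := (hv.coupling s hce hco (n + 1)).2.2
    have d : (a' - a) / v s.2 ≤ ∑ k ∈ Finset.range (n + 1),
        (max (e' (2 * k)) 0 - max (e (2 * k)) 0) / v (loc v s e (2 * k + 1)) := by
      refine le_trans (le_of_eq ?_) (Finset.single_le_sum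
        (fun k _ => div_nonneg (sub_nonneg.2 (hce k)) (hv.pos _).le)
        (Finset.mem_range.2 (Nat.succ_pos n)))
      simp only [mul_zero, zero_add, loc_one, e0, e0']
      rw [max_eq_left ha.le, max_eq_left (ha.trans haa').le]
    linarith
  set δ' := loc v s e 3 - loc v s e' 3 with hδ'
  -- Here strict monotonicity of the weight matters: the first stay changes the rate of the next one
  -- strictly.
  have hδ'0 : 0 < δ' := by
    have l2 : loc v s e 2 = s.1 + a / v s.2 := by
      rw [loc_add_two (e := e) 0, e0, max_eq_left ha.le]; rfl
    have l2' : loc v s e' 2 = s.1 + a' / v s.2 := by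
      rw [loc_add_two (e := e') 0, e0', max_eq_left (ha.trans haa').le]; rfl
    have l3 : loc v s e 3 = s.2 + t 0 / v (loc v s e 2) := by
      rw [loc_add_two (e := e) 1, max_eq_left (by exact ht.le)]; rfl
    have l3' : loc v s e' 3 = s.2 + t 0 / v (loc v s e' 2) := by
      rw [loc_add_two (e := e') 1, max_eq_left (by exact ht.le)]; rfl
    have hp : 0 < a / v s.2 := div_pos ha hy
    have hlt : loc v s e 2 < loc v s e' 2 := by
      rw [l2, l2']; exact add_lt_add_right (div_lt_div_of_pos_right haa' hy) _
    have hvl : v (loc v s e 2) < v (loc v s e' 2) :=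
      hstrict (by rw [l2]; exact h1.trans (by linarith)) (by
        have : loc v s e 2 ≤ loc v s e' 2 := hlt.le
        rw [l2] at this
        exact h1.trans (by linarith)) hlt
    have := div_lt_div_of_pos_left ht (hv.pos _) hvl
    rw [hδ', l3, l3']; linarith
  have O : ∀ n, loc v s e' (2 * (n + 1) + 1) + δ' ≤ loc v s e (2 * (n + 1) + 1) := fun n => by
    have := hv.coupling_odd_gap s hce hco (Nat.le_add_left 1 n)
    simp only [mul_one] at this
    linarith
  have ae : tailEven v s e' ≤ tailEven v s e :=
    le_of_tendsto_of_tendsto' (hv.tendsto_tailEven s e') (hv.tendsto_tailEven s e) fun n =>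
      hv.tail_antitone (hv.coupling s hce hco n).1
  have ao : tailOdd v s e ≤ tailOdd v s e' :=
    le_of_tendsto_of_tendsto' (hv.tendsto_tailOdd s e) (hv.tendsto_tailOdd s e') fun n =>
      hv.tail_antitone (hv.coupling s hce hco n).2.1
  rw [balance] at hb hb'
  -- If the starting vertex has zero limiting tail, then `r ≠ 0` makes the tail at the other vertex
  -- positive and strictness comes from there; otherwise it comes from the starting vertex.
  rcases (hv.tailEven_nonneg s e).eq_or_lt with hz | hz
  · have hz' : 0 < tailOdd v s e' := by
      refine lt_of_le_of_ne (hv.tailOdd_nonneg s e') fun h => hr ?_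
      have := hv.tailEven_nonneg s e'
      linarith
    have := hv.tail_limit_lt hδ'0 hz' (hv.tendsto_tailOdd s e') (hv.tendsto_tailOdd s e) O
    linarith
  · have := hv.tail_limit_lt (div_pos (sub_pos.2 haa') hy) hz (hv.tendsto_tailEven s e)
      (hv.tendsto_tailEven s e') E
    linarith

/-- The law of the limiting balance has no atoms. -/
lemma measure_balance_eq (hv : IsReinforcement v) (hstrict : StrictMonoOn v (Ici 1)) {ρ : ℝ}
    (hρ : 0 < ρ) (hmono : AntitoneOn (fun t => v t ^ ρ * tail v t) (Ici 1)) {s : ℝ × ℝ}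
    (h1 : 1 ≤ s.1) (h2 : 1 ≤ s.2) (r : ℝ) : expSeq {e | balance v s e = r} = 0 := by
  rcases eq_or_ne r 0 with rfl | hr
  · refine measure_mono_null_ae ?_ (hv.measure_bothInf_eq_zero hρ hmono h1 h2)
    filter_upwards [ae_unbounded_sum] with e he hb
    have hb' : tailOdd v s e - tailEven v s e = 0 := hb
    have h0 : tailEven v s e = 0 ∧ tailOdd v s e = 0 := by
      rcases hv.tailEven_eq_zero_or s he with h | h <;> constructor <;> linarith
    have t0 := hv.tendsto_tailEven s e
    have t1 := hv.tendsto_tailOdd s e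
    rw [h0.1] at t0
    rw [h0.2] at t1
    exact tendsto_of_even_odd (f := fun n => tail v (loc v s e n)) t0 t1
  · have hm : MeasurableSet {e | balance v s e = r} := hv.measurable_balance s (measurableSet_singleton r)
    rw [← map_consSeq, Measure.map_apply measurable_consSeq hm,
      Measure.prod_apply_symm (measurable_consSeq hm), lintegral_eq_zero_iff
        (measurable_measure_prodMk_right (measurable_consSeq hm))]
    filter_upwards [ae_pos_expSeq] with t ht
    -- After Fubini, with all clocks but the first fixed, at most one positive first clock gives the
    -- value `r`.
    have hsub : {a | 0 < a ∧ balance v s (consSeq (a, t)) = r}.Subsingleton := by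
      rintro a ⟨ha, hab⟩ a' ⟨ha', hab'⟩
      rcases lt_trichotomy a a' with h | h | h
      · exact absurd hab' (hv.balance_cons_ne hstrict h1 ha h (ht 0) hr hab)
      · exact h
      · exact absurd hab (hv.balance_cons_ne hstrict h1 ha' h (ht 0) hr hab')
    refine measure_mono_null_ae ?_ (expMeasure_subsingleton hsub)
    filter_upwards [ae_pos_expMeasure] with a ha hab
    exact ⟨ha, hab⟩

end IsReinforcement

end VRJP

/-! ### Identification of the canonical skeleton with the chain -/

namespace VRJP

open Set

/-- The weight function frozen below one. -/
def frozen (w : ℝ → ℝ) (x : ℝ) : ℝ := w (max x 1)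

/-- The waiting times used on `{0, 1}`, in the order in which they are used. -/
noncomputable def edgeSeq (χ : ℤ × ℤ → ℕ → ℝ) (n : ℕ) : ℝ :=
  if Even n then χ (0, 1) (n / 2) else χ (1, 0) (n / 2)

/-- The waiting times relevant for the process on `{0, 1}` are positive. -/
structure PositiveNoise (χ : ℤ × ℤ → ℕ → ℝ) : Prop where
  right : ∀ n, 0 < χ (0, 1) n
  left : ∀ n, 0 < χ (1, 0) n
  farLeft : 0 < χ (0, -1) 0
  farRight : 0 < χ (1, 2) 0

/-- Local time of the current vertex after `n` jumps of the process on `{0, 1}`. -/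
noncomputable def pathLoc (w : ℝ → ℝ) (χ : ℤ × ℤ → ℕ → ℝ) (n : ℕ) : ℝ :=
  loc (frozen w) (1, 1) (edgeSeq χ) n

/-- Time of the `n`-th jump of the process on `{0, 1}`. -/
noncomputable def jumpTime (w : ℝ → ℝ) (χ : ℤ × ℤ → ℕ → ℝ) (n : ℕ) : ℝ :=
  pathLoc w χ n + pathLoc w χ (n + 1) - 2

variable {w : ℝ → ℝ} {χ : ℤ × ℤ → ℕ → ℝ}

lemma edgeSeq_even (k : ℕ) : edgeSeq χ (2 * k) = χ (0, 1) k := by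
  simp [edgeSeq]

lemma edgeSeq_odd (k : ℕ) : edgeSeq χ (2 * k + 1) = χ (1, 0) k := by
  have h : ¬ Even (2 * k + 1) := Nat.not_even_iff_odd.2 ⟨k, rfl⟩
  have h2 : (2 * k + 1) / 2 = k := by omega
  simp [edgeSeq, h2]

lemma PositiveNoise.edgeSeq_pos (hχ : PositiveNoise χ) (n : ℕ) : 0 < edgeSeq χ n := by
  unfold edgeSeq
  split_ifs
  · exact hχ.right _
  · exact hχ.left _

lemma frozen_of_one_le {x : ℝ} (hx : 1 ≤ x) : frozen w x = w x := by
  rw [frozen, max_eq_left hx]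

lemma integrableOn_frozen (hint : IntegrableOn (fun u => 1 / w u) (Ioi 1)) :
    IntegrableOn (fun u => 1 / frozen w u) (Ioi 1) :=
  (integrableOn_congr_fun (fun u hu => by rw [frozen_of_one_le (le_of_lt hu)])
    measurableSet_Ioi).2 hint

namespace WeightAssumption

lemma strictMonoOn_frozen (hw : WeightAssumption w) : StrictMonoOn (frozen w) (Ici 1) :=
  fun x hx y hy hxy => by
    rw [frozen_of_one_le hx, frozen_of_one_le hy]
    exact hw.strictMonoOn (Ici_subset_Ici.2 zero_le_one hx) (Ici_subset_Ici.2 zero_le_one hy) hxy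

/-- All local times of the two vertices are at least one, so freezing `w` below one changes nothing
there and gives a globally monotone function bounded below. -/
lemma isReinforcement (hw : WeightAssumption w)
    (hint : IntegrableOn (fun u => 1 / w u) (Ioi 1)) : IsReinforcement (frozen w) where
  mono x y h := by
    refine hw.strictMonoOn.monotoneOn ?_ ?_ (max_le_max_right 1 h)
    · exact zero_le_one.trans (le_max_right x 1)
    · exact zero_le_one.trans (le_max_right y 1)
  one_le x := by
    rw [← hw.map_one]
    exact hw.strictMonoOn.monotoneOn (zero_le_one (α := ℝ)) (zero_le_one.trans (le_max_right x 1))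
      (le_max_right x 1)
  rightContinuous x := by
    refine ContinuousWithinAt.comp (f := fun y : ℝ => max y 1) (t := Ici (max x 1))
      (hw.rightContinuous _ (zero_le_one.trans (le_max_right x 1)))
      (Continuous.continuousWithinAt (by fun_prop)) ?_
    intro y hy
    exact max_le_max_right 1 (mem_Ici.1 hy)
  integrableOn := integrableOn_frozen hint

end WeightAssumption

lemma tail_frozen {t : ℝ} (ht : 1 ≤ t) : tail (frozen w) t = ∫ s in Ioi t, 1 / w s :=
  setIntegral_congr_fun measurableSet_Ioi fun u hu => by
    rw [frozen_of_one_le (ht.trans (le_of_lt hu))]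

lemma antitoneOn_frozen {ρ : ℝ}
    (h : AntitoneOn (fun t => w t ^ ρ * ∫ s in Ioi t, 1 / w s) (Ici 1)) :
    AntitoneOn (fun t => frozen w t ^ ρ * tail (frozen w) t) (Ici 1) :=
  h.congr fun t ht => by simp only; rw [frozen_of_one_le ht, tail_frozen ht]

lemma one_le_pathLoc (hv : IsReinforcement (frozen w)) (χ : ℤ × ℤ → ℕ → ℝ) (n : ℕ) :
    1 ≤ pathLoc w χ n := by
  have h := hv.min_le_loc (1, 1) (edgeSeq χ) n
  rwa [min_self] at h

lemma weight_pos (hv : IsReinforcement (frozen w)) {x : ℝ} (hx : 1 ≤ x) : 0 < w x := by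
  rw [← frozen_of_one_le (w := w) hx]; exact hv.pos x

lemma pathLoc_add_two (hv : IsReinforcement (frozen w)) (hχ : PositiveNoise χ) (n : ℕ) :
    pathLoc w χ (n + 2) = pathLoc w χ n + edgeSeq χ n / w (pathLoc w χ (n + 1)) := by
  rw [← frozen_of_one_le (w := w) (one_le_pathLoc hv χ (n + 1)), pathLoc, loc_add_two,
    max_eq_left (hχ.edgeSeq_pos n).le]
  rfl

lemma pathLoc_lt_add_two (hv : IsReinforcement (frozen w)) (hχ : PositiveNoise χ) (n : ℕ) :
    pathLoc w χ n < pathLoc w χ (n + 2) := by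
  rw [pathLoc_add_two hv hχ]
  exact lt_add_of_pos_right _
    (div_pos (hχ.edgeSeq_pos n) (weight_pos hv (one_le_pathLoc hv χ (n + 1))))

lemma strictMono_jumpTime (hv : IsReinforcement (frozen w)) (hχ : PositiveNoise χ) :
    StrictMono (jumpTime w χ) :=
  strictMono_nat_of_lt_succ fun n => by
    have := pathLoc_lt_add_two hv hχ n
    simp only [jumpTime]
    linarith

lemma jumpTime_zero : jumpTime w χ 0 = 0 := by
  simp only [jumpTime, pathLoc, loc_zero, zero_add, loc_one]
  norm_num

lemma jumpTime_nonneg (hv : IsReinforcement (frozen w)) (hχ : PositiveNoise χ) (n : ℕ) :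
    0 ≤ jumpTime w χ n := by
  rw [← jumpTime_zero (w := w) (χ := χ)]
  exact (strictMono_jumpTime hv hχ).monotone (Nat.zero_le n)

/-- The skeleton after an even number `2 * k` of jumps. -/
structure EvenState (w : ℝ → ℝ) (χ : ℤ × ℤ → ℕ → ℝ) (k : ℕ) (st : SkeletonState) : Prop where
  pos : st.pos = 0
  time : st.time = ENNReal.ofReal (jumpTime w χ (2 * k))
  loc0 : st.loc 0 = ENNReal.ofReal (pathLoc w χ (2 * k))
  loc1 : st.loc 1 = ENNReal.ofReal (pathLoc w χ (2 * k + 1))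
  locL : st.loc (-1) = 0
  locR : st.loc 2 = 0
  jumps01 : st.jumps (0, 1) = k
  jumps10 : st.jumps (1, 0) = k
  jumpsL : st.jumps (0, -1) = 0
  jumpsR : st.jumps (1, 2) = 0

/-- The skeleton after an odd number `2 * k + 1` of jumps. -/
structure OddState (w : ℝ → ℝ) (χ : ℤ × ℤ → ℕ → ℝ) (k : ℕ) (st : SkeletonState) : Prop where
  pos : st.pos = 1
  time : st.time = ENNReal.ofReal (jumpTime w χ (2 * k + 1))
  loc0 : st.loc 0 = ENNReal.ofReal (pathLoc w χ (2 * k + 2))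
  loc1 : st.loc 1 = ENNReal.ofReal (pathLoc w χ (2 * k + 1))
  locL : st.loc (-1) = 0
  locR : st.loc 2 = 0
  jumps01 : st.jumps (0, 1) = k + 1
  jumps10 : st.jumps (1, 0) = k
  jumpsL : st.jumps (0, -1) = 0
  jumpsR : st.jumps (1, 2) = 0

/-- Positivity of the clock is needed, since `0 / 0 = 0` in `ℝ≥0∞`. The clocks towards `-1` and `2`
are never consumed, so only their index `0` matters. -/
lemma waitingTime_of_loc_eq_zero (hw0 : w 0 = 0) {st : SkeletonState} {j : ℤ}
    (hj : st.loc j = 0) (hpos : 0 < χ (st.pos, j) (st.jumps (st.pos, j))) :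
    waitingTime w χ st j = ∞ := by
  simp [waitingTime, hj, hw0, ENNReal.div_zero, hpos]

lemma waitingTime_of_loc_eq (hv : IsReinforcement (frozen w)) {st : SkeletonState} {j : ℤ} {x : ℝ}
    (hx : 1 ≤ x) (hj : st.loc j = ENNReal.ofReal x) :
    waitingTime w χ st j
      = ENNReal.ofReal (χ (st.pos, j) (st.jumps (st.pos, j)) / w x) := by
  rw [waitingTime, hj, ENNReal.toReal_ofReal (zero_le_one.trans hx),
    ENNReal.ofReal_div_of_pos (weight_pos hv hx)]

lemma EvenState.step (hw0 : w 0 = 0) (hv : IsReinforcement (frozen w)) (hχ : PositiveNoise χ)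
    {k : ℕ} {st : SkeletonState} (h : EvenState w χ k st) : OddState w χ k (step w χ st) := by
  have hL : waitingTime w χ st (st.pos - 1) = ∞ := by
    refine waitingTime_of_loc_eq_zero hw0 ?_ ?_ <;> rw [h.pos]
    · exact h.locL
    · have := h.jumpsL
      norm_num at this ⊢
      rw [this]; exact hχ.farLeft
  have hR : waitingTime w χ st (st.pos + 1)
      = ENNReal.ofReal (edgeSeq χ (2 * k) / w (pathLoc w χ (2 * k + 1))) := by
    rw [waitingTime_of_loc_eq hv (one_le_pathLoc hv χ (2 * k + 1)) (by rw [h.pos]; exact h.loc1),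
      h.pos, zero_add, h.jumps01, edgeSeq_even]
  have hnext : nextPos w χ st = 1 := by
    rw [nextPos, hL, if_pos le_top, h.pos, zero_add]
  have hhold : holdingTime w χ st
      = ENNReal.ofReal (edgeSeq χ (2 * k) / w (pathLoc w χ (2 * k + 1))) := by
    rw [holdingTime, hL, hR, min_eq_right le_top]
  have hpos : 0 ≤ edgeSeq χ (2 * k) / w (pathLoc w χ (2 * k + 1)) :=
    div_nonneg (hχ.edgeSeq_pos _).le (weight_pos hv (one_le_pathLoc hv χ _)).le
  have h2 := pathLoc_add_two hv hχ (2 * k)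
  constructor
  · exact hnext
  · simp only [VRJP.step]
    rw [hhold, h.time, ← ENNReal.ofReal_add (jumpTime_nonneg hv hχ _) hpos]
    congr 1
    simp only [jumpTime, h2]
    ring
  · simp only [VRJP.step]
    rw [h.pos, Function.update_self, h.loc0, hhold, h2, ← ENNReal.ofReal_add
      (zero_le_one.trans (one_le_pathLoc hv χ _)) hpos]
  · simp [VRJP.step, h.pos, h.loc1]
  · simp [VRJP.step, h.pos, h.locL]
  · simp [VRJP.step, h.pos, h.locR]
  · simp [VRJP.step, h.pos, hnext, h.jumps01]
  · simp [VRJP.step, h.pos, hnext, h.jumps10]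
  · simp [VRJP.step, h.pos, hnext, h.jumpsL]
  · simp [VRJP.step, h.pos, hnext, h.jumpsR]

lemma OddState.step (hw0 : w 0 = 0) (hv : IsReinforcement (frozen w)) (hχ : PositiveNoise χ)
    {k : ℕ} {st : SkeletonState} (h : OddState w χ k st) :
    EvenState w χ (k + 1) (step w χ st) := by
  have hR : waitingTime w χ st (st.pos + 1) = ∞ := by
    refine waitingTime_of_loc_eq_zero hw0 ?_ ?_ <;> rw [h.pos]
    · exact h.locR
    · have := h.jumpsR
      norm_num at this ⊢
      rw [this]; exact hχ.farRight
  have hL : waitingTime w χ st (st.pos - 1)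
      = ENNReal.ofReal (edgeSeq χ (2 * k + 1) / w (pathLoc w χ (2 * k + 2))) := by
    rw [waitingTime_of_loc_eq hv (one_le_pathLoc hv χ (2 * k + 2)) (by rw [h.pos]; exact h.loc0),
      h.pos, sub_self, h.jumps10, edgeSeq_odd]
  have hnext : nextPos w χ st = 0 := by
    rw [nextPos, hL, hR, if_neg (by simp), h.pos, sub_self]
  have hhold : holdingTime w χ st
      = ENNReal.ofReal (edgeSeq χ (2 * k + 1) / w (pathLoc w χ (2 * k + 2))) := by
    rw [holdingTime, hL, hR, min_eq_left le_top]
  have hpos : 0 ≤ edgeSeq χ (2 * k + 1) / w (pathLoc w χ (2 * k + 2)) :=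
    div_nonneg (hχ.edgeSeq_pos _).le (weight_pos hv (one_le_pathLoc hv χ _)).le
  have h2 : pathLoc w χ (2 * k + 3) = pathLoc w χ (2 * k + 1)
      + edgeSeq χ (2 * k + 1) / w (pathLoc w χ (2 * k + 2)) := pathLoc_add_two hv hχ (2 * k + 1)
  constructor
  · exact hnext
  · simp only [VRJP.step]
    rw [hhold, h.time, ← ENNReal.ofReal_add (jumpTime_nonneg hv hχ _) hpos]
    congr 1
    simp only [jumpTime, mul_add, mul_one, h2]
    ring
  · simp [VRJP.step, h.pos, h.loc0, mul_add]
  · simp only [VRJP.step]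
    rw [h.pos, Function.update_self, h.loc1, hhold, mul_add, mul_one, h2, ← ENNReal.ofReal_add
      (zero_le_one.trans (one_le_pathLoc hv χ _)) hpos]
  · simp [VRJP.step, h.pos, h.locL]
  · simp [VRJP.step, h.pos, h.locR]
  · simp [VRJP.step, h.pos, hnext, h.jumps01]
  · simp [VRJP.step, h.pos, hnext, h.jumps10]
  · simp [VRJP.step, h.pos, hnext, h.jumpsL]
  · simp [VRJP.step, h.pos, hnext, h.jumpsR]

/-- The skeleton of the process on `{0, 1}`. -/
noncomputable abbrev twoVertexSkeleton (w : ℝ → ℝ) (χ : ℤ × ℤ → ℕ → ℝ) : ℕ → SkeletonState :=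
  skeleton w twoVertexWeights 0 χ

lemma evenState_skeleton (hw0 : w 0 = 0) (hv : IsReinforcement (frozen w)) (hχ : PositiveNoise χ)
    (k : ℕ) : EvenState w χ k (twoVertexSkeleton w χ (2 * k)) := by
  induction k with
  | zero =>
    constructor <;> simp [skeleton, twoVertexWeights, jumpTime_zero, pathLoc]
  | succ k ih => exact (ih.step hw0 hv hχ).step hw0 hv hχ

lemma oddState_skeleton (hw0 : w 0 = 0) (hv : IsReinforcement (frozen w)) (hχ : PositiveNoise χ)
    (k : ℕ) : OddState w χ k (twoVertexSkeleton w χ (2 * k + 1)) :=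
  (evenState_skeleton hw0 hv hχ k).step hw0 hv hχ

lemma skeleton_time (hw0 : w 0 = 0) (hv : IsReinforcement (frozen w)) (hχ : PositiveNoise χ)
    (n : ℕ) : (twoVertexSkeleton w χ n).time = ENNReal.ofReal (jumpTime w χ n) := by
  rcases Nat.even_or_odd' n with ⟨k, rfl | rfl⟩
  · exact (evenState_skeleton hw0 hv hχ k).time
  · exact (oddState_skeleton hw0 hv hχ k).time

lemma twoVertexProcess_eq_pos (hw0 : w 0 = 0) (hv : IsReinforcement (frozen w))
    (hχ : PositiveNoise χ) {n : ℕ} {t : ℝ} (h0 : jumpTime w χ n ≤ t) (h1 : t < jumpTime w χ (n + 1)) :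
    twoVertexProcess w χ t = (twoVertexSkeleton w χ n).pos := by
  have ht : 0 ≤ t := (jumpTime_nonneg hv hχ n).trans h0
  have hmem : ∀ m : ℕ, (t ∈ {s : ℝ | (skeleton w twoVertexWeights 0 χ m).time ≤ ENNReal.ofReal s ∧
      ENNReal.ofReal s < (skeleton w twoVertexWeights 0 χ (m + 1)).time}) ↔ m = n := by
    intro m
    have e1 := skeleton_time hw0 hv hχ m
    have e2 := skeleton_time hw0 hv hχ (m + 1)
    simp only [twoVertexSkeleton] at e1 e2
    rw [mem_ofPred_eq, e1, e2, ENNReal.ofReal_le_ofReal_iff ht,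
      ENNReal.ofReal_lt_ofReal_iff_of_nonneg ht]
    constructor
    · rintro ⟨k0, k1⟩
      have l1 := (strictMono_jumpTime hv hχ).lt_iff_lt.1 (k0.trans_lt h1)
      have l2 := (strictMono_jumpTime hv hχ).lt_iff_lt.1 (h0.trans_lt k1)
      omega
    · rintro rfl
      exact ⟨h0, h1⟩
  -- The intervals between successive jump times are disjoint, so a single summand is nonzero.
  rw [twoVertexProcess, canonicalProcess, tsum_eq_single n]
  · rw [indicator_of_mem ((hmem n).2 rfl)]
  · intro m hm
    rw [indicator_of_notMem (fun h => hm ((hmem m).1 h))]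

end VRJP

/-! ### Continuous time: local times, convergence of `Z`, and the minimum -/

namespace VRJP

open Set

variable {w : ℝ → ℝ} {χ : ℤ × ℤ → ℕ → ℝ}

lemma IsReinforcement.tendsto_atTop_of_tendsto_tail {v : ℝ → ℝ} (hv : IsReinforcement v)
    {α : Type*} {l : Filter α} {f : α → ℝ} (h : Tendsto (fun a => tail v (f a)) l (𝓝 0)) :
    Tendsto f l atTop := by
  refine Filter.tendsto_atTop.2 fun K => ?_
  filter_upwards [h.eventually_lt_const (hv.tail_pos K)] with a ha
  by_contra hlt
  exact absurd (hv.tail_antitone (not_le.1 hlt).le) (not_le.2 ha)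

/-- The driving waiting times make the process run forever. -/
structure RegularNoise (χ : ℤ × ℤ → ℕ → ℝ) : Prop extends PositiveNoise χ where
  unbounded_sum : ∀ M : ℝ, ∃ n, M < ∑ k ∈ Finset.range n, max (edgeSeq χ k) 0

/-- The limiting balance of the process on `{0, 1}`. -/
noncomputable def pathBalance (w : ℝ → ℝ) (χ : ℤ × ℤ → ℕ → ℝ) : ℝ :=
  balance (frozen w) (1, 1) (edgeSeq χ)

lemma tendsto_tail_pathLoc_even (hv : IsReinforcement (frozen w)) (χ : ℤ × ℤ → ℕ → ℝ) :
    Tendsto (fun n => tail (frozen w) (pathLoc w χ (2 * n))) atTop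
      (𝓝 (tailEven (frozen w) (1, 1) (edgeSeq χ))) :=
  hv.tendsto_tailEven (1, 1) (edgeSeq χ)

lemma tendsto_tail_pathLoc_odd (hv : IsReinforcement (frozen w)) (χ : ℤ × ℤ → ℕ → ℝ) :
    Tendsto (fun n => tail (frozen w) (pathLoc w χ (2 * n + 1))) atTop
      (𝓝 (tailOdd (frozen w) (1, 1) (edgeSeq χ))) :=
  hv.tendsto_tailOdd (1, 1) (edgeSeq χ)

/-- No explosion: elapsed time is the sum of the two local times minus the initial weights, and one
of the local times diverges. -/
lemma tendsto_jumpTime (hv : IsReinforcement (frozen w)) (hχ : RegularNoise χ) :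
    Tendsto (jumpTime w χ) atTop atTop := by
  refine tendsto_atTop_atTop_of_monotone (strictMono_jumpTime hv hχ.1).monotone fun b => ?_
  rcases hv.tailEven_eq_zero_or (1, 1) hχ.2 with h | h
  · have h1 := tendsto_tail_pathLoc_even hv χ
    rw [h] at h1
    obtain ⟨k, hk⟩ := ((hv.tendsto_atTop_of_tendsto_tail h1).eventually_ge_atTop (b + 1)).exists
    have h2 := one_le_pathLoc hv χ (2 * k + 1)
    exact ⟨2 * k, by simp only [jumpTime]; linarith⟩
  · have h1 := tendsto_tail_pathLoc_odd hv χ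
    rw [h] at h1
    obtain ⟨k, hk⟩ := ((hv.tendsto_atTop_of_tendsto_tail h1).eventually_ge_atTop (b + 1)).exists
    have h2 := one_le_pathLoc hv χ (2 * k)
    exact ⟨2 * k, by simp only [jumpTime]; linarith⟩

/-- The indicator function of the times spent at `i`. -/
noncomputable abbrev presence (w : ℝ → ℝ) (χ : ℤ × ℤ → ℕ → ℝ) (i : ℤ) : ℝ → ℝ :=
  {r : ℝ | twoVertexProcess w χ r = i}.indicator fun _ => (1 : ℝ)

lemma presence_nonneg (i : ℤ) (t : ℝ) : 0 ≤ presence w χ i t :=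
  indicator_nonneg (fun _ _ => zero_le_one) t

lemma presence_le_one (i : ℤ) (t : ℝ) : presence w χ i t ≤ 1 :=
  indicator_le_self' (fun _ _ => zero_le_one) t



lemma presence_eqOn (hw0 : w 0 = 0) (hv : IsReinforcement (frozen w)) (hχ : PositiveNoise χ)
    (i : ℤ) (n : ℕ) :
    EqOn (presence w χ i) (fun _ => if (twoVertexSkeleton w χ n).pos = i then 1 else 0)
      (Ioo (jumpTime w χ n) (jumpTime w χ (n + 1))) := fun t ht => by
  have h := twoVertexProcess_eq_pos hw0 hv hχ ht.1.le ht.2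
  simp only [presence, indicator, mem_ofPred_eq, h]

lemma intervalIntegrable_presence_step (hw0 : w 0 = 0) (hv : IsReinforcement (frozen w))
    (hχ : PositiveNoise χ) (i : ℤ) (n : ℕ) :
    IntervalIntegrable (presence w χ i) volume (jumpTime w χ n) (jumpTime w χ (n + 1)) := by
  refine (intervalIntegrable_const
    (c := (if (twoVertexSkeleton w χ n).pos = i then 1 else 0 : ℝ))).congr_uIoo ?_
  rw [uIoo_of_lt (strictMono_jumpTime hv hχ n.lt_succ_self)]
  exact (presence_eqOn hw0 hv hχ i n).symm

lemma intervalIntegrable_presence (hw0 : w 0 = 0) (hv : IsReinforcement (frozen w))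
    (hχ : PositiveNoise χ) (i : ℤ) (n : ℕ) :
    IntervalIntegrable (presence w χ i) volume 0 (jumpTime w χ n) := by
  rw [← jumpTime_zero (w := w) (χ := χ)]
  exact IntervalIntegrable.trans_iterate fun k _ =>
    intervalIntegrable_presence_step hw0 hv hχ i k

lemma twoVertexLocalTime_jump (hw0 : w 0 = 0) (hv : IsReinforcement (frozen w))
    (hχ : PositiveNoise χ) (i : ℤ) (n : ℕ) :
    twoVertexLocalTime w χ i (jumpTime w χ (n + 1)) = twoVertexLocalTime w χ i (jumpTime w χ n)
      + if (twoVertexSkeleton w χ n).pos = i then pathLoc w χ (n + 2) - pathLoc w χ n else 0 := by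
  have h1 := intervalIntegral.integral_add_adjacent_intervals
    (intervalIntegrable_presence hw0 hv hχ i n) (intervalIntegrable_presence_step hw0 hv hχ i n)
  have h2 : ∫ r in jumpTime w χ n..jumpTime w χ (n + 1), presence w χ i r
      = if (twoVertexSkeleton w χ n).pos = i then pathLoc w χ (n + 2) - pathLoc w χ n else 0 := by
    rw [intervalIntegral.integral_congr_Ioo_of_le
      (strictMono_jumpTime hv hχ n.lt_succ_self).le (presence_eqOn hw0 hv hχ i n),
      intervalIntegral.integral_const]
    split_ifs
    · simp only [jumpTime, smul_eq_mul]; ring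
    · simp
  rw [twoVertexLocalTime, localTime, ← h1, h2, ← add_assoc]
  rfl

lemma twoVertexLocalTime_jump_even (hw0 : w 0 = 0) (hv : IsReinforcement (frozen w))
    (hχ : PositiveNoise χ) (k : ℕ) :
    twoVertexLocalTime w χ 0 (jumpTime w χ (2 * k)) = pathLoc w χ (2 * k) ∧
    twoVertexLocalTime w χ 1 (jumpTime w χ (2 * k)) = pathLoc w χ (2 * k + 1) := by
  induction k with
  | zero =>
    simp [jumpTime_zero, twoVertexLocalTime, localTime, twoVertexWeights, pathLoc]
  | succ k ih =>
    have e0 := (evenState_skeleton hw0 hv hχ k).pos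
    have e1 := (oddState_skeleton hw0 hv hχ k).pos
    have a := fun i => twoVertexLocalTime_jump hw0 hv hχ i (2 * k)
    have b := fun i => twoVertexLocalTime_jump hw0 hv hχ i (2 * k + 1)
    rw [e0] at a
    rw [e1] at b
    rw [mul_add, mul_one]
    constructor
    · rw [b 0, a 0, ih.1]; simp
    · rw [b 1, a 1, ih.2]; simp

lemma monotoneOn_twoVertexLocalTime (hw0 : w 0 = 0) (hv : IsReinforcement (frozen w))
    (hχ : RegularNoise χ) (i : ℤ) : MonotoneOn (twoVertexLocalTime w χ i) (Ici 0) := by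
  intro s hs t ht hst
  obtain ⟨n, hn⟩ := ((tendsto_jumpTime hv hχ).eventually_ge_atTop t).exists
  have h1 : IntervalIntegrable (presence w χ i) volume 0 t :=
    (intervalIntegrable_presence hw0 hv hχ.1 i n).mono_set
      (uIcc_subset_uIcc_left (by rw [uIcc_of_le (ht.trans hn)]; exact ⟨ht, hn⟩))
  exact add_le_add_right (intervalIntegral.integral_mono_interval le_rfl hs hst
    (Eventually.of_forall fun r => presence_nonneg i r) h1) _

lemma tendsto_jumpTime_even (hv : IsReinforcement (frozen w)) (hχ : RegularNoise χ) :
    Tendsto (fun k => jumpTime w χ (2 * k)) atTop atTop :=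
  (tendsto_jumpTime hv hχ).comp (tendsto_id.const_mul_atTop' two_pos)

/-- Local times are monotone in `t`, so convergence along the even jump times suffices. The `max t
0` in the proof is there because monotonicity is known only on `[0, ∞)`. -/
lemma tendsto_tail_localTime (hw0 : w 0 = 0) (hv : IsReinforcement (frozen w))
    (hχ : RegularNoise χ) (i : ℤ) {A : ℝ}
    (h : Tendsto (fun k => tail (frozen w) (twoVertexLocalTime w χ i (jumpTime w χ (2 * k)))) atTop
      (𝓝 A)) :
    Tendsto (fun t => tail (frozen w) (twoVertexLocalTime w χ i t)) atTop (𝓝 A) := by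
  have hanti : Antitone fun t => tail (frozen w) (twoVertexLocalTime w χ i (max t 0)) :=
    fun s t hst => hv.tail_antitone (monotoneOn_twoVertexLocalTime hw0 hv hχ i
      (le_max_right s 0) (le_max_right t 0) (max_le_max_right 0 hst))
  have h1 := (tendsto_iff_tendsto_subseq_of_antitone hanti (tendsto_jumpTime_even hv hχ)).2
    (h.congr fun k => by
      simp only [Function.comp_apply, max_eq_left (jumpTime_nonneg hv hχ.1 (2 * k))])
  refine h1.congr' ?_
  filter_upwards [eventually_ge_atTop 0] with t ht
  rw [max_eq_left ht]

lemma one_le_twoVertexLocalTime (hw0 : w 0 = 0) (hv : IsReinforcement (frozen w))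
    (hχ : RegularNoise χ) {t : ℝ} (ht : 0 ≤ t) :
    1 ≤ twoVertexLocalTime w χ 0 t ∧ 1 ≤ twoVertexLocalTime w χ 1 t := by
  have h := fun i => monotoneOn_twoVertexLocalTime hw0 hv hχ i (self_mem_Ici (a := (0 : ℝ))) ht ht
  have h0 := h 0
  have h1 := h 1
  simp only [twoVertexLocalTime, localTime, twoVertexWeights, intervalIntegral.integral_same]
    at h0 h1 ⊢
  simp only [mem_insert_iff, mem_singleton_iff, true_or, or_true, indicator_of_mem, add_zero]
    at h0 h1 ⊢
  exact ⟨h0, h1⟩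

lemma integral_eq_tail_sub (hv : IsReinforcement (frozen w)) {x : ℝ} (hx : 1 ≤ x) :
    ∫ u in (1 : ℝ)..x, 1 / w u = tail (frozen w) 1 - tail (frozen w) x := by
  rw [hv.tail_sub]
  refine intervalIntegral.integral_congr fun u hu => ?_
  rw [uIcc_of_le hx] at hu
  simp only [frozen_of_one_le hu.1]

/-- On a regular trajectory, `Z` converges to the limiting balance. -/
theorem tendsto_Z (hw0 : w 0 = 0) (hv : IsReinforcement (frozen w)) (hχ : RegularNoise χ) :
    Tendsto (Z w χ) atTop (𝓝 (pathBalance w χ)) := by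
  have hE := tendsto_tail_localTime hw0 hv hχ 0 ((tendsto_tail_pathLoc_even hv χ).congr fun k => by
    rw [(twoVertexLocalTime_jump_even hw0 hv hχ.1 k).1])
  have hO := tendsto_tail_localTime hw0 hv hχ 1 ((tendsto_tail_pathLoc_odd hv χ).congr fun k => by
    rw [(twoVertexLocalTime_jump_even hw0 hv hχ.1 k).2])
  -- One of the two factors diverges and the other is at least one, so the jump correction in `Z`
  -- vanishes.
  have hprod : Tendsto (fun t => frozen w (twoVertexLocalTime w χ 0 t)
      * frozen w (twoVertexLocalTime w χ 1 t)) atTop atTop := by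
    rcases hv.tailEven_eq_zero_or (1, 1) hχ.2 with h | h
    · rw [h] at hE
      exact tendsto_atTop_mono (fun t => le_mul_of_one_le_right (hv.pos _).le (hv.one_le _))
        (hv.tendsto_atTop.comp (hv.tendsto_atTop_of_tendsto_tail hE))
    · rw [h] at hO
      exact tendsto_atTop_mono (fun t => le_mul_of_one_le_left (hv.pos _).le (hv.one_le _))
        (hv.tendsto_atTop.comp (hv.tendsto_atTop_of_tendsto_tail hO))
  have hzero : Tendsto (fun t => presence w χ 1 t / (frozen w (twoVertexLocalTime w χ 0 t)
      * frozen w (twoVertexLocalTime w χ 1 t))) atTop (𝓝 0) :=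
    tendsto_bdd_div_atTop_nhds_zero (Eventually.of_forall fun t => presence_nonneg 1 t)
      (Eventually.of_forall fun t => presence_le_one 1 t) hprod
  have h := (hO.sub hE).sub hzero
  rw [sub_zero] at h
  refine h.congr' ?_
  filter_upwards [eventually_ge_atTop 0] with t ht
  obtain ⟨h0, h1⟩ := one_le_twoVertexLocalTime hw0 hv hχ ht
  rw [Z, integral_eq_tail_sub hv h0, integral_eq_tail_sub hv h1, frozen_of_one_le h0,
    frozen_of_one_le h1]
  ring

lemma Zinfty_eq (hw0 : w 0 = 0) (hv : IsReinforcement (frozen w)) (hχ : RegularNoise χ) :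
    Zinfty w χ = pathBalance w χ :=
  (tendsto_Z hw0 hv hχ).limUnder_eq

lemma totalLocalTime_eq (hw0 : w 0 = 0) (hv : IsReinforcement (frozen w)) (hχ : RegularNoise χ)
    (i : ℤ) : totalLocalTime twoVertexWeights (twoVertexProcess w χ) i
      = ⨆ k, ENNReal.ofReal (twoVertexLocalTime w χ i (jumpTime w χ (2 * k))) := by
  refine le_antisymm (iSup_le fun t => ?_) (iSup_le fun k => ?_)
  · obtain ⟨k, hk⟩ := ((tendsto_jumpTime_even hv hχ).eventually_ge_atTop (t : ℝ)).exists
    exact le_iSup_of_le k (ENNReal.ofReal_le_ofReal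
      (monotoneOn_twoVertexLocalTime hw0 hv hχ i t.2 (mem_Ici.2 (t.2.trans hk)) hk))
  · exact le_iSup_of_le (⟨_, jumpTime_nonneg hv hχ.1 (2 * k)⟩ : Ici (0 : ℝ)) le_rfl

lemma minTotalLocalTime_eq (hw0 : w 0 = 0) (hv : IsReinforcement (frozen w))
    (hχ : RegularNoise χ) : minTotalLocalTime w χ
      = min (⨆ k, ENNReal.ofReal (pathLoc w χ (2 * k)))
          (⨆ k, ENNReal.ofReal (pathLoc w χ (2 * k + 1))) := by
  rw [minTotalLocalTime, totalLocalTime_eq hw0 hv hχ, totalLocalTime_eq hw0 hv hχ]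
  simp only [(twoVertexLocalTime_jump_even hw0 hv hχ.1 _).1,
    (twoVertexLocalTime_jump_even hw0 hv hχ.1 _).2]

namespace IsReinforcement

variable {v : ℝ → ℝ}

lemma iSup_ofReal_lt_top (hv : IsReinforcement v) {f : ℕ → ℝ} (hf : Monotone f) {A : ℝ}
    (hA : 0 < A) (h : Tendsto (fun n => tail v (f n)) atTop (𝓝 A)) :
    ⨆ n, ENNReal.ofReal (f n) < ∞ := by
  obtain ⟨K, hK⟩ := hv.exists_forall_le_of_lt_tail hA
  exact (iSup_le fun n => ENNReal.ofReal_le_ofReal (hK _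
    ((hv.tail_antitone.comp_monotone hf).le_of_tendsto h n))).trans_lt ENNReal.ofReal_lt_top

lemma limit_eq_tail_of_iSup_eq (hv : IsReinforcement v) {f : ℕ → ℝ} (hf : Monotone f)
    (h0 : ∀ n, 0 ≤ f n) {A : ℝ} (h : Tendsto (fun n => tail v (f n)) atTop (𝓝 A)) {a : ℝ≥0∞}
    (ha : a ≠ ∞) (hs : ⨆ n, ENNReal.ofReal (f n) = a) : A = tail v a.toReal := by
  have h1 : Tendsto (fun n => ENNReal.ofReal (f n)) atTop (𝓝 a) := by
    rw [← hs]
    exact tendsto_atTop_iSup fun m n hmn => ENNReal.ofReal_le_ofReal (hf hmn)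
  have h2 : Tendsto f atTop (𝓝 a.toReal) :=
    ((ENNReal.tendsto_toReal ha).comp h1).congr fun n => ENNReal.toReal_ofReal (h0 n)
  exact tendsto_nhds_unique h ((hv.continuous_tail.tendsto _).comp h2)

end IsReinforcement

lemma monotone_pathLoc_even (hv : IsReinforcement (frozen w)) (χ : ℤ × ℤ → ℕ → ℝ) :
    Monotone fun n => pathLoc w χ (2 * n) :=
  hv.monotone_loc_even (1, 1) (edgeSeq χ)

lemma monotone_pathLoc_odd (hv : IsReinforcement (frozen w)) (χ : ℤ × ℤ → ℕ → ℝ) :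
    Monotone fun n => pathLoc w χ (2 * n + 1) :=
  hv.monotone_loc_odd (1, 1) (edgeSeq χ)

lemma minTotalLocalTime_lt_top (hw0 : w 0 = 0) (hv : IsReinforcement (frozen w))
    (hχ : RegularNoise χ) (h : pathBalance w χ ≠ 0) : minTotalLocalTime w χ < ∞ := by
  rw [minTotalLocalTime_eq hw0 hv hχ, min_lt_iff]
  have hne : tailEven (frozen w) (1, 1) (edgeSeq χ) ≠ 0
      ∨ tailOdd (frozen w) (1, 1) (edgeSeq χ) ≠ 0 := by
    by_contra! hc
    exact h (by rw [pathBalance, balance, hc.1, hc.2, sub_zero])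
  refine hne.imp (fun h => ?_) fun h => ?_
  · exact hv.iSup_ofReal_lt_top (monotone_pathLoc_even hv χ)
      ((hv.tailEven_nonneg _ _).lt_of_ne' h) (tendsto_tail_pathLoc_even hv χ)
  · exact hv.iSup_ofReal_lt_top (monotone_pathLoc_odd hv χ)
      ((hv.tailOdd_nonneg _ _).lt_of_ne' h) (tendsto_tail_pathLoc_odd hv χ)

/-- The vertex attaining a finite minimum `a` has limiting tail `tail (frozen w) a.toReal > 0`, so
the other limit is zero and the balance is this value up to sign. -/
lemma pathBalance_eq_of_minTotalLocalTime_eq (hw0 : w 0 = 0) (hv : IsReinforcement (frozen w))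
    (hχ : RegularNoise χ) {a : ℝ≥0∞} (ha : a ≠ ∞) (h : minTotalLocalTime w χ = a) :
    pathBalance w χ = tail (frozen w) a.toReal ∨ pathBalance w χ = -tail (frozen w) a.toReal := by
  rw [minTotalLocalTime_eq hw0 hv hχ] at h
  have hpos := hv.tail_pos a.toReal
  have hor := hv.tailEven_eq_zero_or (1, 1) hχ.2
  rw [pathBalance, balance]
  rcases min_choice (⨆ k, ENNReal.ofReal (pathLoc w χ (2 * k)))
    (⨆ k, ENNReal.ofReal (pathLoc w χ (2 * k + 1))) with hm | hm
  · have hE := hv.limit_eq_tail_of_iSup_eq (monotone_pathLoc_even hv χ)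
      (fun n => zero_le_one.trans (one_le_pathLoc hv χ _)) (tendsto_tail_pathLoc_even hv χ) ha
      (hm.symm.trans h)
    right
    rw [hE, hor.resolve_left (by rw [hE]; exact hpos.ne'), zero_sub]
  · have hO := hv.limit_eq_tail_of_iSup_eq (monotone_pathLoc_odd hv χ)
      (fun n => zero_le_one.trans (one_le_pathLoc hv χ _)) (tendsto_tail_pathLoc_odd hv χ) ha
      (hm.symm.trans h)
    left
    rw [hO, hor.resolve_right (by rw [hO]; exact hpos.ne'), sub_zero]


end VRJP

/-! ### Transfer to the probability space carrying the clocks -/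

namespace VRJP

open Set

section

variable {Ω : Type*} [MeasurableSpace Ω] {P : Measure Ω} {χ : ℤ × ℤ → ℕ → Ω → ℝ} {w : ℝ → ℝ}

/-- The pair of oriented edge and index of the `n`-th waiting time used on `{0, 1}`. -/
def usedClock (n : ℕ) : OrientedEdge × ℕ :=
  (if Even n then ⟨(0, 1), by norm_num⟩ else ⟨(1, 0), by norm_num⟩, n / 2)

lemma edgeSeq_eq_usedClock (x : ℤ × ℤ → ℕ → ℝ) (n : ℕ) :
    edgeSeq x n = x (usedClock n).1 (usedClock n).2 := by
  simp only [edgeSeq, usedClock]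
  split_ifs <;> rfl

lemma usedClock_injective : Function.Injective usedClock := by
  intro m n h
  simp only [usedClock, Prod.mk.injEq] at h
  obtain ⟨h1, h2⟩ := h
  rcases Nat.even_or_odd m with hm | hm <;> rcases Nat.even_or_odd n with hn | hn
  · have := Nat.even_iff.1 hm
    have := Nat.even_iff.1 hn
    omega
  · rw [if_pos hm, if_neg (Nat.not_even_iff_odd.2 hn)] at h1
    simp at h1
  · rw [if_neg (Nat.not_even_iff_odd.2 hm), if_pos hn] at h1
    simp at h1
  · have := Nat.odd_iff.1 hm
    have := Nat.odd_iff.1 hn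
    omega

lemma measurable_edgeSeq (hχm : ∀ (e : OrientedEdge) (n : ℕ), Measurable (χ e n)) :
    Measurable fun ω => edgeSeq fun e n => χ e n ω :=
  measurable_pi_lambda _ fun n => by
    simp only [edgeSeq_eq_usedClock]
    exact hχm _ _

/-- Each clock is used at most once, so reading the independent family along the injective
`usedClock` gives an i.i.d. sequence. -/
lemma map_edgeSeq (hχm : ∀ (e : OrientedEdge) (n : ℕ), Measurable (χ e n))
    (hχlaw : ∀ (e : OrientedEdge) (n : ℕ), P.map (χ e n) = expMeasure 1)
    (hχind : iIndepFun (fun p : OrientedEdge × ℕ => χ p.1 p.2) P) :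
    P.map (fun ω => edgeSeq fun e n => χ e n ω) = expSeq := by
  have h := (hχind.precomp usedClock_injective).map_fun_eq_infinitePi_map fun n => hχm _ _
  simp only [hχlaw] at h
  have he : (fun ω => edgeSeq fun e n => χ e n ω)
      = fun ω n => χ (usedClock n).1 (usedClock n).2 ω :=
    funext fun ω => funext fun n => edgeSeq_eq_usedClock _ n
  rw [he]
  exact h

lemma ae_pos_of_law (hχm : ∀ (e : OrientedEdge) (n : ℕ), Measurable (χ e n))
    (hχlaw : ∀ (e : OrientedEdge) (n : ℕ), P.map (χ e n) = expMeasure 1) (e : OrientedEdge)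
    (n : ℕ) : ∀ᵐ ω ∂P, 0 < χ e n ω := by
  have h := ae_pos_expMeasure
  rw [← hχlaw e n] at h
  exact ae_of_ae_map (hχm e n).aemeasurable h

lemma ae_regularNoise (hχm : ∀ (e : OrientedEdge) (n : ℕ), Measurable (χ e n))
    (hχlaw : ∀ (e : OrientedEdge) (n : ℕ), P.map (χ e n) = expMeasure 1)
    (hχind : iIndepFun (fun p : OrientedEdge × ℕ => χ p.1 p.2) P) :
    ∀ᵐ ω ∂P, RegularNoise fun e n => χ e n ω := by
  have h := ae_unbounded_sum
  rw [← map_edgeSeq hχm hχlaw hχind] at h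
  have hpos := ae_pos_of_law hχm hχlaw
  filter_upwards [ae_of_ae_map (measurable_edgeSeq hχm).aemeasurable h,
    ae_all_iff.2 (hpos ⟨(0, 1), by norm_num⟩), ae_all_iff.2 (hpos ⟨(1, 0), by norm_num⟩),
    hpos ⟨(0, -1), by norm_num⟩ 0, hpos ⟨(1, 2), by norm_num⟩ 0] with ω h1 h2 h3 h4 h5
  exact ⟨⟨h2, h3, h4, h5⟩, h1⟩

lemma measure_pathBalance_eq (hw : WeightAssumption w)
    (hint : IntegrableOn (fun u => 1 / w u) (Ioi 1))
    (hmono : ∃ ρ : ℝ, 0 < ρ ∧ AntitoneOn (fun t => w t ^ ρ * ∫ s in Ioi t, 1 / w s) (Ici 1))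
    (hχm : ∀ (e : OrientedEdge) (n : ℕ), Measurable (χ e n))
    (hχlaw : ∀ (e : OrientedEdge) (n : ℕ), P.map (χ e n) = expMeasure 1)
    (hχind : iIndepFun (fun p : OrientedEdge × ℕ => χ p.1 p.2) P) (r : ℝ) :
    P {ω | pathBalance w (fun e n => χ e n ω) = r} = 0 := by
  obtain ⟨ρ, hρ, hanti⟩ := hmono
  have hv := hw.isReinforcement hint
  have h := hv.measure_balance_eq hw.strictMonoOn_frozen hρ (antitoneOn_frozen hanti)
    (s := (1, 1)) le_rfl le_rfl r
  have hs : MeasurableSet {e | balance (frozen w) (1, 1) e = r} :=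
    hv.measurable_balance _ (measurableSet_singleton r)
  rwa [← map_edgeSeq hχm hχlaw hχind, Measure.map_apply (measurable_edgeSeq hχm) hs] at h

lemma measurable_pathBalance (hv : IsReinforcement (frozen w))
    (hχm : ∀ (e : OrientedEdge) (n : ℕ), Measurable (χ e n)) :
    Measurable fun ω => pathBalance w fun e n => χ e n ω :=
  (hv.measurable_balance (1, 1)).comp (measurable_edgeSeq hχm)

lemma measurable_pathLoc (hv : IsReinforcement (frozen w))
    (hχm : ∀ (e : OrientedEdge) (n : ℕ), Measurable (χ e n)) (n : ℕ) :
    Measurable fun ω => pathLoc w (fun e n => χ e n ω) n :=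
  (IsReinforcement.measurable_section (1, 1) (hv.measurable_loc n)).comp (measurable_edgeSeq hχm)

end

end VRJP

open VRJP

theorem mainTheorem4 {Ω : Type*} [MeasurableSpace Ω] (P : Measure Ω) [IsProbabilityMeasure P]
    (w : ℝ → ℝ) (hw : VRJP.WeightAssumption w)
    (hint : IntegrableOn (fun u => 1 / w u) (Set.Ioi 1))
    (hmono : ∃ ρ : ℝ, 0 < ρ ∧
      AntitoneOn (fun t => w t ^ ρ * ∫ s in Set.Ioi t, 1 / w s) (Set.Ici 1))
    (χ : ℤ × ℤ → ℕ → Ω → ℝ)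
    (hχm : ∀ (e : VRJP.OrientedEdge) (n : ℕ), Measurable (χ e n))
    (hχlaw : ∀ (e : VRJP.OrientedEdge) (n : ℕ), P.map (χ e n) = expMeasure 1)
    (hχind : iIndepFun (fun p : VRJP.OrientedEdge × ℕ => χ p.1 p.2) P) :
    (∀ᵐ ω ∂P, Tendsto (VRJP.Z w (fun e n => χ e n ω)) atTop
      (𝓝 (VRJP.Zinfty w (fun e n => χ e n ω)))) ∧
    AEMeasurable (fun ω => VRJP.Zinfty w (fun e n => χ e n ω)) P ∧
    (∀ r : ℝ, P {ω | VRJP.Zinfty w (fun e n => χ e n ω) = r} = 0) ∧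
    (∀ᵐ ω ∂P, VRJP.minTotalLocalTime w (fun e n => χ e n ω) < ∞) ∧
    AEMeasurable (fun ω => VRJP.minTotalLocalTime w (fun e n => χ e n ω)) P ∧
    (∀ a : ℝ≥0∞, P.map (fun ω => VRJP.minTotalLocalTime w (fun e n => χ e n ω)) {a} = 0) := by
  have hv := hw.isReinforcement hint
  have hw0 := hw.map_zero
  have hreg := ae_regularNoise hχm hχlaw hχind
  have hne : ∀ r, ∀ᵐ ω ∂P, pathBalance w (fun e n => χ e n ω) ≠ r := fun r => by
    simpa only [ae_iff, ne_eq, not_not] using measure_pathBalance_eq hw hint hmono hχm hχlaw hχind r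
  have hZ : ∀ᵐ ω ∂P, Zinfty w (fun e n => χ e n ω) = pathBalance w fun e n => χ e n ω :=
    hreg.mono fun ω h => Zinfty_eq hw0 hv h
  have hfin : ∀ᵐ ω ∂P, minTotalLocalTime w (fun e n => χ e n ω) < ∞ := by
    filter_upwards [hreg, hne 0] with ω h h0
    exact minTotalLocalTime_lt_top hw0 hv h h0
  -- Needed beyond its own sake: `P.map` of a function that is not almost everywhere measurable is
  -- zero by default, which would make the statement on atoms empty.
  have hmin : AEMeasurable (fun ω => minTotalLocalTime w fun e n => χ e n ω) P :=
    ⟨_, (Measurable.iSup fun k => (measurable_pathLoc hv hχm (2 * k)).ennreal_ofReal).min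
      (Measurable.iSup fun k => (measurable_pathLoc hv hχm (2 * k + 1)).ennreal_ofReal),
      hreg.mono fun ω h => minTotalLocalTime_eq hw0 hv h⟩
  refine ⟨?_, ⟨_, measurable_pathBalance hv hχm, hZ⟩, fun r => ?_, hfin, hmin, fun a => ?_⟩
  · filter_upwards [hreg] with ω h
    rw [Zinfty_eq hw0 hv h]
    exact tendsto_Z hw0 hv h
  · have h : ∀ᵐ ω ∂P, ¬ Zinfty w (fun e n => χ e n ω) = r := by
      filter_upwards [hZ, hne r] with ω h1 h2
      rwa [h1]
    simpa only [ae_iff, not_not] using h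
  · rw [Measure.map_apply_of_aemeasurable hmin (measurableSet_singleton a)]
    have h : ∀ᵐ ω ∂P, ¬ minTotalLocalTime w (fun e n => χ e n ω) = a := by
      -- The value `∞` is excluded by finiteness; a finite `a` forces the balance into a set of two
      -- values, which is null.
      filter_upwards [hreg, hfin, hne (tail (frozen w) a.toReal),
        hne (-tail (frozen w) a.toReal)] with ω h1 h2 h3 h4 h5
      rcases pathBalance_eq_of_minTotalLocalTime_eq hw0 hv h1 (h5 ▸ h2.ne) h5 with h | h
      · exact h3 h
      · exact h4 h
    simp only [ae_iff, not_not] at h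
    exact h
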